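/- **Setting.** Let $\pi\colon E\to M$ be a fibred manifold (a smooth surjective submersion between finite-dimensional, Hausdorff, second countable smooth manifolds, with $n=\dim M$ and fibres of constant dimension $m$), and let $r,p,l\ge 0$ be integers. Let $J^r\pi$ be the manifold of $r$-jets of local sections of $\pi$, with the coordinates $(x^\lambda,u^i_\sigma)$, $|\sigma|\le r$, induced by fibred coordinates $(x^\lambda,u^i)$ of $E$, and let $\mathcal F_r=C^\infty(J^r\pi)$, so that $\mathcal F_0=C^\infty(E)$. * A point $\theta=j^{r+1}_xs$ of $J^{r+1}\pi$ over $\eta=j^r_xs\in J^r\pi$ determines a splitting of $T_\eta J^r\pi$ into the horizontal space $T_x(j_rs)(T_xM)$ and the space of vectors vertical over $M$. A *relative $k$-form* is a family $\alpha_\theta\in\Lambda^kT^*_\eta J^r\pi$, $\theta\in J^{r+1}\pi$. Relative forms are multiplied by functions in $\mathcal F_r$ through pull-back to $J^{r+1}\pi$. * $\bar\Lambda^l_r$ is the $\mathcal F_r$-module of all $h(\beta)$, where $\beta$ is a smooth $l$-form on $J^r\pi$ and $h(\beta)_\theta$ is $\beta_\eta$ composed with the horizontal projection in each argument ($\bar\Lambda^0_r=\mathcal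 F_r$). * $\mathcal C^p\Lambda^p_{r,r+1}$ is the $\mathcal F_r$-module of the relative $p$-forms that are locally sums of products $f\,\omega^{i_1}_{\sigma_1}\wedge\dots\wedge\omega^{i_p}_{\sigma_p}$, where $f$ is a smooth function on $J^r\pi$, $|\sigma_j|\le r$ and $\omega^i_\sigma=du^i_\sigma-u^i_{\sigma\lambda}\,dx^\lambda$. * $\mathcal C^p\Lambda^p_{r,r+1}\wedge\bar\Lambda^l_r$ is the $\mathcal F_r$-module of sections generated by the products $\gamma\wedge\beta$ with $\gamma\in\mathcal C^p\Lambda^p_{r,r+1}$ and $\beta\in\bar\Lambda^l_r$: the relative $(p+l)$-forms which, near each point of $J^r\pi$, are finite sums of such products. * $\varkappa_0$ is the $\mathcal F_0$-module of smooth vector fields on $E$ that are vertical over $M$. For $\varphi=\varphi^i\,\partial/\partial u^i\in\varkappa_0$, let $\mathrm{Evo}_\varphi=\sum_{|\sigma|\le r}D_\sigma\varphi^i\,\partial/\partial u^i_\sigma$, a vector field on $J^r\pi$, where $D_\sigma$ denotes the iterated total derivatives. * An $\mathbb R$-linear map $\Delta\colon\varkappa_0\to\bar\Lambda^l_r$ is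 a *differential operator of order $\le r$* if $[\delta_{a_0},[\dots,[\delta_{a_r},\Delta]\dots]]=0$ for all $a_0,\dots,a_r\in\mathcal F_0$, where $\delta_a$ is multiplication by $a$. It is *$\mathcal C$-differential* if for every local section $s$ of $\pi$ and every $\varphi\in\varkappa_0$ which vanishes along $s$, the form $\Delta(\varphi)$ vanishes at all points of $j_{r+1}s$. Let $\mathcal C\mathrm{Diff}^{\mathrm{alt}}_{(p)\,r}(\varkappa_0,\bar\Lambda^l_r)$ be the $\mathcal F_r$-module of the alternating $\mathbb R$-multilinear maps $\varkappa_0^{\,p}\to\bar\Lambda^l_r$ that are $\mathcal C$-differential operators of order $\le r$ in each argument. **Proposition.** For $\alpha\in\mathcal C^p\Lambda^p_{r,r+1}\wedge\bar\Lambda^l_r$ put $$\nabla_\alpha(\varphi_1,\dots,\varphi_p)=\mathrm{Evo}_{\varphi_1}\lrcorner(\dots\lrcorner(\mathrm{Evo}_{\varphi_p}\lrcorner\alpha)\dots).$$ Then $\alpha\mapsto\nabla_\alpha$ is a well-defined isomorphism of $\mathcal F_r$-modules $$\mathcal C^p\Lambda^p_{r,r+1}\wedge\bar\Lambda^l_r\;\longrightarrow\;\mathcal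 C\mathrm{Diff}^{\mathrm{alt}}_{(p)\,r}(\varkappa_0,\bar\Lambda^l_r).$$ It is natural. Let $\Psi\colon E\to E'$ be an isomorphism over $\mathrm{id}_M$ of fibred manifolds $\pi\colon E\to M$ and $\pi'\colon E'\to M$. Then the pull-back of relative forms along the prolongations of $\Psi$ maps $\mathcal C^p\Lambda^p_{r,r+1}\wedge\bar\Lambda^l_r$ of $\pi'$ into that of $\pi$. Moreover, if $\alpha'$ is an element of this module of $\pi'$, and the vertical fields $\varphi_i$ on $E$ and $\varphi'_i$ on $E'$ are $\Psi$-related, then $\Psi^*\big(\nabla_{\alpha'}(\varphi'_1,\dots,\varphi'_p)\big)=\nabla_{\Psi^*\alpha'}(\varphi_1,\dots,\varphi_p)$. -/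

import Mathlib

open Set Filter Topology
open scoped Manifold ContDiff

noncomputable section

namespace FiniteJet

/-! ### Symmetry of iterated derivatives -/

theorem iteratedFDeriv_succ_eval {B F : Type*} [NormedAddCommGroup B] [NormedSpace ℝ B]
    [NormedAddCommGroup F] [NormedSpace ℝ F] {f : B → F} (n : ℕ) (x : B)
    (hf : ContDiffAt ℝ (n + 1 : ℕ) f x) (v : Fin (n + 1) → B) :
    iteratedFDeriv ℝ (n + 1) f x v =
      fderiv ℝ (fun y => iteratedFDeriv ℝ n f y (Fin.tail v)) x (v 0) := by
  have hd : DifferentiableAt ℝ (iteratedFDeriv ℝ n f) x :=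
    (hf.iteratedFDeriv_right (m := 1) (by norm_cast; omega)).differentiableAt one_ne_zero
  have := (((ContinuousMultilinearMap.apply ℝ (fun _ : Fin n => B) F (Fin.tail v)).hasFDerivAt).comp
          x hd.hasFDerivAt).fderiv
  rw [iteratedFDeriv_succ_apply_left]
  exact (congrArg (fun L => L (v 0)) this).symm

theorem iteratedFDeriv_adj {B F : Type*} [NormedAddCommGroup B] [NormedSpace ℝ B]
    [NormedAddCommGroup F] [NormedSpace ℝ F] {f : B → F} (n : ℕ) (i : Fin n) (x : B)
    (hf : ContDiffAt ℝ (n + 1 : ℕ) f x) (v : Fin (n + 1) → B) :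
    iteratedFDeriv ℝ (n + 1) f x (v ∘ Equiv.swap i.castSucc i.succ) =
      iteratedFDeriv ℝ (n + 1) f x v := by
  induction n generalizing x with
  | zero => exact i.elim0
  | succ n ih =>
    have hev : ∀ᶠ y in 𝓝 x, ContDiffAt ℝ (n + 1 : ℕ) f y :=
      ((hf.of_le (by norm_cast; omega)).eventually (by simp))
    refine Fin.cases ?_ (fun i => ?_) i
    · have h2 : ∀ c, ContDiffAt ℝ 2 (fun y => iteratedFDeriv ℝ n f y c) x := fun c =>
        (ContinuousMultilinearMap.apply ℝ (fun _ : Fin n => B) F c).contDiff.contDiffAt.comp x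
          (hf.iteratedFDeriv_right (m := 2) (by norm_cast; omega))
      have key : ∀ w : Fin (n + 2) → B, iteratedFDeriv ℝ (n + 2) f x w =
          fderiv ℝ (fderiv ℝ (fun y => iteratedFDeriv ℝ n f y (fun j => w j.succ.succ))) x
            (w 0) (w 1) := by
        intro w
        have hd : DifferentiableAt ℝ
            (fderiv ℝ (fun y => iteratedFDeriv ℝ n f y (fun j => w j.succ.succ))) x :=
          ((h2 _).fderiv_right (m := 1) le_rfl).differentiableAt one_ne_zero
        rw [iteratedFDeriv_succ_eval _ _ hf]
        have : (fun y => iteratedFDeriv ℝ (n + 1) f y (Fin.tail w)) =ᶠ[𝓝 x]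
            fun y => fderiv ℝ (fun y => iteratedFDeriv ℝ n f y (fun j => w j.succ.succ)) y (w 1) := by
          filter_upwards [hev] with y hy
          exact iteratedFDeriv_succ_eval _ _ hy _
        rw [this.fderiv_eq, fderiv_clm_apply hd (differentiableAt_const _)]
        simp
      rw [key, key]
      have : ∀ j : Fin n, Equiv.swap (0 : Fin (n + 1)).castSucc (0 : Fin (n+1)).succ j.succ.succ
          = j.succ.succ := by
        intro j
        apply Equiv.swap_apply_of_ne_of_ne
        · simp [Fin.ext_iff]
        · simp [Fin.ext_iff]
      have h0 : Equiv.swap (0 : Fin (n + 1)).castSucc (0 : Fin (n+1)).succ 0 = 1 :=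
        Equiv.swap_apply_left _ _
      have h1 : Equiv.swap (0 : Fin (n + 1)).castSucc (0 : Fin (n+1)).succ 1 = 0 :=
        Equiv.swap_apply_right _ _
      simp only [Function.comp_apply, this, h0, h1]
      rw [((h2 _).isSymmSndFDerivAt (by simp)).eq]
    · rw [iteratedFDeriv_succ_eval _ _ hf, iteratedFDeriv_succ_eval _ _ hf]
      have s0 : (v ∘ Equiv.swap i.succ.castSucc i.succ.succ) 0 = v 0 := by
        simp only [Function.comp_apply]
        rw [Equiv.swap_apply_of_ne_of_ne] <;> simp [Fin.ext_iff]
      have st : Fin.tail (v ∘ Equiv.swap i.succ.castSucc i.succ.succ) =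
          Fin.tail v ∘ Equiv.swap i.castSucc i.succ := by
        funext j
        simp only [Fin.tail, Function.comp_apply]
        congr 1
        exact ((Fin.succ_injective (n+1)).map_swap i.castSucc i.succ j).symm
      rw [s0, st]
      congr 1
      apply Filter.EventuallyEq.fderiv_eq
      filter_upwards [hev] with y hy
      exact ih i y hy _

theorem iteratedFDeriv_comp_perm' {B F : Type*} [NormedAddCommGroup B] [NormedSpace ℝ B]
    [NormedAddCommGroup F] [NormedSpace ℝ F] {f : B → F} {x : B} (k : ℕ)
    (hf : ContDiffAt ℝ k f x) (σ : Equiv.Perm (Fin k)) (v : Fin k → B) :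
    iteratedFDeriv ℝ k f x (v ∘ σ) = iteratedFDeriv ℝ k f x v := by
  cases k with
  | zero => congr 1; funext i; exact i.elim0
  | succ n =>
    have hσ : σ ∈ Submonoid.closure
        (Set.range fun i : Fin n => Equiv.swap i.castSucc i.succ) := by
      rw [Equiv.Perm.mclosure_swap_castSucc_succ]; trivial
    induction hσ using Submonoid.closure_induction generalizing v with
    | mem σ h => obtain ⟨i, rfl⟩ := h; exact iteratedFDeriv_adj n i x hf v
    | one => rfl
    | mul σ τ _ _ h1 h2 =>
      rw [Equiv.Perm.coe_mul, ← Function.comp_assoc, h2, h1]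

/-! ### Symmetric multilinear maps -/

section Model

variable (B F : Type*) [NormedAddCommGroup B] [NormedSpace ℝ B]
  [NormedAddCommGroup F] [NormedSpace ℝ F]

/-- Symmetric `k`-linear maps from `B` to `F`: the values of the `k`-th derivative. -/
def symMul (k : ℕ) : Submodule ℝ (B [×k]→L[ℝ] F) where
  carrier := {f | ∀ (σ : Equiv.Perm (Fin k)) (v : Fin k → B), f (v ∘ σ) = f v}
  add_mem' := fun ha hb σ v => by simp [ha σ v, hb σ v]
  zero_mem' := fun σ v => by simp
  smul_mem' := fun c f hf σ v => by simp [hf σ v]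

/-- The type of symmetric `k`-linear maps, with the operator norm. -/
def SymMul (k : ℕ) : Type _ := symMul B F k

instance (k : ℕ) : NormedAddCommGroup (SymMul B F k) :=
  inferInstanceAs (NormedAddCommGroup (symMul B F k))

instance (k : ℕ) : NormedSpace ℝ (SymMul B F k) :=
  inferInstanceAs (NormedSpace ℝ (symMul B F k))

/-- The space of jet coordinates of order `r`: a base point together with the derivatives
`u_σ`, `|σ| = k`, collected in a symmetric `k`-linear map for each `k ≤ r`. -/
abbrev JetModel (r : ℕ) : Type _ := B × ((k : Fin (r + 1)) → SymMul B F k)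

variable {B F}

/-- The inclusion of symmetric `k`-linear maps into all `k`-linear maps. -/
def SymMul.inclL (k : ℕ) : SymMul B F k →L[ℝ] (B [×k]→L[ℝ] F) := (symMul B F k).subtypeL

/-- A symmetric `k`-linear map as a `k`-linear map. -/
def SymMul.incl {k : ℕ} (f : SymMul B F k) : B [×k]→L[ℝ] F := SymMul.inclL k f

/-- Constructor of symmetric `k`-linear maps. -/
def SymMul.mk {k : ℕ} (f : B [×k]→L[ℝ] F) (h : f ∈ symMul B F k) : SymMul B F k :=
  (⟨f, h⟩ : symMul B F k)

open Classical in
/-- A `k`-linear map viewed as a symmetric one (used only when it is symmetric). -/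
def toSym (k : ℕ) (f : B [×k]→L[ℝ] F) : SymMul B F k :=
  if h : f ∈ symMul B F k then SymMul.mk f h else 0

theorem coe_toSym {k : ℕ} {f : B [×k]→L[ℝ] F} (h : f ∈ symMul B F k) :
    (toSym k f).incl = f := by
  unfold toSym
  rw [dif_pos h]
  rfl

theorem toSym_coe {k : ℕ} (f : SymMul B F k) : toSym k f.incl = f := by
  have : f.incl ∈ symMul B F k := f.2
  unfold toSym
  rw [dif_pos this]
  rfl

theorem iteratedFDeriv_mem_symMul {f : B → F} {x : B} (k : ℕ) (hf : ContDiffAt ℝ ∞ f x) :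
    iteratedFDeriv ℝ k f x ∈ symMul B F k := fun σ v =>
  iteratedFDeriv_comp_perm' k (hf.of_le (by exact_mod_cast le_top)) σ v

/-- The formal power series with `k`-th derivative `u_k` for `k ≤ r`. -/
def polySeries {r : ℕ} (p : JetModel B F r) : FormalMultilinearSeries ℝ B F := fun k =>
  if h : k < r + 1 then ((k.factorial : ℝ)⁻¹) • (p.2 ⟨k, h⟩).incl else 0

/-- The polynomial map with prescribed derivatives at the base point. -/
def poly {r : ℕ} (p : JetModel B F r) (w : B) : F :=
  ∑ k ∈ Finset.range (r + 1), polySeries p k (fun _ => w - p.1)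

theorem hasFPowerSeries_poly {r : ℕ} (p : JetModel B F r) :
    HasFiniteFPowerSeriesOnBall (poly p) (polySeries p) p.1 (r + 1) ⊤ := by
  refine HasFiniteFPowerSeriesOnBall.mk' (fun m hm => ?_) (by simp) (fun y _ => ?_)
  · simp [polySeries, Nat.not_lt.2 hm]
  · simp [poly]

theorem contDiff_poly {r : ℕ} (p : JetModel B F r) : ContDiff ℝ ∞ (poly p) := by
  unfold poly
  refine ContDiff.sum fun k _ => ?_
  exact (polySeries p k).contDiff.comp (contDiff_pi.2 fun _ => contDiff_id.sub contDiff_const)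

theorem iteratedFDeriv_poly {r : ℕ} (p : JetModel B F r) (k : Fin (r + 1)) :
    iteratedFDeriv ℝ k (poly p) p.1 = (p.2 k).incl := by
  have hω : ContDiff ℝ ω (poly p) := by
    unfold poly
    refine ContDiff.sum fun k _ => ?_
    exact (polySeries p k).contDiff.comp (contDiff_pi.2 fun _ => contDiff_id.sub contDiff_const)
  ext v
  rw [(hasFPowerSeries_poly p).toHasFPowerSeriesOnBall.iteratedFDeriv_eq_sum
    hω.contDiffOn.analyticOn]
  have : ∀ σ : Equiv.Perm (Fin k), polySeries p k (fun i => v (σ i)) =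
      ((k : ℕ).factorial : ℝ)⁻¹ • (p.2 k).incl v := by
    intro σ
    have := (p.2 k).2 σ v
    simp only [polySeries, k.2, dif_pos]
    exact congrArg (fun y => ((k : ℕ).factorial : ℝ)⁻¹ • y) this
  rw [Finset.sum_congr rfl fun σ _ => this σ, Finset.sum_const, Finset.card_univ,
    Fintype.card_perm, Fintype.card_fin, ← Nat.cast_smul_eq_nsmul ℝ, smul_smul,
    mul_inv_cancel₀ (by positivity), one_smul]

/-- The value coordinate `u = u_0` of a point of the jet model. -/
def JetModel.value {r : ℕ} (p : JetModel B F r) : F :=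
  (p.2 0).incl (fun _ => 0)

theorem poly_base {r : ℕ} (p : JetModel B F r) : poly p p.1 = p.value := by
  have := congrArg (fun L => L (fun _ => 0)) (iteratedFDeriv_poly p 0)
  exact this

theorem contDiffAt_taylorComp {X G H : Type*} [NormedAddCommGroup X] [NormedSpace ℝ X]
    [NormedAddCommGroup G] [NormedSpace ℝ G] [NormedAddCommGroup H] [NormedSpace ℝ H] [CompleteSpace H]
    {q : X → FormalMultilinearSeries ℝ G H} {p : X → FormalMultilinearSeries ℝ B G}
    {x : X} {k : ℕ} (hq : ∀ j, j ≤ k → ContDiffAt ℝ ∞ (fun x => q x j) x)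
    (hp : ∀ j, j ≤ k → ContDiffAt ℝ ∞ (fun x => p x j) x) :
    ContDiffAt ℝ ∞ (fun x => (q x).taylorComp (p x) k) x := by
  refine ContDiffAt.sum fun c _ => ?_
  let L := c.compAlongOrderedFinpartitionL ℝ B G H
  have h1 := L.analyticOnNhd_uncurry_of_multilinear (s := univ)
    (q x c.length, fun m ↦ p x (c.partSize m)) (mem_univ _)
  change ContDiffAt ℝ ∞
    ((fun p ↦ L p.1 p.2) ∘ (fun x ↦ (q x c.length, fun m ↦ p x (c.partSize m)))) x
  refine h1.contDiffAt.comp x ?_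
  exact (hq _ c.length_le).prodMk (contDiffAt_pi.2 fun m => hp _ (c.partSize_le m))

theorem contDiffAt_toSym {X : Type*} [NormedAddCommGroup X] [NormedSpace ℝ X]
    [FiniteDimensional ℝ B] [FiniteDimensional ℝ F] {k : ℕ}
    {f : X → B [×k]→L[ℝ] F} {x : X} (hf : ContDiffAt ℝ ∞ f x)
    (hs : ∀ᶠ y in 𝓝 x, f y ∈ symMul B F k) :
    ContDiffAt ℝ ∞ (fun y => toSym k (f y)) x := by
  obtain ⟨P, hP⟩ := (symMul B F k).exists_isCompl
  let L : (B [×k]→L[ℝ] F) →ₗ[ℝ] SymMul B F k := Submodule.projectionOnto _ _ hP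
  have hL : ∀ y : symMul B F k, L y = y := Submodule.projectionOnto_apply_left hP
  have hfin : FiniteDimensional ℝ (B [×k]→L[ℝ] F) := by
    exact FiniteDimensional.of_injective
      (ContinuousMultilinearMap.toMultilinearMapLinear :
        (B [×k]→L[ℝ] F) →ₗ[ℝ] MultilinearMap ℝ (fun _ : Fin k => B) F)
      ContinuousMultilinearMap.toMultilinearMap_injective
  refine ((L.toContinuousLinearMap.contDiff.contDiffAt).comp x hf).congr_of_eventuallyEq ?_
  filter_upwards [hs] with y hy
  have := hL ⟨f y, hy⟩
  unfold toSym
  rw [dif_pos hy]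
  exact this.symm

end Model

/-! ### Fibred manifolds, adapted charts and local sections -/

section Jets

variable {B F M E : Type*}
  [NormedAddCommGroup B] [NormedSpace ℝ B] [NormedAddCommGroup F] [NormedSpace ℝ F]
  [TopologicalSpace M] [ChartedSpace B M] [TopologicalSpace E] [ChartedSpace (B × F) E]

variable (B F M E) in
/-- A fibred manifold `π : E → M`: a surjective submersion. Here `M` is modelled on `B` and
`E` on `B × F`. -/
structure FibredManifold where
  /-- The projection `π`. -/
  proj : E → M
  surjective : Function.Surjective proj
  submersion : Manifold.IsSubmersion 𝓘(ℝ, B × F) 𝓘(ℝ, B) ∞ proj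

/-- A chart `(x^λ, u^i)` of `E` adapted to the fibring, together with the induced chart
`(x^λ)` of `M`. -/
structure AdaptedChart (π : FibredManifold B F M E) where
  /-- The chart of the total space. -/
  tot : OpenPartialHomeomorph E (B × F)
  /-- The chart of the base. -/
  base : OpenPartialHomeomorph M B
  tot_mem : tot ∈ IsManifold.maximalAtlas 𝓘(ℝ, B × F) ∞ E
  base_mem : base ∈ IsManifold.maximalAtlas 𝓘(ℝ, B) ∞ M
  proj_mem : ∀ y ∈ tot.source, π.proj y ∈ base.source
  base_proj : ∀ y ∈ tot.source, base (π.proj y) = (tot y).1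

/-- A smooth local section of `π`, defined on the open set `dom` (its values outside `dom` are
irrelevant). -/
structure LocalSection (π : FibredManifold B F M E) where
  /-- The underlying map. -/
  toFun : M → E
  /-- The domain. -/
  dom : Set M
  isOpen_dom : IsOpen dom
  smooth : ContMDiffOn 𝓘(ℝ, B) 𝓘(ℝ, B × F) ∞ toFun dom
  proj_apply : ∀ x ∈ dom, π.proj (toFun x) = x

/-- A local section with a point of its domain: a representative of a jet. -/
structure PointedSection (π : FibredManifold B F M E) where
  /-- The section. -/
  sec : LocalSection π
  /-- The point. -/
  pt : M
  mem : pt ∈ sec.dom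

variable {π : FibredManifold B F M E}

/-- The components `u^i ∘ s` of a section, as functions of the base coordinates. -/
def AdaptedChart.rep (c : AdaptedChart π) (s : LocalSection π) (z : B) : F :=
  (c.tot (s.toFun (c.base.symm z))).2

/-- Two pointed local sections have the same `r`-jet: same base point, same value, and in all
adapted charts the same derivatives up to order `r`. -/
def JetEquiv (r : ℕ) (a b : PointedSection π) : Prop :=
  a.pt = b.pt ∧ a.sec.toFun a.pt = b.sec.toFun b.pt ∧
    ∀ c : AdaptedChart π, a.sec.toFun a.pt ∈ c.tot.source → ∀ k ≤ r,
      iteratedFDeriv ℝ k (c.rep a.sec) (c.base a.pt) =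
        iteratedFDeriv ℝ k (c.rep b.sec) (c.base b.pt)

variable (π) in
/-- The relation of having the same `r`-jet. -/
def jetSetoid (r : ℕ) : Setoid (PointedSection π) where
  r := JetEquiv r
  iseqv :=
    { refl := fun _ => ⟨rfl, rfl, fun _ _ _ _ => rfl⟩
      symm := fun h => ⟨h.1.symm, h.2.1.symm, fun c hc k hk => (h.2.2 c (h.2.1 ▸ hc) k hk).symm⟩
      trans := fun h h' => ⟨h.1.trans h'.1, h.2.1.trans h'.2.1, fun c hc k hk =>
        (h.2.2 c hc k hk).trans (h'.2.2 c (h.2.1 ▸ hc) k hk)⟩ }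

variable (π) in
/-- The `r`-th jet space `J^r π`. -/
def Jet (r : ℕ) : Type _ := Quotient (jetSetoid π r)

/-- The jet `j^r_x s`. -/
def jetMk (r : ℕ) (a : PointedSection π) : Jet π r := Quotient.mk (jetSetoid π r) a

/-- A representative of a jet. -/
def Jet.rep {r : ℕ} (θ : Jet π r) : PointedSection π := Quotient.out θ

theorem jetMk_rep {r : ℕ} (θ : Jet π r) : jetMk r θ.rep = θ := Quotient.out_eq θ

theorem rep_jetMk {r : ℕ} (a : PointedSection π) : JetEquiv r (jetMk r a).rep a :=
  Quotient.mk_out (s := jetSetoid π r) a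

/-- The projection `π^r : J^r π → M`. -/
def Jet.base {r : ℕ} (θ : Jet π r) : M := θ.rep.pt

/-- The projection `π^r_0 : J^r π → E`. -/
def Jet.toE {r : ℕ} (θ : Jet π r) : E := θ.rep.sec.toFun θ.rep.pt

/-- The projection `π^{r+1}_r : J^{r+1} π → J^r π`. -/
def Jet.proj {r : ℕ} (θ : Jet π (r + 1)) : Jet π r := jetMk r θ.rep

/-! ### The manifold structure of the jet spaces -/

namespace AdaptedChart

/-- The derivative coordinates of the `r`-jet of a pointed section. -/
def coords (c : AdaptedChart π) (r : ℕ) (a : PointedSection π) : JetModel B F r :=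
  (c.base a.pt, fun k => toSym k (iteratedFDeriv ℝ k (c.rep a.sec) (c.base a.pt)))

theorem fst_tot_sec (c : AdaptedChart π) (s : LocalSection π) {x : M} (hx : x ∈ s.dom)
    (h : s.toFun x ∈ c.tot.source) : (c.tot (s.toFun x)).1 = c.base x := by
  rw [← c.base_proj _ h, s.proj_apply x hx]

theorem base_mem_source (c : AdaptedChart π) (s : LocalSection π) {x : M} (hx : x ∈ s.dom)
    (h : s.toFun x ∈ c.tot.source) : x ∈ c.base.source := by
  have := c.proj_mem _ h
  rwa [s.proj_apply x hx] at this

theorem contDiffAt_rep (c : AdaptedChart π) (s : LocalSection π) {x : M} (hx : x ∈ s.dom)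
    (h : s.toFun x ∈ c.tot.source) : ContDiffAt ℝ ∞ (c.rep s) (c.base x) := by
  have hb := c.base_mem_source s hx h
  have e : c.base.symm (c.base x) = x := c.base.left_inv hb
  have h1 : ContMDiffAt 𝓘(ℝ, B) 𝓘(ℝ, B) ∞ c.base.symm (c.base x) :=
    contMDiffAt_symm_of_mem_maximalAtlas c.base_mem (c.base.map_source hb)
  have h2 : ContMDiffAt 𝓘(ℝ, B) 𝓘(ℝ, B × F) ∞ s.toFun (c.base.symm (c.base x)) := by
    rw [e]; exact s.smooth.contMDiffAt (s.isOpen_dom.mem_nhds hx)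
  have h3 : ContMDiffAt 𝓘(ℝ, B × F) 𝓘(ℝ, B × F) ∞ c.tot
      (s.toFun (c.base.symm (c.base x))) := by
    rw [e]; exact contMDiffAt_of_mem_maximalAtlas c.tot_mem h
  have h4 := (h3.comp (c.base x) (h2.comp (c.base x) h1)).contDiffAt
  exact contDiff_snd.contDiffAt.comp (c.base x) h4

theorem coe_coords (c : AdaptedChart π) (r : ℕ) (a : PointedSection π)
    (h : a.sec.toFun a.pt ∈ c.tot.source) (k : Fin (r + 1)) :
    ((c.coords r a).2 k).incl =
      iteratedFDeriv ℝ k (c.rep a.sec) (c.base a.pt) :=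
  coe_toSym (iteratedFDeriv_mem_symMul _ (c.contDiffAt_rep a.sec a.mem h))

theorem coords_value (c : AdaptedChart π) (r : ℕ) (a : PointedSection π)
    (h : a.sec.toFun a.pt ∈ c.tot.source) :
    (c.coords r a).value = c.rep a.sec (c.base a.pt) := by
  unfold JetModel.value
  rw [c.coe_coords r a h 0]
  rfl

theorem coords_point (c : AdaptedChart π) (r : ℕ) (a : PointedSection π)
    (h : a.sec.toFun a.pt ∈ c.tot.source) :
    ((c.coords r a).1, (c.coords r a).value) = c.tot (a.sec.toFun a.pt) := by
  have hb := c.base_mem_source _ a.mem h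
  rw [c.coords_value r a h]
  refine Prod.ext (c.fst_tot_sec _ a.mem h).symm ?_
  simp [rep, c.base.left_inv hb]

theorem coords_congr (c : AdaptedChart π) {r : ℕ} {a b : PointedSection π}
    (h : JetEquiv r a b) (ha : a.sec.toFun a.pt ∈ c.tot.source) :
    c.coords r a = c.coords r b := by
  refine Prod.ext (by simp [coords, h.1]) ?_
  funext k
  simp only [coords]
  rw [h.2.2 c ha k (Nat.lt_succ_iff.1 k.2)]

/-- The fibre component of the change of adapted coordinates. -/
def fibTrans (c c' : AdaptedChart π) (p : B × F) : F := (c'.tot (c.tot.symm p)).2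

/-- The change of base coordinates. -/
def baseTrans (c c' : AdaptedChart π) (z : B) : B := c'.base (c.base.symm z)

theorem contDiffAt_fibTrans (c c' : AdaptedChart π) {p : B × F} (hp : p ∈ c.tot.target)
    (hp' : c.tot.symm p ∈ c'.tot.source) : ContDiffAt ℝ ∞ (fibTrans c c') p := by
  have h1 : ContMDiffAt 𝓘(ℝ, B × F) 𝓘(ℝ, B × F) ∞ c.tot.symm p :=
    contMDiffAt_symm_of_mem_maximalAtlas c.tot_mem hp
  have h2 : ContMDiffAt 𝓘(ℝ, B × F) 𝓘(ℝ, B × F) ∞ c'.tot (c.tot.symm p) :=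
    contMDiffAt_of_mem_maximalAtlas c'.tot_mem hp'
  exact contDiff_snd.contDiffAt.comp p (h2.comp p h1).contDiffAt

theorem contDiffAt_baseTrans (c c' : AdaptedChart π) {z : B} (hz : z ∈ c.base.target)
    (hz' : c.base.symm z ∈ c'.base.source) : ContDiffAt ℝ ∞ (baseTrans c c') z := by
  have h1 : ContMDiffAt 𝓘(ℝ, B) 𝓘(ℝ, B) ∞ c.base.symm z :=
    contMDiffAt_symm_of_mem_maximalAtlas c.base_mem hz
  have h2 : ContMDiffAt 𝓘(ℝ, B) 𝓘(ℝ, B) ∞ c'.base (c.base.symm z) :=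
    contMDiffAt_of_mem_maximalAtlas c'.base_mem hz'
  exact (h2.comp z h1).contDiffAt

/-- The Taylor series of `z ↦ (z, f z)`, from that of `f`. -/
def pairSeries (z : B) (q : FormalMultilinearSeries ℝ B F) :
    FormalMultilinearSeries ℝ B (B × F) := fun j =>
  (iteratedFDeriv ℝ j (fun w : B => w) z).prod (q j)

/-- The Taylor series of the transformed section, from that of the section. -/
def transSeries (c c' : AdaptedChart π) (z : B) (u : F) (q : FormalMultilinearSeries ℝ B F) :
    FormalMultilinearSeries ℝ B F :=
  (ftaylorSeries ℝ (fibTrans c c') (z, u)).taylorComp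
    ((pairSeries z q).taylorComp (ftaylorSeries ℝ (baseTrans c' c) (baseTrans c c' z)))

theorem taylorComp_congr {G H : Type*} [NormedAddCommGroup G] [NormedSpace ℝ G]
    [NormedAddCommGroup H] [NormedSpace ℝ H] {q q' : FormalMultilinearSeries ℝ G H}
    {p p' : FormalMultilinearSeries ℝ B G} {k : ℕ} (hq : ∀ j ≤ k, q j = q' j)
    (hp : ∀ j ≤ k, p j = p' j) : q.taylorComp p k = q'.taylorComp p' k := by
  refine Finset.sum_congr rfl fun c _ => ?_
  simp only [FormalMultilinearSeries.compAlongOrderedFinpartition]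
  rw [hq _ c.length_le]
  congr 1
  funext m
  exact hp _ (c.partSize_le m)

theorem transSeries_congr (c c' : AdaptedChart π) (z : B) (u : F)
    {q q' : FormalMultilinearSeries ℝ B F} {k : ℕ} (h : ∀ j ≤ k, q j = q' j) :
    transSeries c c' z u q k = transSeries c c' z u q' k := by
  refine taylorComp_congr (fun _ _ => rfl) fun j hj => ?_
  refine taylorComp_congr (fun i hi => ?_) fun _ _ => rfl
  simp only [pairSeries]
  rw [h i (hi.trans hj)]

theorem rep_eventuallyEq (c c' : AdaptedChart π) (s : LocalSection π) {x : M} (hx : x ∈ s.dom)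
    (h : s.toFun x ∈ c.tot.source) (h' : s.toFun x ∈ c'.tot.source) :
    c'.rep s =ᶠ[𝓝 (c'.base x)]
      fibTrans c c' ∘ ((fun z => (z, c.rep s z)) ∘ baseTrans c' c) := by
  have hb := c.base_mem_source s hx h
  have hb' := c'.base_mem_source s hx h'
  have e : c'.base.symm (c'.base x) = x := c'.base.left_inv hb'
  have hc : ContinuousAt c'.base.symm (c'.base x) :=
    c'.base.continuousAt_symm (c'.base.map_source hb')
  have hs : ContinuousAt s.toFun x :=
    (s.smooth.contMDiffAt (s.isOpen_dom.mem_nhds hx)).continuousAt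
  have ev1 : ∀ᶠ y in 𝓝 x, y ∈ s.dom := s.isOpen_dom.mem_nhds hx
  have ev2 : ∀ᶠ y in 𝓝 x, s.toFun y ∈ c.tot.source :=
    hs.eventually (c.tot.open_source.mem_nhds h)
  have ev := hc.eventually (p := fun y => y ∈ s.dom ∧ s.toFun y ∈ c.tot.source)
    (by rw [e]; exact ev1.and ev2)
  filter_upwards [ev] with w hw
  obtain ⟨hw1, hw2⟩ := hw
  have hw3 := c.base_mem_source s hw1 hw2
  have : (baseTrans c' c w, c.rep s (baseTrans c' c w)) = c.tot (s.toFun (c'.base.symm w)) := by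
    refine Prod.ext (c.fst_tot_sec s hw1 hw2).symm ?_
    simp only [rep, baseTrans, c.base.left_inv hw3]
  simp only [Function.comp_apply, this, fibTrans, c.tot.left_inv hw2]
  rfl

theorem iteratedFDeriv_rep_trans (c c' : AdaptedChart π) (s : LocalSection π) {x : M}
    (hx : x ∈ s.dom) (h : s.toFun x ∈ c.tot.source) (h' : s.toFun x ∈ c'.tot.source) (k : ℕ) :
    iteratedFDeriv ℝ k (c'.rep s) (c'.base x) =
      transSeries c c' (c.base x) (c.rep s (c.base x))
        (ftaylorSeries ℝ (c.rep s) (c.base x)) k := by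
  have hb := c.base_mem_source s hx h
  have hb' := c'.base_mem_source s hx h'
  have e : c'.base.symm (c'.base x) = x := c'.base.left_inv hb'
  have e2 : baseTrans c' c (c'.base x) = c.base x := by simp [baseTrans, e]
  have e3 : baseTrans c c' (c.base x) = c'.base x := by simp [baseTrans, c.base.left_inv hb]
  have pt : (c.base x, c.rep s (c.base x)) = c.tot (s.toFun x) := by
    refine Prod.ext (c.fst_tot_sec s hx h).symm ?_
    simp only [rep, c.base.left_inv hb]
  have h1 : ContDiffAt ℝ ∞ (baseTrans c' c) (c'.base x) :=
    contDiffAt_baseTrans c' c (c'.base.map_source hb') (by rwa [e])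
  have h2 : ContDiffAt ℝ ∞ (fun z => (z, c.rep s z)) (baseTrans c' c (c'.base x)) := by
    rw [e2]; exact contDiffAt_id.prodMk (c.contDiffAt_rep s hx h)
  have h3 : ContDiffAt ℝ ∞ (fibTrans c c') (((fun z => (z, c.rep s z)) ∘ baseTrans c' c)
      (c'.base x)) := by
    simp only [Function.comp_apply, e2, pt]
    exact contDiffAt_fibTrans c c' (c.tot.map_source h) (by rwa [c.tot.left_inv h])
  rw [Filter.EventuallyEq.eq_of_nhds ((rep_eventuallyEq c c' s hx h h').iteratedFDeriv ℝ k),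
    iteratedFDeriv_comp h3 (h2.comp _ h1) (by exact_mod_cast le_top)]
  simp only [Function.comp_apply, e2, transSeries, e3]
  refine taylorComp_congr (fun _ _ => rfl) fun j hj => ?_
  rw [ftaylorSeries, iteratedFDeriv_comp h2 h1 (by exact_mod_cast le_top)]
  refine taylorComp_congr (fun i hi => ?_) fun _ _ => rfl
  simp only [ftaylorSeries, e2, pairSeries]
  exact iteratedFDeriv_prodMk contDiffAt_id (c.contDiffAt_rep s hx h)
    (by exact_mod_cast le_top)

/-- The formal series of a point of the jet model. -/
def jetSeries {r : ℕ} (p : JetModel B F r) : FormalMultilinearSeries ℝ B F := fun k =>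
  if h : k < r + 1 then (p.2 ⟨k, h⟩).incl else 0

/-- The change of jet coordinates induced by a change of adapted charts. -/
def transMap (c c' : AdaptedChart π) (r : ℕ) (p : JetModel B F r) : JetModel B F r :=
  (baseTrans c c' p.1, fun k => toSym k (transSeries c c' p.1 p.value (jetSeries p) k))

theorem transSeries_coords (c c' : AdaptedChart π) (r : ℕ) (a : PointedSection π)
    (h : a.sec.toFun a.pt ∈ c.tot.source) (h' : a.sec.toFun a.pt ∈ c'.tot.source)
    (k : Fin (r + 1)) :
    transSeries c c' (c.coords r a).1 (c.coords r a).value (jetSeries (c.coords r a)) k =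
      iteratedFDeriv ℝ k (c'.rep a.sec) (c'.base a.pt) := by
  rw [iteratedFDeriv_rep_trans c c' a.sec a.mem h h', c.coords_value r a h]
  refine transSeries_congr _ _ _ _ fun j hj => ?_
  have : j < r + 1 := lt_of_le_of_lt hj k.2
  simp only [jetSeries, this, dif_pos]
  exact c.coe_coords r a h ⟨j, this⟩

theorem coords_trans (c c' : AdaptedChart π) (r : ℕ) (a : PointedSection π)
    (h : a.sec.toFun a.pt ∈ c.tot.source) (h' : a.sec.toFun a.pt ∈ c'.tot.source) :
    c'.coords r a = transMap c c' r (c.coords r a) := by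
  refine Prod.ext ?_ ?_
  · simp [coords, transMap, baseTrans, c.base.left_inv (c.base_mem_source _ a.mem h)]
  · funext k
    simp only [transMap]
    rw [transSeries_coords c c' r a h h']
    rfl

theorem jetEquiv_of_coords (c : AdaptedChart π) {r : ℕ} {a b : PointedSection π}
    (ha : a.sec.toFun a.pt ∈ c.tot.source) (hb : b.sec.toFun b.pt ∈ c.tot.source)
    (h : c.coords r a = c.coords r b) : JetEquiv r a b := by
  have hv : a.sec.toFun a.pt = b.sec.toFun b.pt := by
    apply c.tot.injOn ha hb
    rw [← c.coords_point r a ha, ← c.coords_point r b hb, h]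
  refine ⟨?_, hv, fun c' hc' k hk => ?_⟩
  · rw [← a.sec.proj_apply a.pt a.mem, ← b.sec.proj_apply b.pt b.mem, hv]
  · have := transSeries_coords c c' r a ha hc' ⟨k, Nat.lt_succ_iff.2 hk⟩
    have h2 := transSeries_coords c c' r b hb (hv ▸ hc') ⟨k, Nat.lt_succ_iff.2 hk⟩
    rw [← this, ← h2, h]

/-- The local section which is polynomial in an adapted chart, with prescribed derivatives. -/
def polySection (c : AdaptedChart π) {r : ℕ} (p : JetModel B F r) : LocalSection π where
  toFun := fun y => c.tot.symm (c.base y, poly p (c.base y))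
  dom := c.base.source ∩ c.base ⁻¹' {z | (z, poly p z) ∈ c.tot.target}
  isOpen_dom := c.base.isOpen_inter_preimage
    (c.tot.open_target.preimage (continuous_id.prodMk (contDiff_poly p).continuous))
  smooth := by
    intro y hy
    have h1 : ContMDiffAt 𝓘(ℝ, B) 𝓘(ℝ, B) ∞ c.base y :=
      contMDiffAt_of_mem_maximalAtlas c.base_mem hy.1
    have h2 : ContMDiffAt 𝓘(ℝ, B) 𝓘(ℝ, B × F) ∞ (fun z => (z, poly p z)) (c.base y) :=
      (contDiff_id.prodMk (contDiff_poly p)).contMDiff.contMDiffAt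
    have h3 : ContMDiffAt 𝓘(ℝ, B × F) 𝓘(ℝ, B × F) ∞ c.tot.symm
        (c.base y, poly p (c.base y)) :=
      contMDiffAt_symm_of_mem_maximalAtlas c.tot_mem hy.2
    exact (h3.comp y (h2.comp y h1)).contMDiffWithinAt
  proj_apply := by
    intro y hy
    have h1 := c.tot.map_target hy.2
    apply c.base.injOn (c.proj_mem _ h1) hy.1
    rw [c.base_proj _ h1, c.tot.right_inv hy.2]

theorem target_base (c : AdaptedChart π) {q : B × F} (hq : q ∈ c.tot.target) :
    q.1 ∈ c.base.target := by
  have h1 := c.tot.map_target hq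
  have := c.base.map_source (c.proj_mem _ h1)
  rwa [c.base_proj _ h1, c.tot.right_inv hq] at this

/-- The polynomial section, pointed at the base point of the jet coordinates. -/
def polyPointed (c : AdaptedChart π) {r : ℕ} (p : JetModel B F r)
    (hp : (p.1, p.value) ∈ c.tot.target) : PointedSection π where
  sec := c.polySection p
  pt := c.base.symm p.1
  mem := by
    have h := c.target_base hp
    refine ⟨c.base.map_target h, ?_⟩
    simp only [mem_preimage, c.base.right_inv h, mem_ofPred_eq, poly_base]
    exact hp

theorem polyPointed_val (c : AdaptedChart π) {r : ℕ} (p : JetModel B F r)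
    (hp : (p.1, p.value) ∈ c.tot.target) :
    (c.polyPointed p hp).sec.toFun (c.polyPointed p hp).pt = c.tot.symm (p.1, p.value) := by
  simp only [polyPointed, polySection, c.base.right_inv (c.target_base hp), poly_base]

theorem polyPointed_mem (c : AdaptedChart π) {r : ℕ} (p : JetModel B F r)
    (hp : (p.1, p.value) ∈ c.tot.target) :
    (c.polyPointed p hp).sec.toFun (c.polyPointed p hp).pt ∈ c.tot.source := by
  rw [polyPointed_val]; exact c.tot.map_target hp

theorem coords_polyPointed (c : AdaptedChart π) {r : ℕ} (p : JetModel B F r)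
    (hp : (p.1, p.value) ∈ c.tot.target) : c.coords r (c.polyPointed p hp) = p := by
  have hb := c.base.right_inv (c.target_base hp)
  refine Prod.ext hb ?_
  funext k
  have hr : c.rep (c.polySection p) =ᶠ[𝓝 p.1] poly p := by
    have e1 : ∀ᶠ z in 𝓝 p.1, z ∈ c.base.target :=
      c.base.open_target.mem_nhds (c.target_base hp)
    have e2 : ∀ᶠ z in 𝓝 p.1, (z, poly p z) ∈ c.tot.target := by
      refine (continuous_id.prodMk (contDiff_poly p).continuous).continuousAt.eventually ?_
      exact c.tot.open_target.mem_nhds (by simpa [poly_base] using hp)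
    filter_upwards [e1, e2] with z h1 h2
    simp only [rep, polySection, c.base.right_inv h1, c.tot.right_inv h2]
  simp only [coords, polyPointed, hb]
  rw [Filter.EventuallyEq.eq_of_nhds (hr.iteratedFDeriv ℝ k), iteratedFDeriv_poly, toSym_coe]

theorem contDiff_coord {r : ℕ} (k : Fin (r + 1)) :
    ContDiff ℝ ∞ (fun p : JetModel B F r => (p.2 k).incl) := by
  have h : ContDiff ℝ ∞ (fun p : JetModel B F r => p.2 k) := contDiff_pi.1 contDiff_snd k
  exact (SymMul.inclL k).contDiff.comp h

theorem contDiffAt_transMap [FiniteDimensional ℝ B] [FiniteDimensional ℝ F]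
    (c c' : AdaptedChart π) {r : ℕ} {p : JetModel B F r}
    (hp : (p.1, p.value) ∈ c.tot.target)
    (hp' : c.tot.symm (p.1, p.value) ∈ c'.tot.source) :
    ContDiffAt ℝ ∞ (transMap c c' r) p := by
  have hval : ContDiff ℝ ∞ (fun p : JetModel B F r => p.value) := by
    exact (ContinuousMultilinearMap.apply ℝ (fun _ : Fin ((0 : Fin (r + 1)) : ℕ) => B) F
      (fun _ => 0)).contDiff.comp (contDiff_coord 0)
  have hpair : ContDiff ℝ ∞ (fun p : JetModel B F r => (p.1, p.value)) :=
    contDiff_fst.prodMk hval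
  have hb := c.target_base hp
  have hs := c.tot.map_target hp
  have hbb : c.base.symm p.1 ∈ c'.base.source := by
    have h := c'.proj_mem _ hp'
    have e : c.base.symm p.1 = π.proj (c.tot.symm (p.1, p.value)) := by
      apply c.base.injOn (c.base.map_target hb) (c.proj_mem _ hs)
      rw [c.base.right_inv hb, c.base_proj _ hs, c.tot.right_inv hp]
    rwa [e]
  have hbb2 : baseTrans c c' p.1 ∈ c'.base.target := c'.base.map_source hbb
  have ev : ∀ᶠ p' : JetModel B F r in 𝓝 p, (p'.1, p'.value) ∈ c.tot.target ∧
      c.tot.symm (p'.1, p'.value) ∈ c'.tot.source := by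
    have ho : IsOpen (c.tot.symm ≫ₕ c'.tot).source := (c.tot.symm ≫ₕ c'.tot).open_source
    have := hpair.continuous.continuousAt.eventually (ho.mem_nhds (by
      rw [OpenPartialHomeomorph.trans_source]; exact ⟨hp, hp'⟩))
    filter_upwards [this] with p' h
    rw [OpenPartialHomeomorph.trans_source] at h
    exact h
  have hbt : ContDiffAt ℝ ∞ (baseTrans c c') p.1 := contDiffAt_baseTrans c c' hb hbb
  refine (hbt.comp p contDiffAt_fst).prodMk (contDiffAt_pi.2 fun k => ?_)
  refine contDiffAt_toSym ?_ ?_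
  · refine contDiffAt_taylorComp (fun j hj => ?_) (fun j hj => ?_)
    · exact ((contDiffAt_fibTrans c c' hp hp').iteratedFDeriv_right (m := ∞)
        (by exact_mod_cast le_top)).comp p hpair.contDiffAt
    · refine contDiffAt_taylorComp (fun i hi => ?_) (fun i hi => ?_)
      · have h1 : ContDiff ℝ ∞ (iteratedFDeriv ℝ i (fun w : B => w)) :=
          (contDiff_id (𝕜 := ℝ) (E := B) (n := ∞)).iteratedFDeriv_right (m := ∞) (by exact_mod_cast le_top)
        have hir : i < r + 1 := lt_of_le_of_lt (hi.trans hj) k.2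
        have h2 : ContDiff ℝ ∞ (fun p : JetModel B F r => jetSeries p i) := by
          simp only [jetSeries, hir, dif_pos]
          exact contDiff_coord ⟨i, hir⟩
        have h3 : ContDiff ℝ ∞ (ContinuousMultilinearMap.prodL ℝ (fun _ : Fin i => B) B F) :=
          LinearIsometryEquiv.contDiff _
        have h4 : ContDiff ℝ ∞ (fun p : JetModel B F r =>
            iteratedFDeriv ℝ i (fun w : B => w) p.1) := h1.comp contDiff_fst
        exact (h3.comp (h4.prodMk h2)).contDiffAt
      · have e : baseTrans c' c (baseTrans c c' p.1) = p.1 := by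
          simp only [baseTrans, c'.base.left_inv hbb, c.base.right_inv hb]
        have h1 : ContDiffAt ℝ ∞ (baseTrans c' c) (baseTrans c c' p.1) := by
          refine contDiffAt_baseTrans c' c hbb2 ?_
          simp only [baseTrans, c'.base.left_inv hbb]
          exact c.base.map_target hb
        have h2 := h1.iteratedFDeriv_right (i := i) (m := ∞) (by exact_mod_cast le_top)
        exact ContDiffAt.comp p (f := fun p : JetModel B F r => baseTrans c c' p.1) h2
          (hbt.comp p contDiffAt_fst)
  · filter_upwards [ev] with p' h
    have h1 := c.polyPointed_mem p' h.1
    have h2 : (c.polyPointed p' h.1).sec.toFun (c.polyPointed p' h.1).pt ∈ c'.tot.source := by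
      rw [polyPointed_val]; exact h.2
    have h3 := transSeries_coords c c' r (c.polyPointed p' h.1) h1 h2 k
    rw [coords_polyPointed] at h3
    rw [h3]
    exact iteratedFDeriv_mem_symMul _ (c'.contDiffAt_rep _ (c.polyPointed p' h.1).mem h2)

end AdaptedChart

theorem toE_jetMk (r : ℕ) (a : PointedSection π) :
    (jetMk r a).toE = a.sec.toFun a.pt := (rep_jetMk a).2.1

open Classical in
/-- The chart `(x^λ, u^i_σ)`, `|σ| ≤ r`, of `J^r π` induced by an adapted chart. (The jet `θ₀` is
only used as a value of the inverse outside of the target.) -/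
def AdaptedChart.jetChart (c : AdaptedChart π) (r : ℕ) (θ₀ : Jet π r) :
    PartialEquiv (Jet π r) (JetModel B F r) where
  toFun := fun θ => c.coords r θ.rep
  invFun := fun p =>
    if h : (p.1, p.value) ∈ c.tot.target then jetMk r (c.polyPointed p h) else θ₀
  source := {θ | θ.toE ∈ c.tot.source}
  target := {p | (p.1, p.value) ∈ c.tot.target}
  map_source' := by
    intro θ hθ
    have := c.coords_point r θ.rep hθ
    change (_, _) ∈ c.tot.target
    rw [this]
    exact c.tot.map_source hθ
  map_target' := by
    intro p hp
    have hp : (p.1, p.value) ∈ c.tot.target := hp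
    change (dite _ _ _ : Jet π r).toE ∈ c.tot.source
    rw [dif_pos hp, toE_jetMk]
    exact c.polyPointed_mem p hp
  left_inv' := by
    intro θ hθ
    have hp : ((c.coords r θ.rep).1, (c.coords r θ.rep).value) ∈ c.tot.target := by
      rw [c.coords_point r θ.rep hθ]
      exact c.tot.map_source hθ
    change (dite _ _ _ : Jet π r) = θ
    rw [dif_pos hp]
    refine Eq.trans (Quotient.sound (s := jetSetoid π r) ?_) (jetMk_rep θ)
    exact c.jetEquiv_of_coords (c.polyPointed_mem _ hp) hθ (c.coords_polyPointed _ hp)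
  right_inv' := by
    intro p hp
    have hp : (p.1, p.value) ∈ c.tot.target := hp
    change c.coords r (dite _ _ _ : Jet π r).rep = p
    rw [dif_pos hp]
    refine (c.coords_congr (rep_jetMk _) ?_).trans (c.coords_polyPointed p hp)
    rw [(rep_jetMk (r := r) (c.polyPointed p hp)).2.1]
    exact c.polyPointed_mem p hp

open Classical in
theorem AdaptedChart.jetChart_trans_source (c c' : AdaptedChart π) (r : ℕ) (θ₀ θ₁ : Jet π r) :
    ((c.jetChart r θ₀).symm.trans (c'.jetChart r θ₁)).source =
      {p | (p.1, p.value) ∈ c.tot.target ∧ c.tot.symm (p.1, p.value) ∈ c'.tot.source} := by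
  ext p
  rw [PartialEquiv.trans_source]
  constructor
  · rintro ⟨h, h'⟩
    have h : (p.1, p.value) ∈ c.tot.target := h
    refine ⟨h, ?_⟩
    have h' : (dite _ _ _ : Jet π r).toE ∈ c'.tot.source := h'
    rwa [dif_pos h, toE_jetMk, c.polyPointed_val] at h'
  · rintro ⟨h, h'⟩
    refine ⟨h, ?_⟩
    change (dite _ _ _ : Jet π r).toE ∈ c'.tot.source
    rwa [dif_pos h, toE_jetMk, c.polyPointed_val]

open Classical in
theorem AdaptedChart.jetChart_trans_eq (c c' : AdaptedChart π) (r : ℕ) (θ₀ θ₁ : Jet π r)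
    {p : JetModel B F r} (hp : p ∈ ((c.jetChart r θ₀).symm.trans (c'.jetChart r θ₁)).source) :
    (c.jetChart r θ₀).symm.trans (c'.jetChart r θ₁) p = transMap c c' r p := by
  rw [c.jetChart_trans_source] at hp
  obtain ⟨h, h'⟩ := hp
  change c'.coords r (dite _ _ _ : Jet π r).rep = _
  rw [dif_pos h]
  have e := (rep_jetMk (r := r) (c.polyPointed p h))
  have h2 : (c.polyPointed p h).sec.toFun (c.polyPointed p h).pt ∈ c'.tot.source := by
    rwa [c.polyPointed_val]
  rw [c'.coords_congr e (by rwa [e.2.1]),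
    coords_trans c c' r _ (c.polyPointed_mem p h) h2, c.coords_polyPointed]

variable [FiniteDimensional ℝ B] [FiniteDimensional ℝ F]

theorem AdaptedChart.contDiffOn_jetChart_trans (c c' : AdaptedChart π) (r : ℕ)
    (θ₀ θ₁ : Jet π r) :
    ContDiffOn ℝ ∞ ((c.jetChart r θ₀).symm.trans (c'.jetChart r θ₁))
      ((c.jetChart r θ₀).symm.trans (c'.jetChart r θ₁)).source := by
  have h : ContDiffOn ℝ ∞ (transMap c c' r)
      ((c.jetChart r θ₀).symm.trans (c'.jetChart r θ₁)).source := by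
    intro p hp
    rw [c.jetChart_trans_source] at hp
    exact (contDiffAt_transMap c c' hp.1 hp.2).contDiffWithinAt
  exact h.congr fun p hp => c.jetChart_trans_eq c' r θ₀ θ₁ hp

variable [IsManifold 𝓘(ℝ, B × F) ∞ E]

variable (π) in
theorem exists_adaptedChart (y : E) : ∃ c : AdaptedChart π, y ∈ c.tot.source := by
  have h := π.submersion.isSubmersionOfComplement_complement y
  let e := h.equiv
  have hinj : Function.Injective
      ((e.symm : (B × π.submersion.complement) →ₗ[ℝ] B × F) ∘ₗ
        LinearMap.inr ℝ B π.submersion.complement) :=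
    e.symm.injective.comp LinearMap.inr_injective
  have : FiniteDimensional ℝ π.submersion.complement := FiniteDimensional.of_injective _ hinj
  have hdim : Module.finrank ℝ π.submersion.complement = Module.finrank ℝ F := by
    have := e.toLinearEquiv.finrank_eq
    rw [Module.finrank_prod, Module.finrank_prod] at this
    omega
  let e' : π.submersion.complement ≃L[ℝ] F := ContinuousLinearEquiv.ofFinrankEq hdim
  let L : (B × F) ≃L[ℝ] (B × F) := e.trans ((ContinuousLinearEquiv.refl ℝ B).prodCongr e')
  have hfst : ∀ z, (L z).1 = (e z).1 := fun z => rfl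
  have hcharts : ∀ z ∈ h.domChart.target, h.codChart (π.proj (h.domChart.symm z)) = (L z).1 := by
    intro z hz
    have h1 := h.writtenInCharts (show z ∈ (h.domChart.extend 𝓘(ℝ, B × F)).target by simpa using! hz)
    simpa [hfst] using! h1
  refine ⟨⟨h.domChart.trans L.toHomeomorph.toOpenPartialHomeomorph, h.codChart, ?_,
    h.codChart_mem_maximalAtlas, ?_, ?_⟩, ?_⟩
  · apply OpenPartialHomeomorph.mem_maximalAtlas_of_contMDiffOn
    · have h1 := contMDiffOn_of_mem_maximalAtlas h.domChart_mem_maximalAtlas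
      have h2 : ContMDiff 𝓘(ℝ, B × F) 𝓘(ℝ, B × F) ∞ L := L.contDiff.contMDiff
      simpa using! h2.comp_contMDiffOn h1
    · have h1 := contMDiffOn_symm_of_mem_maximalAtlas h.domChart_mem_maximalAtlas
      have h2 : ContMDiff 𝓘(ℝ, B × F) 𝓘(ℝ, B × F) ∞ L.symm := L.symm.contDiff.contMDiff
      refine h1.comp h2.contMDiffOn ?_
      intro z hz
      simpa using! hz
  · intro y hy
    exact h.source_subset_preimage_source (by simpa using hy)
  · intro y hy
    have hy' : y ∈ h.domChart.source := by simpa using hy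
    have := hcharts _ (h.domChart.map_source hy')
    rw [h.domChart.left_inv hy'] at this
    exact this
  · simpa using h.mem_domChart_source

variable (π) in
/-- A chosen adapted chart around a point of `E`. -/
def adaptedChartAt (y : E) : AdaptedChart π := (exists_adaptedChart π y).choose

variable (π) in
theorem mem_adaptedChartAt (y : E) : y ∈ (adaptedChartAt π y).tot.source :=
  (exists_adaptedChart π y).choose_spec

variable (π) in
/-- The atlas of induced charts on `J^r π`. -/
def jetCore (r : ℕ) : ChartedSpaceCore (JetModel B F r) (Jet π r) where
  atlas := {e | ∃ (c : AdaptedChart π) (θ₀ : Jet π r), e = c.jetChart r θ₀}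
  chartAt := fun θ => (adaptedChartAt π θ.toE).jetChart r θ
  mem_chart_source := fun θ => mem_adaptedChartAt π θ.toE
  chart_mem_atlas := fun θ => ⟨_, _, rfl⟩
  open_source := by
    rintro _ _ ⟨c, θ₀, rfl⟩ ⟨c', θ₁, rfl⟩
    rw [c.jetChart_trans_source]
    have hc : Continuous (fun p : JetModel B F r => (p.1, p.value)) := by
      refine continuous_fst.prodMk ?_
      exact (ContinuousMultilinearMap.apply ℝ (fun _ : Fin ((0 : Fin (r + 1)) : ℕ) => B) F
        (fun _ => 0)).continuous.comp (AdaptedChart.contDiff_coord 0).continuous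
    have := (c.tot.symm ≫ₕ c'.tot).open_source.preimage hc
    rw [OpenPartialHomeomorph.trans_source] at this
    exact this
  continuousOn_toFun := by
    rintro _ _ ⟨c, θ₀, rfl⟩ ⟨c', θ₁, rfl⟩
    exact (c.contDiffOn_jetChart_trans c' r θ₀ θ₁).continuousOn

instance (r : ℕ) : TopologicalSpace (Jet π r) := (jetCore π r).toTopologicalSpace

instance (r : ℕ) : ChartedSpace (JetModel B F r) (Jet π r) := (jetCore π r).toChartedSpace

instance (r : ℕ) : IsManifold 𝓘(ℝ, JetModel B F r) ∞ (Jet π r) := by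
  refine isManifold_of_contDiffOn _ _ _ ?_
  rintro e e' he he'
  obtain ⟨_, ⟨c, θ₀, rfl⟩, rfl⟩ : ∃ f, ∃ hf : f ∈ (jetCore π r).atlas,
      e = (jetCore π r).openPartialHomeomorph f hf := by
    have h1 : e ∈ ⋃ (f) (hf : f ∈ (jetCore π r).atlas),
        {(jetCore π r).openPartialHomeomorph f hf} := he
    simp only [mem_iUnion, mem_singleton_iff] at h1
    exact h1
  obtain ⟨_, ⟨c', θ₁, rfl⟩, rfl⟩ : ∃ f, ∃ hf : f ∈ (jetCore π r).atlas,
      e' = (jetCore π r).openPartialHomeomorph f hf := by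
    have h1 : e' ∈ ⋃ (f) (hf : f ∈ (jetCore π r).atlas),
        {(jetCore π r).openPartialHomeomorph f hf} := he'
    simp only [mem_iUnion, mem_singleton_iff] at h1
    exact h1
  have := c.contDiffOn_jetChart_trans c' r θ₀ θ₁
  simpa using! this

end Jets

/-! ### Functions, forms and tangent maps on jet spaces -/

section Forms

variable {B F M E : Type*}
  [NormedAddCommGroup B] [NormedSpace ℝ B] [NormedAddCommGroup F] [NormedSpace ℝ F]
  [TopologicalSpace M] [ChartedSpace B M] [TopologicalSpace E] [ChartedSpace (B × F) E]
  [FiniteDimensional ℝ B] [FiniteDimensional ℝ F] [IsManifold 𝓘(ℝ, B × F) ∞ E]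

/-- The algebra `𝓕_r` of smooth functions on `J^r π`. -/
abbrev JetFun (π : FibredManifold B F M E) (r : ℕ) : Type _ :=
  C^∞⟮𝓘(ℝ, JetModel B F r), Jet π r; 𝓘(ℝ, ℝ), ℝ⟯

/-- The tangent space of `J^r π` at `η`. -/
abbrev TJet {π : FibredManifold B F M E} {r : ℕ} (η : Jet π r) : Type _ :=
  TangentSpace 𝓘(ℝ, JetModel B F r) η

/-- Relative `k`-forms: families of alternating forms on `T J^r π` indexed by the points of
`J^{r+1} π`. No regularity is imposed here; the modules of forms are submodules of this one. -/
def RelForm (π : FibredManifold B F M E) (r k : ℕ) : Type _ :=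
  (θ : Jet π (r + 1)) → TJet θ.proj [⋀^Fin k]→ₗ[ℝ] ℝ

section RelForm

variable (π : FibredManifold B F M E) (r k : ℕ)

instance : AddCommGroup (RelForm π r k) :=
  inferInstanceAs (AddCommGroup ((θ : Jet π (r + 1)) → TJet θ.proj [⋀^Fin k]→ₗ[ℝ] ℝ))

instance : Module ℝ (RelForm π r k) :=
  inferInstanceAs (Module ℝ ((θ : Jet π (r + 1)) → TJet θ.proj [⋀^Fin k]→ₗ[ℝ] ℝ))

/-- Multiplication by functions on `J^r π`, which are pulled back to `J^{r+1} π`. -/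
instance : Module (JetFun π r) (RelForm π r k) where
  smul f α := fun θ => f θ.proj • α θ
  one_smul α := funext fun θ => one_smul ℝ (α θ)
  mul_smul f g α := funext fun θ => mul_smul (f θ.proj) (g θ.proj) (α θ)
  smul_zero f := funext fun θ => smul_zero (f θ.proj)
  smul_add f α β := funext fun θ => smul_add (f θ.proj) (α θ) (β θ)
  add_smul f g α := funext fun θ => add_smul (f θ.proj) (g θ.proj) (α θ)
  zero_smul α := funext fun θ => zero_smul ℝ (α θ)

variable {π r k}

theorem RelForm.smul_apply (f : JetFun π r) (α : RelForm π r k) (θ : Jet π (r + 1)) :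
    (f • α) θ = f θ.proj • α θ := rfl

instance : IsScalarTower ℝ (JetFun π r) (RelForm π r k) where
  smul_assoc c f α := funext fun θ => smul_assoc c (f θ.proj) (α θ)

instance : SMulCommClass ℝ (JetFun π r) (RelForm π r k) where
  smul_comm c f α := funext fun θ => smul_comm c (f θ.proj) (α θ)

instance : SMulCommClass (JetFun π r) ℝ (RelForm π r k) where
  smul_comm f c α := funext fun θ => smul_comm (f θ.proj) c (α θ)

/-- Multiplication of relative forms by a function on `E`, pulled back along
`J^{r+1} π → J^r π → E`. -/
def mulForm (a : E → ℝ) : RelForm π r k →ₗ[ℝ] RelForm π r k where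
  toFun α := fun θ => a θ.proj.toE • α θ
  map_add' α β := funext fun θ => smul_add (a θ.proj.toE) (α θ) (β θ)
  map_smul' c α := funext fun θ => smul_comm (a θ.proj.toE) c (α θ)

end RelForm

variable {π : FibredManifold B F M E} {r : ℕ}

/-- The tangent vector at `η` whose components in the induced chart around `η₀` are `v`: first the
components along `∂/∂x^λ`, then those along `∂/∂u^i_σ`. -/
def coordVec (η₀ η : Jet π r) (v : JetModel B F r) : TJet η :=
  (trivializationAt (JetModel B F r)
    (TangentSpace 𝓘(ℝ, JetModel B F r) : Jet π r → Type _) η₀).symmL ℝ η v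

/-- Smooth `l`-forms on `J^r π`: the elements of `Λ^l_r`. The components in the induced charts are
smooth. -/
def IsSmoothForm {l : ℕ} (β : (η : Jet π r) → TJet η [⋀^Fin l]→ₗ[ℝ] ℝ) : Prop :=
  ∀ (η₀ : Jet π r) (v : Fin l → JetModel B F r),
    ContMDiffAt 𝓘(ℝ, JetModel B F r) 𝓘(ℝ, ℝ) ∞
      (fun η => β η (fun i => coordVec η₀ η (v i))) η₀

open Classical in
/-- The prolongation `j_r s` of a local section (with a constant value outside of the domain). -/
def prolong (r : ℕ) (s : PointedSection π) (x : M) : Jet π r :=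
  if h : x ∈ s.sec.dom then jetMk r ⟨s.sec, x, h⟩ else jetMk r s

/-- The contact map `D_{r+1}` at `θ = j^{r+1}_x s`, that is `T_x (j_r s)`. -/
def contactMap (θ : Jet π (r + 1)) : TangentSpace 𝓘(ℝ, B) θ.proj.base →ₗ[ℝ] TJet θ.proj :=
  (mfderiv 𝓘(ℝ, B) 𝓘(ℝ, JetModel B F r) (prolong r θ.rep) θ.rep.pt).toLinearMap

/-- The horizontal projection of `T J^r π` determined by a point of `J^{r+1} π`. -/
def hor (θ : Jet π (r + 1)) : TJet θ.proj →ₗ[ℝ] TJet θ.proj :=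
  contactMap θ ∘ₗ
    (mfderiv 𝓘(ℝ, JetModel B F r) 𝓘(ℝ, B) (Jet.base : Jet π r → M) θ.proj).toLinearMap

/-- The complementary vertical projection `ω_{r+1}`. -/
def ver (θ : Jet π (r + 1)) : TJet θ.proj →ₗ[ℝ] TJet θ.proj := LinearMap.id - hor θ

variable (π r) in
/-- The `𝓕_r`-module of the horizontal parts `h(β)` of the `l`-forms `β` on `J^r π`. -/
def barForms (l : ℕ) : Submodule (JetFun π r) (RelForm π r l) where
  carrier := {α | ∃ β : (η : Jet π r) → TJet η [⋀^Fin l]→ₗ[ℝ] ℝ, IsSmoothForm β ∧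
    ∀ θ, α θ = (β θ.proj).compLinearMap (hor θ)}
  add_mem' := by
    rintro α α' ⟨β, h, e⟩ ⟨β', h', e'⟩
    refine ⟨fun η => β η + β' η, fun η₀ v => (h η₀ v).add (h' η₀ v), fun θ => ?_⟩
    change α θ + α' θ = _
    rw [e, e']
    rfl
  zero_mem' := ⟨fun _ => 0, fun _ _ => contMDiffAt_const, fun _ => rfl⟩
  smul_mem' := by
    rintro f α ⟨β, h, e⟩
    refine ⟨fun η => f η • β η, fun η₀ v => (f.contMDiff η₀).smul (h η₀ v), fun θ => ?_⟩
    rw [RelForm.smul_apply, e]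
    rfl

variable (π r) in
/-- The `𝓕_r`-module of relative `p`-forms with values in the contact forms and with coefficients
in `𝓕_r`. The vectors `(0, w)` are the vertical ones, so the functions `f` below are the
components of `γ` with respect to the contact forms `ω^i_σ = du^i_σ - u^i_{σλ} dx^λ`. -/
def contactForms (p : ℕ) : Submodule (JetFun π r) (RelForm π r p) where
  carrier := {γ | (∀ θ, γ θ = (γ θ).compLinearMap (ver θ)) ∧
    ∀ (η₀ : Jet π r) (w : Fin p → (k : Fin (r + 1)) → SymMul B F k), ∃ f : Jet π r → ℝ,
      ContMDiffAt 𝓘(ℝ, JetModel B F r) 𝓘(ℝ, ℝ) ∞ f η₀ ∧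
      ∀ᶠ η in 𝓝 η₀, ∀ θ : Jet π (r + 1), θ.proj = η →
        γ θ (fun i => coordVec η₀ θ.proj (0, w i)) = f η}
  add_mem' := by
    rintro γ γ' ⟨h, k⟩ ⟨h', k'⟩
    refine ⟨fun θ => ?_, fun η₀ w => ?_⟩
    · change γ θ + γ' θ = (γ θ + γ' θ).compLinearMap (ver θ)
      conv_lhs => rw [h, h']
      rfl
    · obtain ⟨f, hf, e⟩ := k η₀ w
      obtain ⟨f', hf', e'⟩ := k' η₀ w
      refine ⟨f + f', hf.add hf', ?_⟩
      filter_upwards [e, e'] with η e e' θ hθ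
      have := congrArg₂ (· + ·) (e θ hθ) (e' θ hθ)
      exact this
  zero_mem' := ⟨fun _ => rfl, fun _ _ => ⟨0, contMDiffAt_const, Eventually.of_forall
    fun _ _ _ => rfl⟩⟩
  smul_mem' := by
    rintro g γ ⟨h, k⟩
    refine ⟨fun θ => ?_, fun η₀ w => ?_⟩
    · rw [RelForm.smul_apply]
      conv_lhs => rw [h]
      rfl
    · obtain ⟨f, hf, e⟩ := k η₀ w
      refine ⟨fun η => g η • f η, (g.contMDiff η₀).smul hf, ?_⟩
      filter_upwards [e] with η e θ hθ
      have := congrArg (fun c => g η • c) (e θ hθ)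
      rw [← this, ← hθ]
      rfl

/-- The wedge product of relative forms (the sum over shuffles, without a numerical factor). -/
def wedge {p l : ℕ} (γ : RelForm π r p) (β : RelForm π r l) : RelForm π r (l + p) := fun θ =>
  (((LinearMap.mul' ℝ ℝ).compAlternatingMap ((γ θ).domCoprod (β θ))).domDomCongr
    (finSumFinEquiv.trans (finCongr (Nat.add_comm p l))))

variable (π r) in
/-- The `𝓕_r`-module generated by the products `γ ∧ β` of contact `p`-forms and barred
`l`-forms. As for all modules of sections, membership is a local condition on `J^r π`: near each
point, the form is a finite sum of products. -/
def contactBar (p l : ℕ) : Submodule (JetFun π r) (RelForm π r (l + p)) where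
  carrier := {α | ∀ η₀ : Jet π r, ∃ α' ∈ Submodule.span (JetFun π r)
      {δ | ∃ γ ∈ contactForms π r p, ∃ β ∈ barForms π r l, δ = wedge γ β},
    ∀ᶠ η in 𝓝 η₀, ∀ θ : Jet π (r + 1), θ.proj = η → α θ = α' θ}
  add_mem' := by
    intro α β h k η₀
    obtain ⟨α', hα, e⟩ := h η₀
    obtain ⟨β', hβ, e'⟩ := k η₀
    refine ⟨α' + β', add_mem hα hβ, ?_⟩
    filter_upwards [e, e'] with η e e' θ hθ
    exact congrArg₂ (· + ·) (e θ hθ) (e' θ hθ)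
  zero_mem' := fun _ => ⟨0, zero_mem _, Eventually.of_forall fun _ _ _ => rfl⟩
  smul_mem' := by
    intro f α h η₀
    obtain ⟨α', hα, e⟩ := h η₀
    refine ⟨f • α', Submodule.smul_mem _ f hα, ?_⟩
    filter_upwards [e] with η e θ hθ
    rw [RelForm.smul_apply, RelForm.smul_apply, e θ hθ]

/-! ### Vertical and evolutionary vector fields -/

variable (π) in
/-- The module `κ₀` of smooth vertical vector fields on `E`. -/
def VertField : Submodule ℝ ((y : E) → TangentSpace 𝓘(ℝ, B × F) y) where
  carrier := {X | ContMDiff 𝓘(ℝ, B × F) (𝓘(ℝ, B × F).prod 𝓘(ℝ, B × F)) ∞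
      (fun y => (⟨y, X y⟩ : TangentBundle 𝓘(ℝ, B × F) E)) ∧
    ∀ y, mfderiv 𝓘(ℝ, B × F) 𝓘(ℝ, B) π.proj y (X y) = 0}
  add_mem' := by
    rintro X Y ⟨h, k⟩ ⟨h', k'⟩
    refine ⟨h.add_section h', fun y => ?_⟩
    rw [Pi.add_apply, map_add, k, k', add_zero]
  zero_mem' := ⟨Bundle.contMDiff_zeroSection ℝ _, fun y => map_zero _⟩
  smul_mem' := by
    rintro c X ⟨h, k⟩
    refine ⟨h.const_smul_section, fun y => ?_⟩
    rw [Pi.smul_apply, map_smul, k, smul_zero]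

/-- Multiplication of vertical vector fields by functions on `E`. -/
def mulField (a : C^∞⟮𝓘(ℝ, B × F), E; 𝓘(ℝ, ℝ), ℝ⟯) : VertField π →ₗ[ℝ] VertField π where
  toFun X := ⟨fun y => a y • X.1 y, a.contMDiff.smul_section X.2.1, fun y => by
    rw [map_smul, X.2.2, smul_zero]⟩
  map_add' X Y := Subtype.ext (funext fun y => smul_add (a y) (X.1 y) (Y.1 y))
  map_smul' c X := Subtype.ext (funext fun y => smul_comm (a y) c (X.1 y))

/-- The components `φ^i ∘ s` of a vertical field along a section, in an adapted chart, as
functions of the base coordinates. -/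
def fieldRep (c : AdaptedChart π) (φ : VertField π) (s : LocalSection π) (z : B) : F :=
  (mfderiv 𝓘(ℝ, B × F) 𝓘(ℝ, B × F) c.tot (s.toFun (c.base.symm z))
    (φ.1 (s.toFun (c.base.symm z))) : B × F).2

/-- The evolutionary vector field `D_σ φ^i ∂/∂u^i_σ` on `J^r π`. The total derivative
`D_σ φ^i` at the jet of a section `s` is the partial derivative `∂_σ (φ^i ∘ s)`. -/
def Evo (φ : VertField π) (η : Jet π r) : TJet η :=
  coordVec η η (0, fun k => toSym k (iteratedFDeriv ℝ k
    (fieldRep (adaptedChartAt π η.toE) φ η.rep.sec) ((adaptedChartAt π η.toE).base η.rep.pt)))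

/-- Successive contraction `v₁ ⌟ (… ⌟ (v_p ⌟ α) … )`. -/
def contract {V : Type*} [AddCommGroup V] [Module ℝ V] {l : ℕ} :
    (p : ℕ) → V [⋀^Fin (l + p)]→ₗ[ℝ] ℝ → (Fin p → V) → V [⋀^Fin l]→ₗ[ℝ] ℝ
  | 0, α, _ => α
  | p + 1, α, v => contract p (AlternatingMap.curryLeft (n := l + p) α (v (Fin.last p)))
      (Fin.init v)

/-- `∇_α(φ₁, …, φ_p) = Evo_{φ₁} ⌟ (… ⌟ (Evo_{φ_p} ⌟ α) … )`. -/
def nabla {p l : ℕ} (α : RelForm π r (l + p)) (φ : Fin p → VertField π) : RelForm π r l :=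
  fun θ => contract p (α θ) (fun i => Evo (φ i) θ.proj)

/-! ### `C`-differential operators -/

/-- The commutator of an operator with the multiplication by a function `a` on `E`. -/
def commutator {l : ℕ} (a : C^∞⟮𝓘(ℝ, B × F), E; 𝓘(ℝ, ℝ), ℝ⟯)
    (Δ : VertField π →ₗ[ℝ] RelForm π r l) : VertField π →ₗ[ℝ] RelForm π r l :=
  mulForm a ∘ₗ Δ - Δ ∘ₗ mulField a

/-- Differential operators of order at most `k`: the iterated commutators with any `k + 1`
functions vanish. -/
def IsDiffOp {l : ℕ} : (k : ℕ) → (VertField π →ₗ[ℝ] RelForm π r l) → Prop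
  | 0, Δ => ∀ a, commutator a Δ = 0
  | k + 1, Δ => ∀ a, IsDiffOp k (commutator a Δ)

/-- `C`-differential operators restrict to the prolongations of the local sections: if `φ`
vanishes along a section, then `Δ φ` vanishes along its prolongation. -/
def IsCDiff {l : ℕ} (Δ : VertField π →ₗ[ℝ] RelForm π r l) : Prop :=
  ∀ (s : LocalSection π) (φ : VertField π), (∀ x ∈ s.dom, φ.1 (s.toFun x) = 0) →
    ∀ (x : M) (hx : x ∈ s.dom), Δ φ (jetMk (r + 1) ⟨s, x, hx⟩) = 0

theorem commutator_add {l : ℕ} (a : C^∞⟮𝓘(ℝ, B × F), E; 𝓘(ℝ, ℝ), ℝ⟯)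
    (Δ Δ' : VertField π →ₗ[ℝ] RelForm π r l) :
    commutator a (Δ + Δ') = commutator a Δ + commutator a Δ' := by
  simp only [commutator, LinearMap.comp_add, LinearMap.add_comp]
  abel

theorem commutator_smul {l : ℕ} (a : C^∞⟮𝓘(ℝ, B × F), E; 𝓘(ℝ, ℝ), ℝ⟯) (f : JetFun π r)
    (Δ : VertField π →ₗ[ℝ] RelForm π r l) :
    commutator a (f • Δ) = f • commutator a Δ := by
  ext X : 1
  funext θ
  change a θ.proj.toE • f θ.proj • Δ X θ - f θ.proj • Δ (mulField a X) θ =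
    f θ.proj • (a θ.proj.toE • Δ X θ - Δ (mulField a X) θ)
  rw [smul_sub, smul_comm]

theorem IsDiffOp.zero {l : ℕ} (k : ℕ) :
    IsDiffOp k (0 : VertField π →ₗ[ℝ] RelForm π r l) := by
  have h : ∀ a, commutator a (0 : VertField π →ₗ[ℝ] RelForm π r l) = 0 := fun a => by
    simp [commutator]
  induction k with
  | zero => exact h
  | succ k ih => intro a; rwa [h]

theorem IsDiffOp.add {l k : ℕ} {Δ Δ' : VertField π →ₗ[ℝ] RelForm π r l} (h : IsDiffOp k Δ)
    (h' : IsDiffOp k Δ') : IsDiffOp k (Δ + Δ') := by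
  induction k generalizing Δ Δ' with
  | zero => intro a; rw [commutator_add, h a, h' a, add_zero]
  | succ k ih => intro a; rw [commutator_add]; exact ih (h a) (h' a)

theorem IsDiffOp.smul {l k : ℕ} {Δ : VertField π →ₗ[ℝ] RelForm π r l} (f : JetFun π r)
    (h : IsDiffOp k Δ) : IsDiffOp k (f • Δ) := by
  induction k generalizing Δ with
  | zero => intro a; rw [commutator_smul, h a, smul_zero]
  | succ k ih => intro a; rw [commutator_smul]; exact ih (h a)

/-- The operator obtained from a multilinear operator by fixing all arguments but the `i`-th. -/
def partialOp {p l : ℕ} (Δ : VertField π [⋀^Fin p]→ₗ[ℝ] barForms π r l)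
    (φ : Fin p → VertField π) (i : Fin p) : VertField π →ₗ[ℝ] RelForm π r l :=
  ((barForms π r l).subtype.restrictScalars ℝ) ∘ₗ Δ.toMultilinearMap.toLinearMap φ i

variable (π r) in
/-- The `𝓕_r`-module of antisymmetric multi-`C`-differential operators, with `p` arguments in `κ₀`
and values in the barred `l`-forms, of order at most `r` in each argument. -/
def CDiffAlt (p l : ℕ) : Submodule (JetFun π r) (VertField π [⋀^Fin p]→ₗ[ℝ] barForms π r l) where
  carrier := {Δ | ∀ (φ : Fin p → VertField π) (i : Fin p),
    IsDiffOp r (partialOp Δ φ i) ∧ IsCDiff (partialOp Δ φ i)}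
  add_mem' := by
    intro Δ Δ' h h' φ i
    have e : partialOp (Δ + Δ') φ i = partialOp Δ φ i + partialOp Δ' φ i := rfl
    rw [e]
    refine ⟨(h φ i).1.add (h' φ i).1, fun s X hX x hx => ?_⟩
    have := congrArg₂ (· + ·) ((h φ i).2 s X hX x hx) ((h' φ i).2 s X hX x hx)
    exact this.trans (add_zero _)
  zero_mem' := by
    intro φ i
    exact ⟨IsDiffOp.zero r, fun _ _ _ _ _ => rfl⟩
  smul_mem' := by
    intro f Δ h φ i
    have e : partialOp (f • Δ) φ i = f • partialOp Δ φ i := rfl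
    rw [e]
    refine ⟨(h φ i).1.smul f, fun s X hX x hx => ?_⟩
    have := congrArg (fun c => f (jetMk (r + 1) ⟨s, x, hx⟩ : Jet π (r + 1)).proj • c)
      ((h φ i).2 s X hX x hx)
    exact this.trans (smul_zero _)

/-! ### Isomorphisms of fibred manifolds -/

variable {E' : Type*} [TopologicalSpace E'] [ChartedSpace (B × F) E']
  [IsManifold 𝓘(ℝ, B × F) ∞ E']

/-- An isomorphism of fibred manifolds over the identity of the base. -/
structure FibredIso (π : FibredManifold B F M E) (π' : FibredManifold B F M E') where
  /-- The diffeomorphism of the total spaces. -/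
  diffeo : E ≃ₘ^∞⟮𝓘(ℝ, B × F), 𝓘(ℝ, B × F)⟯ E'
  proj_apply : ∀ y, π'.proj (diffeo y) = π.proj y

variable {π' : FibredManifold B F M E'}

/-- The image of a pointed section. -/
def FibredIso.mapSection (Ψ : FibredIso π π') (s : PointedSection π) : PointedSection π' where
  sec :=
    { toFun := fun x => Ψ.diffeo (s.sec.toFun x)
      dom := s.sec.dom
      isOpen_dom := s.sec.isOpen_dom
      smooth := Ψ.diffeo.contMDiff.comp_contMDiffOn s.sec.smooth
      proj_apply := fun x hx => by rw [Ψ.proj_apply, s.sec.proj_apply x hx] }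
  pt := s.pt
  mem := s.mem

/-- The prolongation `J^r Ψ : J^r π → J^r π'`. -/
def FibredIso.jetMap (Ψ : FibredIso π π') (r : ℕ) (θ : Jet π r) : Jet π' r :=
  jetMk r (Ψ.mapSection θ.rep)

/-- The pull-back of relative forms along the prolongations of an isomorphism. -/
def FibredIso.pullback (Ψ : FibredIso π π') {k : ℕ} (α : RelForm π' r k) : RelForm π r k :=
  fun θ => (α (Ψ.jetMap (r + 1) θ)).compLinearMap
    (mfderiv 𝓘(ℝ, JetModel B F r) 𝓘(ℝ, JetModel B F r) (Ψ.jetMap r) θ.proj).toLinearMap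

/-- The vertical fields `φ` and `φ'` correspond to each other under the isomorphism. -/
def FibredIso.Related (Ψ : FibredIso π π') (φ : VertField π) (φ' : VertField π') : Prop :=
  ∀ y, φ'.1 (Ψ.diffeo y) = mfderiv 𝓘(ℝ, B × F) 𝓘(ℝ, B × F) Ψ.diffeo y (φ.1 y)

end Forms

end FiniteJet

end

set_option linter.unusedSectionVars false

noncomputable section

namespace FiniteJet

/-! ### Parametric integrals and Hadamard's lemma -/

section Analysis

variable {B F : Type*} [NormedAddCommGroup B] [NormedSpace ℝ B]
  [NormedAddCommGroup F] [NormedSpace ℝ F]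

/-! Fix a point θ of J^{r+1}π, represented by a section s at x, with projection η in J^rπ. The
u_σ-component of Evo_φ at η is ∂_σ(φ^i ∘ s)(x), in every adapted chart (`fderiv_transMap_evoCoord`,
`dCoord_evo`), so Evo_φ(η) is the r-jet at x of φ along s. Cut-off fields with polynomial
coefficients realise every vertical vector at η in this way (`exists_evo_eq`).

Injectivity is pointwise. At θ the form α is a sum of products g ∧ h, where g sees only vertical
components and h is killed by vertical vectors (`biForms`). Contraction of g ∧ h with p vertical
vectors leaves g(...) h, and such contractions determine the form (`eq_zero_of_contract_eq_zero`).
Since all vertical vectors are values of evolutionary fields, ∇_α = 0 forces α = 0.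

The operator ∇_α has the required type because at θ it depends on each φ_i only through
Evo_{φ_i}(η). A field that vanishes along s has Evo = 0 there. Multiplication by a(θ) - a raises the
order of vanishing along s by one, so r + 1 commutators annihilate the operator
(`isDiffOp_of_flat`). Its values are barred forms because contact forms evaluated on evolutionary
fields are functions on J^rπ, and because barred forms glue by a partition of unity.

For surjectivity the point is the converse: a C-differential operator D of order at most r satisfies
(D X)(θ) = 0 as soon as Evo_X(η) = 0 (`apply_eq_zero_of_evo_eq_zero`). By Hadamard's lemma the
components of X along s are sums of products of r + 1 functions vanishing at x times smooth
functions. Lifting these to E gives a field Y which D annihilates at θ because of its order, while X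
- Y vanishes along s near x and is annihilated because D is C-differential. Hence Δ induces at each
θ an alternating function of p vertical vectors. Near a given η₀, a finite-dimensional family of
fields whose evolutionary fields form a frame of the vertical vectors turns this function into an
explicit sum of products γ ∧ β (`exists_local_form`). These local forms agree by pointwise
injectivity, hence they glue (`exists_nabla_eq`).

Naturality rests on pulling adapted charts back along the isomorphism. In corresponding charts the
prolongations are the identity, so they respect the horizontal projections (`tMapProj_hor`) and the
evolutionary fields (`evo_jetMap`). -/

theorem hasFDerivAt_integral_of_contDiff [FiniteDimensional ℝ B] [CompleteSpace F]
    {f : ℝ × B → F} (hf : ContDiff ℝ 1 f)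
    (z₀ : B) : HasFDerivAt (fun z => ∫ t in (0 : ℝ)..1, f (t, z))
      (∫ t in (0 : ℝ)..1, (fderiv ℝ f (t, z₀)).comp (ContinuousLinearMap.inr ℝ ℝ B)) z₀ := by
  have hd : Continuous (fun q : ℝ × B => (fderiv ℝ f q).comp (ContinuousLinearMap.inr ℝ ℝ B)) :=
    (hf.continuous_fderiv one_ne_zero).clm_comp continuous_const
  -- The dominating constant: the partial derivative is continuous, hence bounded on the compact
  -- product of [0,1] with the closed unit ball around z₀.
  obtain ⟨C, hC⟩ := ((isCompact_Icc (a := (0 : ℝ)) (b := 1)).prod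
    (ProperSpace.isCompact_closedBall z₀ 1)).exists_bound_of_continuousOn hd.continuousOn
  refine (intervalIntegral.hasFDerivAt_integral_of_dominated_of_fderiv_le
    (F' := fun z t => (fderiv ℝ f (t, z)).comp (ContinuousLinearMap.inr ℝ ℝ B))
    (bound := fun _ => C) (Metric.ball_mem_nhds z₀ one_pos) ?_ ?_ ?_ ?_ ?_ ?_)
  · exact Eventually.of_forall fun z =>
      (hf.continuous.comp (Continuous.prodMk_left z)).aestronglyMeasurable
  · exact (hf.continuous.comp (Continuous.prodMk_left z₀)).intervalIntegrable _ _
  · exact (hd.comp (Continuous.prodMk_left z₀)).aestronglyMeasurable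
  · refine Eventually.of_forall fun t ht z hz => hC (t, z) ⟨?_, Metric.ball_subset_closedBall hz⟩
    rw [uIoc_of_le zero_le_one] at ht
    exact ⟨ht.1.le, ht.2⟩
  · exact intervalIntegrable_const
  · refine Eventually.of_forall fun t _ z _ => ?_
    exact ((hf.differentiable one_ne_zero (t, z)).hasFDerivAt).comp z
      (hasFDerivAt_prodMk_right t z)

/-- The derivative of the integral in a fixed direction y is an integral of the same kind, with the
smooth integrand ∂f/∂y. Induction on the order therefore works when f is left arbitrary. -/
theorem contDiff_integral [FiniteDimensional ℝ B] [CompleteSpace F] {f : ℝ × B → F}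
    (hf : ContDiff ℝ ∞ f) : ContDiff ℝ ∞ (fun z => ∫ t in (0 : ℝ)..1, f (t, z)) := by
  rw [contDiff_infty]
  intro n
  induction n generalizing f with
  | zero =>
    refine contDiff_zero.2 (continuous_iff_continuousAt.2 fun z => ?_)
    exact (hasFDerivAt_integral_of_contDiff (hf.of_le (by exact_mod_cast le_top)) z).continuousAt
  | succ n ih =>
    have h1 : ContDiff ℝ 1 f := hf.of_le (by exact_mod_cast le_top)
    have hd : Continuous (fun q : ℝ × B => (fderiv ℝ f q).comp (ContinuousLinearMap.inr ℝ ℝ B)) :=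
      (h1.continuous_fderiv one_ne_zero).clm_comp continuous_const
    push_cast
    refine contDiff_succ_iff_fderiv_apply.2
      ⟨fun z => (hasFDerivAt_integral_of_contDiff h1 z).differentiableAt, by simp, fun y => ?_⟩
    have : (fun z => fderiv ℝ (fun z => ∫ t in (0 : ℝ)..1, f (t, z)) z y) =
        fun z => ∫ t in (0 : ℝ)..1, (fun q => fderiv ℝ f q (0, y)) (t, z) := by
      funext z
      rw [(hasFDerivAt_integral_of_contDiff h1 z).fderiv, ContinuousLinearMap.intervalIntegral_apply]
      · rfl
      · exact (hd.comp (Continuous.prodMk_left z)).intervalIntegrable _ _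
    rw [this]
    exact ih ((hf.fderiv_right (m := ∞) le_rfl).clm_apply contDiff_const)

/-- The fundamental theorem of calculus along the segment from z₀ to z. -/
theorem eq_integral_fderiv_of_eq_zero [CompleteSpace F] {f : B → F} (hf : ContDiff ℝ 1 f) {z₀ : B} (h0 : f z₀ = 0)
    (z : B) : f z = ∫ t in (0 : ℝ)..1, fderiv ℝ f (z₀ + t • (z - z₀)) (z - z₀) := by
  have hd : ∀ t : ℝ, HasDerivAt (fun t : ℝ => f (z₀ + t • (z - z₀)))
      (fderiv ℝ f (z₀ + t • (z - z₀)) (z - z₀)) t := by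
    intro t
    have h1 : HasDerivAt (fun t : ℝ => z₀ + t • (z - z₀)) (z - z₀) t := by
      simpa using ((hasDerivAt_id t).smul_const (z - z₀)).const_add z₀
    exact ((hf.differentiable one_ne_zero _).hasFDerivAt).comp_hasDerivAt t h1
  rw [intervalIntegral.integral_eq_sub_of_hasDerivAt (fun t _ => hd t)]
  · simp [h0]
  · refine Continuous.intervalIntegrable ?_ _ _
    have h2 : Continuous (fun t : ℝ => z₀ + t • (z - z₀)) := by fun_prop
    exact ((hf.continuous_fderiv one_ne_zero).comp h2).clm_apply continuous_const

/-- This carries flatness of f at z₀ over to its directional derivatives, with the loss of one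
order. The fixed direction occupies the last slot. -/
theorem iteratedFDeriv_fderiv_apply {f : B → F} {z₀ : B} (hf : ContDiffAt ℝ ∞ f z₀) (k : ℕ)
    (e : B) (v : Fin k → B) :
    iteratedFDeriv ℝ k (fun z => fderiv ℝ f z e) z₀ v =
      iteratedFDeriv ℝ (k + 1) f z₀ (Fin.snoc v e) := by
  have h := ContinuousLinearMap.iteratedFDeriv_comp_left
    (ContinuousLinearMap.apply ℝ F e) (f := fderiv ℝ f) (x := z₀) (n := ∞)
    (hf.fderiv_right (m := ∞) le_rfl) (i := k) (by exact_mod_cast le_top)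
  have h2 := congrArg (fun L => L v) h
  refine Eq.trans h2 ?_
  rw [iteratedFDeriv_succ_apply_right]
  simp

/-- Hadamard's lemma: a smooth function whose derivatives of order less than `k` vanish at a point
lies in the `k`-th power of the ideal of that point. -/
theorem exists_eq_sum_prod_smul [FiniteDimensional ℝ B] [CompleteSpace F] {ι : Type*} [Fintype ι]
    (b : Module.Basis ι ℝ B) (z₀ : B) (k : ℕ) {f : B → F} (hf : ContDiff ℝ ∞ f)
    (h0 : ∀ j < k, iteratedFDeriv ℝ j f z₀ = 0) :
    ∃ g : (Fin k → ι) → B → F, (∀ m, ContDiff ℝ ∞ (g m)) ∧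
      ∀ z, f z = ∑ m, (∏ j, b.coord (m j) (z - z₀)) • g m z := by
  induction k generalizing f with
  | zero => exact ⟨fun _ => f, fun _ => hf, fun z => by simp⟩
  | succ k ih =>
    -- The partial derivatives of f vanish to one order less than f, so the induction hypothesis
    -- factors each of them.
    have h1 : ∀ l : ι, ∃ g : (Fin k → ι) → B → F, (∀ m, ContDiff ℝ ∞ (g m)) ∧
        ∀ z, fderiv ℝ f z (b l) = ∑ m, (∏ j, b.coord (m j) (z - z₀)) • g m z := by
      intro l
      refine ih ((hf.fderiv_right (m := ∞) le_rfl).clm_apply contDiff_const) fun j hj => ?_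
      ext v
      rw [iteratedFDeriv_fderiv_apply hf.contDiffAt, h0 (j + 1) (by omega)]
      rfl
    choose g hg hgf using h1
    have hG : ∀ l m, ContDiff ℝ ∞ (fun q : ℝ × B => q.1 ^ k • g l m (z₀ + q.1 • (q.2 - z₀))) := by
      intro l m
      refine (contDiff_fst.pow k).smul ((hg l m).comp ?_)
      exact contDiff_const.add (contDiff_fst.smul (contDiff_snd.sub contDiff_const))
    -- At z₀ + t(z - z₀) the k coordinate factors of ∂_l f each contribute a factor t, whence t ^ k.
    -- The remaining coordinate factor is that of z - z₀ in the direction l, which becomes the head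
    -- of the multi-index.
    refine ⟨fun m z => ∫ t in (0 : ℝ)..1, t ^ k • g (m 0) (Fin.tail m) (z₀ + t • (z - z₀)),
      fun m => contDiff_integral (hG _ _), fun z => ?_⟩
    have hz : f z₀ = 0 := by
      have := congrArg (fun L => L (fun _ => 0)) (h0 0 (Nat.succ_pos k))
      simpa using this
    have hsum : ∀ t : ℝ, fderiv ℝ f (z₀ + t • (z - z₀)) (z - z₀) =
        ∑ l, ∑ m : Fin k → ι, (b.coord l (z - z₀) * ∏ j, b.coord (m j) (z - z₀)) •
          (t ^ k • g l m (z₀ + t • (z - z₀))) := by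
      intro t
      have e := congrArg (fderiv ℝ f (z₀ + t • (z - z₀))) (b.sum_repr (z - z₀)).symm
      rw [map_sum] at e
      refine e.trans ?_
      refine Finset.sum_congr rfl fun l _ => ?_
      rw [map_smul, hgf l, Finset.smul_sum]
      refine Finset.sum_congr rfl fun m _ => ?_
      simp only [add_sub_cancel_left, map_smul, smul_eq_mul, Finset.prod_mul_distrib,
        Finset.prod_const, Finset.card_univ, Fintype.card_fin, smul_smul, Module.Basis.coord_apply]
      congr 1
      ring
    have hcont : ∀ l m, Continuous (fun t : ℝ => t ^ k • g l m (z₀ + t • (z - z₀))) := fun l m =>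
      (hG l m).continuous.comp (Continuous.prodMk_left z)
    rw [eq_integral_fderiv_of_eq_zero (hf.of_le (by exact_mod_cast le_top)) hz z]
    simp_rw [hsum]
    rw [intervalIntegral.integral_finsetSum]
    swap
    · intro l _
      exact (continuous_finsetSum _ fun m _ => (hcont l m).const_smul _).intervalIntegrable _ _
    rw [← (Fin.consEquiv (fun _ : Fin (k + 1) => ι)).sum_comp, Fintype.sum_prod_type]
    refine Finset.sum_congr rfl fun l _ => ?_
    rw [intervalIntegral.integral_finsetSum]
    swap
    · intro m _
      exact ((hcont l m).const_smul _).intervalIntegrable _ _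
    refine Finset.sum_congr rfl fun m _ => ?_
    rw [intervalIntegral.integral_smul, Fin.prod_univ_succ]
    rfl

end Analysis
end FiniteJet

namespace FiniteJet

/-! ### Jets of composites, products and one-parameter families -/

section Jets

variable {B F X Y : Type*} [NormedAddCommGroup B] [NormedSpace ℝ B]
  [NormedAddCommGroup F] [NormedSpace ℝ F] [NormedAddCommGroup X] [NormedSpace ℝ X]
  [NormedAddCommGroup Y] [NormedSpace ℝ Y]

/-- By Faà di Bruno's formula the k-th derivative of a composite involves only derivatives of order
at most k of the two maps. -/
theorem iteratedFDeriv_comp_congr {G G' : X → Y} {g g' : B → X} {z : B} {k : ℕ}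
    (hz : g z = g' z) (hG : ContDiffAt ℝ ∞ G (g z)) (hG' : ContDiffAt ℝ ∞ G' (g z))
    (hg : ContDiffAt ℝ ∞ g z) (hg' : ContDiffAt ℝ ∞ g' z)
    (h : ∀ j ≤ k, iteratedFDeriv ℝ j g z = iteratedFDeriv ℝ j g' z)
    (h' : ∀ j ≤ k, iteratedFDeriv ℝ j G (g z) = iteratedFDeriv ℝ j G' (g z)) :
    iteratedFDeriv ℝ k (fun y => G (g y)) z = iteratedFDeriv ℝ k (fun y => G' (g' y)) z := by
  have e1 := iteratedFDeriv_comp hG hg (i := k) (by exact_mod_cast le_top)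
  have e2 := iteratedFDeriv_comp (hz ▸ hG' : ContDiffAt ℝ ∞ G' (g' z)) hg' (i := k)
    (by exact_mod_cast le_top)
  refine e1.trans (Eq.trans ?_ e2.symm)
  refine AdaptedChart.taylorComp_congr (fun j hj => ?_) h
  rw [← hz]
  exact h' j hj

/-- In Leibniz' formula each term contains either the undifferentiated f, which vanishes at z, or a
derivative of g of order less than k. This gain of one order is what makes commutators lower the
order of an operator. -/
theorem iteratedFDeriv_smul_eq_zero {f : B → ℝ} {g : B → F} {z : B} {k : ℕ}
    (hf : ContDiffAt ℝ ∞ f z) (hg : ContDiffAt ℝ ∞ g z) (h0 : f z = 0)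
    (h : ∀ j < k, iteratedFDeriv ℝ j g z = 0) :
    ∀ j < k + 1, iteratedFDeriv ℝ j (fun y => f y • g y) z = 0 := by
  intro j hj
  have h1 : ∀ᶠ y in 𝓝 z, ContDiffAt ℝ j f y :=
    (hf.of_le (by exact_mod_cast le_top : (j : WithTop ℕ∞) ≤ ∞)).eventually (by simp)
  have h2 : ∀ᶠ y in 𝓝 z, ContDiffAt ℝ j g y :=
    (hg.of_le (by exact_mod_cast le_top : (j : WithTop ℕ∞) ≤ ∞)).eventually (by simp)
  -- The Leibniz estimate is used within an open set on which both factors are of class C^j; there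
  -- the derivatives within the set are the ordinary ones.
  obtain ⟨u, hu, ho, hzu⟩ := eventually_nhds_iff.1 (h1.and h2)
  have key := norm_iteratedFDerivWithin_smul_le (𝕜 := ℝ) (s := u) (N := j) (n := j)
    (fun y hy => (hu y hy).1.contDiffWithinAt) (fun y hy => (hu y hy).2.contDiffWithinAt)
    ho.uniqueDiffOn hzu le_rfl
  simp only [iteratedFDerivWithin_of_isOpen _ ho hzu] at key
  rw [← norm_le_zero_iff]
  refine key.trans (le_of_eq (Finset.sum_eq_zero fun i _ => ?_))
  rcases Nat.eq_zero_or_pos i with rfl | hi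
  · simp [h0]
  · rw [h (j - i) (by have := Finset.mem_range.1 (by assumption); omega)]
    simp

theorem iteratedFDeriv_slice {H : ℝ × B → F} {t : ℝ} {z : B} (k : ℕ)
    (hH : ContDiffAt ℝ k H (t, z)) (v : Fin k → B) :
    iteratedFDeriv ℝ k (fun y => H (t, y)) z v =
      iteratedFDeriv ℝ k H (t, z) (fun i => (0, v i)) := by
  induction k generalizing z with
  | zero => rfl
  | succ k ih =>
    have hs : ContDiffAt ℝ (k + 1 : ℕ) (fun y => H (t, y)) z :=
      hH.comp z (contDiffAt_const.prodMk contDiffAt_id)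
    rw [iteratedFDeriv_succ_eval k z hs, iteratedFDeriv_succ_eval k _ hH]
    have hev : ∀ᶠ y in 𝓝 z, ContDiffAt ℝ k H (t, y) :=
      (Continuous.prodMk_right t).continuousAt.eventually
        ((hH.of_le (by exact_mod_cast Nat.le_succ k)).eventually (by simp))
    have e : (fun y => iteratedFDeriv ℝ k (fun y => H (t, y)) y (Fin.tail v)) =ᶠ[𝓝 z]
        fun y => iteratedFDeriv ℝ k H (t, y) (Fin.tail fun i => ((0 : ℝ), v i)) := by
      filter_upwards [hev] with y hy
      exact ih hy _
    rw [e.fderiv_eq]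
    have hd : DifferentiableAt ℝ
        (fun q => iteratedFDeriv ℝ k H q (Fin.tail fun i => ((0 : ℝ), v i))) (t, z) :=
      ((ContinuousMultilinearMap.apply ℝ (fun _ : Fin k => ℝ × B) F _).differentiableAt).comp _
        ((hH.iteratedFDeriv_right (m := 1) (by norm_cast; omega)).differentiableAt one_ne_zero)
    have h2 := (hd.hasFDerivAt.comp z (hasFDerivAt_prodMk_right t z)).fderiv
    exact congrArg (fun L => L (v 0)) h2

/-- The derivative in the parameter commutes with the derivatives in z: both sides are the same
derivative of order k + 1 of H, by symmetry. -/
theorem hasDerivAt_iteratedFDeriv_slice {H : ℝ × B → F} {t : ℝ} {z : B}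
    (hH : ContDiffAt ℝ ∞ H (t, z)) (k : ℕ) (v : Fin k → B) :
    HasDerivAt (fun s => iteratedFDeriv ℝ k (fun y => H (s, y)) z v)
      (iteratedFDeriv ℝ k (fun y => fderiv ℝ H (t, y) (1, 0)) z v) t := by
  have hle : ∀ j : ℕ, (j : WithTop ℕ∞) ≤ ∞ := fun j => by exact_mod_cast le_top
  have hev : ∀ᶠ s in 𝓝 t, ContDiffAt ℝ k H (s, z) :=
    (Continuous.prodMk_left z).continuousAt.eventually
      ((hH.of_le (hle k)).eventually (by simp))
  have e : (fun s => iteratedFDeriv ℝ k (fun y => H (s, y)) z v) =ᶠ[𝓝 t]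
      fun s => iteratedFDeriv ℝ k H (s, z) (fun i => (0, v i)) := by
    filter_upwards [hev] with s hs
    exact iteratedFDeriv_slice k hs v
  have hd : DifferentiableAt ℝ
      (fun q => iteratedFDeriv ℝ k H q (fun i => ((0 : ℝ), v i))) (t, z) :=
    ((ContinuousMultilinearMap.apply ℝ (fun _ : Fin k => ℝ × B) F _).differentiableAt).comp _
      ((hH.iteratedFDeriv_right (m := 1) (by exact_mod_cast le_top)).differentiableAt one_ne_zero)
  have h2 := (hd.hasFDerivAt.comp_hasDerivAt t ((hasFDerivAt_prodMk_left t z).hasDerivAt)).congr_of_eventuallyEq e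
  convert! h2 using 1
  have h3 : ContDiffAt ℝ ∞ (fun q => fderiv ℝ H q (1, 0)) (t, z) :=
    (hH.fderiv_right (m := ∞) le_rfl).clm_apply contDiffAt_const
  rw [iteratedFDeriv_slice (H := fun q => fderiv ℝ H q (1, 0)) k (h3.of_le (hle k)),
    iteratedFDeriv_fderiv_apply hH]
  have h4 := iteratedFDeriv_succ_eval k (t, z) (hH.of_le (hle _))
    (Fin.cons ((1 : ℝ), (0 : B)) fun i => ((0 : ℝ), v i))
  -- The direction (1, 0) of the parameter stands in the first slot here and in the last one in the
  -- goal; a cyclic permutation moves it.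
  rw [← iteratedFDeriv_comp_perm' _ (hH.of_le (hle _)) (finRotate (k + 1))] at h4
  have h5 : (Fin.cons ((1 : ℝ), (0 : B)) fun i => ((0 : ℝ), v i) : Fin (k + 1) → ℝ × B) ∘
      finRotate (k + 1) = Fin.snoc (fun i => ((0 : ℝ), v i)) ((1 : ℝ), (0 : B)) := by
    funext i
    refine Fin.lastCases ?_ (fun i => ?_) i
    · simp
    · simp [Fin.cons]
  rw [h5] at h4
  exact h4

end Jets

/-! ### Smoothness of families of multilinear maps -/

/-- Expansion of the arguments in a basis reduces smooth families of vectors to constant ones.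
Smoothness of forms is tested on constant vectors only, so this is how it is applied to moving ones.
-/
theorem contMDiffAt_multilinear_apply {V H₀ H X : Type*} [NormedAddCommGroup V] [NormedSpace ℝ V]
    [FiniteDimensional ℝ V] [NormedAddCommGroup H₀] [NormedSpace ℝ H₀] [TopologicalSpace H]
    {I : ModelWithCorners ℝ H₀ H} [TopologicalSpace X] [ChartedSpace H X] {l : ℕ}
    {A : X → MultilinearMap ℝ (fun _ : Fin l => V) ℝ} {x₀ : X}
    (hA : ∀ v, ContMDiffAt I 𝓘(ℝ, ℝ) ∞ (fun x => A x v) x₀) {m : Fin l → X → V}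
    (hm : ∀ i, ContMDiffAt I 𝓘(ℝ, V) ∞ (m i) x₀) :
    ContMDiffAt I 𝓘(ℝ, ℝ) ∞ (fun x => A x (fun i => m i x)) x₀ := by
  classical
  let b := Module.finBasis ℝ V
  have e : (fun x => A x (fun i => m i x)) = fun x => ∑ j : Fin l → Fin (Module.finrank ℝ V),
      (∏ i, b.coord (j i) (m i x)) • A x (fun i => b (j i)) := by
    funext x
    have h1 : (fun i => m i x) = fun i => ∑ j, b.coord j (m i x) • b j :=
      funext fun i => (b.sum_repr (m i x)).symm
    conv_lhs => rw [h1, MultilinearMap.map_sum]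
    exact Finset.sum_congr rfl fun j _ => MultilinearMap.map_smul_univ _ _ _
  rw [e]
  refine ContMDiffAt.sum fun j _ => ?_
  refine ContMDiffAt.smul (f := fun x => ∏ i, b.coord (j i) (m i x))
    (ContMDiffAt.prod (I := 𝓘(ℝ, ℝ)) (G := ℝ) fun i _ => ?_) (hA _)
  exact (b.coord (j i)).toContinuousLinearMap.contDiff.contMDiff.contMDiffAt.comp x₀ (hm i)

/-! ### Multilinear algebra -/

/-- The target may be infinite-dimensional, but the values of D lie in the span of its values on
tuples of basis vectors; the ε are the coordinates of D in that span. The case of interest has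
barred forms as values. -/
theorem exists_alternatingMap_eq_sum {W N : Type*} [AddCommGroup W] [Module ℝ W]
    [FiniteDimensional ℝ W] [AddCommGroup N] [Module ℝ N] {p : ℕ} (D : W [⋀^Fin p]→ₗ[ℝ] N) :
    ∃ (d : ℕ) (ε : Fin d → W [⋀^Fin p]→ₗ[ℝ] ℝ) (n : Fin d → N),
      ∀ w, D w = ∑ j, ε j w • n j := by
  classical
  let b := Module.finBasis ℝ W
  let S : Submodule ℝ N := Submodule.span ℝ (Set.range fun f : Fin p → Fin _ => D (b ∘ f))
  have hS : FiniteDimensional ℝ S := FiniteDimensional.span_of_finite ℝ (Set.finite_range _)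
  have hD : ∀ w, D w ∈ S := by
    intro w
    have h1 : w = fun i => ∑ j, b.coord j (w i) • b j := funext fun i => (b.sum_repr (w i)).symm
    have h2 : D w = ∑ f : Fin p → Fin _, (∏ i, b.coord (f i) (w i)) • D (b ∘ f) := by
      conv_lhs => rw [h1]
      refine (MultilinearMap.map_sum D.toMultilinearMap _).trans ?_
      exact Finset.sum_congr rfl fun j _ => MultilinearMap.map_smul_univ _ _ _
    rw [h2]
    exact Submodule.sum_mem _ fun f _ => Submodule.smul_mem _ _ (Submodule.subset_span ⟨f, rfl⟩)
  let n := Module.finBasis ℝ S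
  refine ⟨_, fun j => (n.coord j).compAlternatingMap (D.codRestrict S hD), fun j => n j,
    fun w => ?_⟩
  have h1 := congrArg (Submodule.subtype S) (n.sum_repr ⟨D w, hD w⟩).symm
  rw [map_sum] at h1
  exact h1

/-- The exterior product of alternating forms, without a numerical factor. -/
def wedgeAt {V : Type*} [AddCommGroup V] [Module ℝ V] {p l : ℕ} (g : V [⋀^Fin p]→ₗ[ℝ] ℝ)
    (h : V [⋀^Fin l]→ₗ[ℝ] ℝ) : V [⋀^Fin (l + p)]→ₗ[ℝ] ℝ :=
  ((LinearMap.mul' ℝ ℝ).compAlternatingMap (g.domCoprod h)).domDomCongr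
    (finSumFinEquiv.trans (finCongr (Nat.add_comm p l)))

/-! ### Contraction of exterior products and forms of given bidegree -/

section Contract

variable {V : Type*} [AddCommGroup V] [Module ℝ V]

/-- The last vector is contracted first and so occupies the first slot: the vectors enter in
reversed order. This is the source of every `Fin.rev` below. -/
theorem contract_apply {p l : ℕ} (a : V [⋀^Fin (l + p)]→ₗ[ℝ] ℝ) (v : Fin p → V) (w : Fin l → V) :
    contract p a v w = a (fun k => Sum.elim (v ∘ Fin.rev) w
      ((finSumFinEquiv.trans (finCongr (Nat.add_comm p l))).symm k)) := by
  induction p with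
  | zero =>
    change a w = _
    congr 1
    funext k
    have : (finSumFinEquiv.trans (finCongr (Nat.add_comm 0 l))).symm k = Sum.inr k := by
      rw [Equiv.symm_apply_eq]; ext; simp
    rw [this]; rfl
  | succ p ih =>
    change contract p (AlternatingMap.curryLeft (n := l + p) a (v (Fin.last p)))
      (Fin.init v) w = _
    rw [ih]
    change a (Matrix.vecCons _ _) = _
    congr 1
    funext k
    obtain ⟨k, rfl⟩ := (finSumFinEquiv.trans (finCongr (Nat.add_comm (p + 1) l))).surjective k
    rw [Equiv.symm_apply_apply]
    rcases k with k | k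
    · refine Fin.cases ?_ (fun k => ?_) k
      · have : (finSumFinEquiv.trans (finCongr (Nat.add_comm (p + 1) l))) (Sum.inl 0) =
            (0 : Fin (l + p + 1)) := by ext; simp
        rw [this]
        simp
      · have : (finSumFinEquiv.trans (finCongr (Nat.add_comm (p + 1) l))) (Sum.inl k.succ) =
            Fin.succ (finSumFinEquiv.trans (finCongr (Nat.add_comm p l)) (Sum.inl k)) := by
          ext; simp
        rw [this]
        simp [Fin.init, Fin.rev_succ]
    · have : (finSumFinEquiv.trans (finCongr (Nat.add_comm (p + 1) l))) (Sum.inr k) =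
          Fin.succ (finSumFinEquiv.trans (finCongr (Nat.add_comm p l)) (Sum.inr k)) := by
        ext; simp; omega
      rw [this]
      simp

/-- In the sum over shuffles every class except the trivial one puts some v_i into an argument of h,
and that summand vanishes. -/
theorem contract_wedgeAt {p l : ℕ} (g : V [⋀^Fin p]→ₗ[ℝ] ℝ) (h : V [⋀^Fin l]→ₗ[ℝ] ℝ)
    (v : Fin p → V) (hv : ∀ (w : Fin l → V) (j : Fin l) (i : Fin p), w j = v i → h w = 0) :
    contract p (wedgeAt g h) v = g (v ∘ Fin.rev) • h := by
  classical
  ext w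
  rw [contract_apply]
  change LinearMap.mul' ℝ ℝ (g.domCoprod h (fun k => Sum.elim (v ∘ Fin.rev) w
    ((finSumFinEquiv.trans (finCongr (Nat.add_comm p l))).symm
      ((finSumFinEquiv.trans (finCongr (Nat.add_comm p l))) k)))) = _
  simp only [Equiv.symm_apply_apply]
  change LinearMap.mul' ℝ ℝ ((∑ σ, AlternatingMap.domCoprod.summand g h σ) _) = _
  rw [sum_apply]
  refine (congrArg _ (Finset.sum_eq_single (Quotient.mk'' 1) ?_ ?_)).trans ?_
  · intro σ _ hσ
    induction σ using Quotient.inductionOn' with | _ σ => ?_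
    rw [AlternatingMap.domCoprod.summand_mk'']
    have : ∃ j i, Sum.elim (v ∘ Fin.rev) w (σ (Sum.inr j)) = v i := by
      by_contra hne
      push Not at hne
      apply hσ
      refine (Quotient.sound' ?_).symm
      rw [QuotientGroup.leftRel_apply, inv_one, one_mul]
      -- If no v_i reaches h, then σ preserves the two blocks of indices, so its class is the
      -- trivial one.
      have h1 : MapsTo σ (range Sum.inr) (range Sum.inr) := by
        rintro _ ⟨j, rfl⟩
        rcases h2 : σ (Sum.inr j) with i | i
        · exact absurd (by rw [h2]; simp) (hne j i.rev)
        · exact ⟨i, rfl⟩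
      refine Equiv.Perm.mem_sumCongrHom_range_of_perm_mapsTo_inl ?_
      have h2 : BijOn σ (range Sum.inr) (range Sum.inr) :=
        ((Set.toFinite _).injOn_iff_bijOn_of_mapsTo h1).1 σ.injective.injOn
      have h3 := h2.compl σ.bijective
      rw [compl_range_inr] at h3
      exact h3.mapsTo
    obtain ⟨j, i, hji⟩ := this
    have := hv (fun j => Sum.elim (v ∘ Fin.rev) w (σ (Sum.inr j))) j i hji
    rw [smul_apply]
    change Equiv.Perm.sign σ • (g _ ⊗ₜ[ℝ] h fun j => Sum.elim (v ∘ Fin.rev) w (σ (Sum.inr j))) = 0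
    rw [this, TensorProduct.tmul_zero, smul_zero]
  · simp
  · rw [AlternatingMap.domCoprod.summand_mk'']
    simp
    exact Or.inl rfl

theorem wedgeAt_eq {p l : ℕ} (g : V [⋀^Fin p]→ₗ[ℝ] ℝ) (h : V [⋀^Fin l]→ₗ[ℝ] ℝ) :
    wedgeAt g h = ((LinearMap.mul' ℝ ℝ).compAlternatingMap
      (AlternatingMap.domCoprod' (g ⊗ₜ[ℝ] h))).domDomCongr
        (finSumFinEquiv.trans (finCongr (Nat.add_comm p l))) := rfl

/-- The exterior product as a bilinear map. -/
def wedgeL (V : Type*) [AddCommGroup V] [Module ℝ V] (p l : ℕ) : (V [⋀^Fin p]→ₗ[ℝ] ℝ) →ₗ[ℝ]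
    (V [⋀^Fin l]→ₗ[ℝ] ℝ) →ₗ[ℝ] (V [⋀^Fin (l + p)]→ₗ[ℝ] ℝ) :=
  LinearMap.mk₂ ℝ wedgeAt
    (fun g g' h => by simp only [wedgeAt_eq, TensorProduct.add_tmul, map_add]; ext v; simp)
    (fun c g h => by simp only [wedgeAt_eq, ← TensorProduct.smul_tmul', map_smul]; ext v; simp)
    (fun g h h' => by simp only [wedgeAt_eq, TensorProduct.tmul_add, map_add]; ext v; simp)
    (fun c g h => by simp only [wedgeAt_eq, TensorProduct.tmul_smul, map_smul]; ext v; simp)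

/-- Contraction with fixed vectors as a linear map. -/
def contractL (p l : ℕ) (v : Fin p → V) :
    (V [⋀^Fin (l + p)]→ₗ[ℝ] ℝ) →ₗ[ℝ] (V [⋀^Fin l]→ₗ[ℝ] ℝ) where
  toFun a := contract p a v
  map_add' a a' := by ext w; simp [contract_apply]
  map_smul' c a := by ext w; simp [contract_apply]

/-- The `p`-forms which are invariant under a projection `P`. -/
def invForms (P : V →ₗ[ℝ] V) (p : ℕ) : Submodule ℝ (V [⋀^Fin p]→ₗ[ℝ] ℝ) where
  carrier := {g | g.compLinearMap P = g}
  add_mem' := fun {g g'} h h' => by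
    change (g + g').compLinearMap P = g + g'
    conv_rhs => rw [← show g.compLinearMap P = g from h, ← show g'.compLinearMap P = g' from h']
    rfl
  zero_mem' := rfl
  smul_mem' := fun c g h => by
    change (c • g).compLinearMap P = c • g
    conv_rhs => rw [← show g.compLinearMap P = g from h]
    rfl

/-- The `l`-forms which vanish as soon as one argument is in the range of `P`. -/
def killForms (P : V →ₗ[ℝ] V) (l : ℕ) : Submodule ℝ (V [⋀^Fin l]→ₗ[ℝ] ℝ) where
  carrier := {h | ∀ (w : Fin l → V) (j : Fin l), w j ∈ LinearMap.range P → h w = 0}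
  add_mem' := fun {g g'} h h' w j hj => by rw [AlternatingMap.add_apply, h w j hj, h' w j hj, add_zero]
  zero_mem' := fun _ _ _ => rfl
  smul_mem' := fun c g h w j hj => by rw [AlternatingMap.smul_apply, h w j hj, smul_zero]

/-- The forms of bidegree `(p, l)` with respect to a projection `P`. -/
def biForms (P : V →ₗ[ℝ] V) (p l : ℕ) : Submodule ℝ (V [⋀^Fin (l + p)]→ₗ[ℝ] ℝ) :=
  LinearMap.range (TensorProduct.lift
    ((wedgeL V p l).domRestrict₁₂ (invForms P p) (killForms P l)))

theorem wedgeAt_mem_biForms {P : V →ₗ[ℝ] V} {p l : ℕ} {g : V [⋀^Fin p]→ₗ[ℝ] ℝ}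
    {h : V [⋀^Fin l]→ₗ[ℝ] ℝ} (hg : g ∈ invForms P p) (hh : h ∈ killForms P l) :
    wedgeAt g h ∈ biForms P p l :=
  ⟨(⟨g, hg⟩ : invForms P p) ⊗ₜ[ℝ] (⟨h, hh⟩ : killForms P l), by rw [TensorProduct.lift.tmul]; rfl⟩

theorem contract_wedgeAt_of_mem {P : V →ₗ[ℝ] V} {p l : ℕ} {h : V [⋀^Fin l]→ₗ[ℝ] ℝ}
    (g : V [⋀^Fin p]→ₗ[ℝ] ℝ) (hh : h ∈ killForms P l) {v : Fin p → V}
    (hv : ∀ i, v i ∈ LinearMap.range P) :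
    contract p (wedgeAt g h) v = g (v ∘ Fin.rev) • h :=
  contract_wedgeAt g h v fun w j i e => hh w j (e ▸ hv i)

/-- Write a as a finite sum of f_i ∧ n_i with the n_i in a basis of the forms killed by the range of
P. Contraction with v gives the sum of f_i(v) n_i, so every f_i vanishes on the range of P. Being
invariant under P, it is zero. No finiteness of the dimension enters. -/
theorem eq_zero_of_contract_eq_zero {P : V →ₗ[ℝ] V} {p l : ℕ} {a : V [⋀^Fin (l + p)]→ₗ[ℝ] ℝ}
    (ha : a ∈ biForms P p l)
    (h0 : ∀ v : Fin p → V, (∀ i, v i ∈ LinearMap.range P) → contract p a v = 0) : a = 0 := by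
  classical
  obtain ⟨t, rfl⟩ := ha
  let n := Module.Basis.ofVectorSpace ℝ (killForms P l)
  obtain ⟨f, rfl⟩ := (TensorProduct.equivFinsuppOfBasisRight (M := invForms P p) n).symm.surjective t
  suffices hf : f = 0 by rw [hf, map_zero, map_zero]
  ext i : 1
  refine Subtype.ext ?_
  rw [← show ((f i : invForms P p) : V [⋀^Fin p]→ₗ[ℝ] ℝ).compLinearMap P = f i from (f i).2]
  ext v
  -- The vectors are supplied in reversed order because contraction reverses them again.
  have h1 := h0 (fun i => P (v i.rev)) fun i => ⟨_, rfl⟩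
  change contractL p l _ _ = 0 at h1
  rw [TensorProduct.equivFinsuppOfBasisRight_symm_apply, Finsupp.sum, map_sum, map_sum] at h1
  have h2 : ∀ i, contractL p l (fun i => P (v i.rev)) (TensorProduct.lift
      ((wedgeL V p l).domRestrict₁₂ (invForms P p) (killForms P l)) (f i ⊗ₜ[ℝ] n i)) =
      (f i : V [⋀^Fin p]→ₗ[ℝ] ℝ) (fun i => P (v i)) • (n i : V [⋀^Fin l]→ₗ[ℝ] ℝ) := by
    intro i
    refine (contract_wedgeAt_of_mem (P := P) (f i).1 (n i).2 fun i => ⟨_, rfl⟩).trans ?_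
    congr 2
    funext i
    simp
  simp only [h2] at h1
  have h3 : ∑ i ∈ f.support, (f i : V [⋀^Fin p]→ₗ[ℝ] ℝ) (fun i => P (v i)) • n i = 0 := by
    refine Subtype.ext ?_
    simpa using h1
  by_cases hi : i ∈ f.support
  · exact linearIndependent_iff'.1 n.linearIndependent _ _ h3 i hi
  · rw [Finsupp.notMem_support_iff.1 hi]
    rfl

end Contract
end FiniteJet

namespace FiniteJet

/-! ### Coordinates on jet spaces -/

section JetGeometry

instance finiteDimensional_symMul {B F : Type*} [NormedAddCommGroup B] [NormedSpace ℝ B]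
    [NormedAddCommGroup F] [NormedSpace ℝ F] [FiniteDimensional ℝ B] [FiniteDimensional ℝ F]
    (k : ℕ) : FiniteDimensional ℝ (SymMul B F k) := by
  have hfin : FiniteDimensional ℝ (B [×k]→L[ℝ] F) :=
    FiniteDimensional.of_injective
      (ContinuousMultilinearMap.toMultilinearMapLinear :
        (B [×k]→L[ℝ] F) →ₗ[ℝ] MultilinearMap ℝ (fun _ : Fin k => B) F)
      ContinuousMultilinearMap.toMultilinearMap_injective
  exact inferInstanceAs (FiniteDimensional ℝ (symMul B F k))

variable {B F M E : Type*}
  [NormedAddCommGroup B] [NormedSpace ℝ B] [NormedAddCommGroup F] [NormedSpace ℝ F]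
  [TopologicalSpace M] [ChartedSpace B M] [TopologicalSpace E] [ChartedSpace (B × F) E]
  [FiniteDimensional ℝ B] [FiniteDimensional ℝ F] [IsManifold 𝓘(ℝ, B × F) ∞ E]
  {π : FibredManifold B F M E} {r : ℕ}

namespace AdaptedChart

/-- The coordinates `(x^λ, u^i_σ)` as a function on `J^r π`. -/
def jetCoord (c : AdaptedChart π) (r : ℕ) (η : Jet π r) : JetModel B F r := c.coords r η.rep

/-- The induced chart of `J^r π` as an open partial homeomorphism. -/
def jetHomeo (c : AdaptedChart π) (r : ℕ) (θ₀ : Jet π r) :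
    OpenPartialHomeomorph (Jet π r) (JetModel B F r) :=
  (jetCore π r).openPartialHomeomorph (c.jetChart r θ₀) ⟨c, θ₀, rfl⟩

theorem coe_jetHomeo (c : AdaptedChart π) (r : ℕ) (θ₀ : Jet π r) :
    ⇑(c.jetHomeo r θ₀) = c.jetCoord r := rfl

theorem jetHomeo_source (c : AdaptedChart π) (r : ℕ) (θ₀ : Jet π r) :
    (c.jetHomeo r θ₀).source = {η | η.toE ∈ c.tot.source} := rfl

theorem jetHomeo_mem_atlas (c : AdaptedChart π) (r : ℕ) (θ₀ : Jet π r) :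
    c.jetHomeo r θ₀ ∈ atlas (JetModel B F r) (Jet π r) := by
  change _ ∈ ⋃ (e) (he : e ∈ (jetCore π r).atlas),
        {(jetCore π r).openPartialHomeomorph e he}
  simp only [mem_iUnion, mem_singleton_iff]
  exact ⟨_, ⟨c, θ₀, rfl⟩, rfl⟩

theorem jetHomeo_mem_maximalAtlas (c : AdaptedChart π) (r : ℕ) (θ₀ : Jet π r) :
    c.jetHomeo r θ₀ ∈ IsManifold.maximalAtlas 𝓘(ℝ, JetModel B F r) ∞ (Jet π r) :=
  IsManifold.subset_maximalAtlas (c.jetHomeo_mem_atlas r θ₀)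

theorem isOpen_jetSource (c : AdaptedChart π) (r : ℕ) :
    IsOpen {η : Jet π r | η.toE ∈ c.tot.source} := by
  -- The chart as a partial homeomorphism needs some jet as a default value, hence the separate
  -- treatment of an empty jet space.
  rcases isEmpty_or_nonempty (Jet π r) with h | ⟨⟨θ₀⟩⟩
  · rw [Set.eq_empty_of_isEmpty {η : Jet π r | η.toE ∈ c.tot.source}]
    exact isOpen_empty
  · exact (c.jetHomeo r θ₀).open_source

theorem jetCoord_jetMk (c : AdaptedChart π) (r : ℕ) (a : PointedSection π)
    (h : a.sec.toFun a.pt ∈ c.tot.source) : c.jetCoord r (jetMk r a) = c.coords r a :=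
  c.coords_congr (rep_jetMk a) (by rwa [(rep_jetMk a).2.1])

theorem jetCoord_point (c : AdaptedChart π) {η : Jet π r} (h : η.toE ∈ c.tot.source) :
    ((c.jetCoord r η).1, (c.jetCoord r η).value) = c.tot η.toE :=
  c.coords_point r η.rep h

theorem contMDiffAt_jetCoord (c : AdaptedChart π) {η : Jet π r} (h : η.toE ∈ c.tot.source) :
    ContMDiffAt 𝓘(ℝ, JetModel B F r) 𝓘(ℝ, JetModel B F r) ∞ (c.jetCoord r) η :=
  contMDiffAt_of_mem_maximalAtlas (c.jetHomeo_mem_maximalAtlas r η) h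

theorem jetCoord_injOn (c : AdaptedChart π) {η η' : Jet π r} (h : η.toE ∈ c.tot.source)
    (h' : η'.toE ∈ c.tot.source) (e : c.jetCoord r η = c.jetCoord r η') : η = η' :=
  (c.jetHomeo r η).injOn h h' e

theorem jetCoord_trans (c c' : AdaptedChart π) {η : Jet π r} (h : η.toE ∈ c.tot.source)
    (h' : η.toE ∈ c'.tot.source) : c'.jetCoord r η = transMap c c' r (c.jetCoord r η) :=
  c.coords_trans c' r η.rep h h'

theorem contDiffAt_transMap_jetCoord (c c' : AdaptedChart π) {η : Jet π r}
    (h : η.toE ∈ c.tot.source) (h' : η.toE ∈ c'.tot.source) :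
    ContDiffAt ℝ ∞ (transMap c c' r) (c.jetCoord r η) := by
  refine contDiffAt_transMap c c' ?_ ?_
  · rw [c.jetCoord_point h]; exact c.tot.map_source h
  · rw [c.jetCoord_point h, c.tot.left_inv h]; exact h'

/-- The differential of the jet coordinates. -/
def dCoord (c : AdaptedChart π) (η : Jet π r) : TJet η →L[ℝ] JetModel B F r :=
  mfderiv 𝓘(ℝ, JetModel B F r) 𝓘(ℝ, JetModel B F r) (c.jetCoord r) η

theorem dCoord_bijective (c : AdaptedChart π) {η : Jet π r} (h : η.toE ∈ c.tot.source) :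
    Function.Bijective (c.dCoord η) := by
  have hm : (c.jetHomeo r η).MDifferentiable 𝓘(ℝ, JetModel B F r) 𝓘(ℝ, JetModel B F r) :=
    ⟨(contMDiffOn_of_mem_maximalAtlas (c.jetHomeo_mem_maximalAtlas r η)).mdifferentiableOn
      (by simp), (contMDiffOn_symm_of_mem_maximalAtlas
        (c.jetHomeo_mem_maximalAtlas r η)).mdifferentiableOn (by simp)⟩
  exact hm.mfderiv_bijective h

theorem dCoord_trans (c c' : AdaptedChart π) {η : Jet π r} (h : η.toE ∈ c.tot.source)
    (h' : η.toE ∈ c'.tot.source) (v : TJet η) :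
    c'.dCoord η v = fderiv ℝ (transMap c c' r) (c.jetCoord r η) (c.dCoord η v) := by
  have e : c'.jetCoord r =ᶠ[𝓝 η] transMap c c' r ∘ c.jetCoord r := by
    filter_upwards [(c.isOpen_jetSource r).mem_nhds h, (c'.isOpen_jetSource r).mem_nhds h']
      with η' h1 h2
    exact c.jetCoord_trans c' h1 h2
  have h1 := (c.contMDiffAt_jetCoord h).mdifferentiableAt (by simp)
  have h2 : DifferentiableAt ℝ (transMap c c' r) (c.jetCoord r η) :=
    (c.contDiffAt_transMap_jetCoord c' h h').differentiableAt (by simp)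
  have h3 := (h2.hasFDerivAt.hasMFDerivAt.comp η h1.hasMFDerivAt).congr_of_eventuallyEq e
  rw [dCoord, h3.mfderiv]
  rfl

end AdaptedChart

/-- The trivialisation of the tangent bundle centred at η₀ is the differential of the chart chosen
at η₀. Together with `dCoord_trans` this permits computation with `coordVec` in any adapted chart.
-/
theorem dCoord_coordVec {η₀ η : Jet π r} (h : η.toE ∈ (adaptedChartAt π η₀.toE).tot.source)
    (v : JetModel B F r) : (adaptedChartAt π η₀.toE).dCoord η (coordVec η₀ η v) = v := by
  have h1 := TangentBundle.continuousLinearMapAt_trivializationAt (I := 𝓘(ℝ, JetModel B F r))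
    (x₀ := η₀) (x := η) h
  have h2 : (adaptedChartAt π η₀.toE).dCoord η = _ := h1.symm
  rw [h2, coordVec]
  exact Bundle.Trivialization.continuousLinearMapAt_symmL _ (by simpa using! h) v

theorem dCoord_coordVec' {η₀ η : Jet π r} (h : η.toE ∈ (adaptedChartAt π η₀.toE).tot.source)
    (c : AdaptedChart π) (hc : η.toE ∈ c.tot.source) (v : JetModel B F r) :
    c.dCoord η (coordVec η₀ η v) = fderiv ℝ (AdaptedChart.transMap (adaptedChartAt π η₀.toE) c r)
      ((adaptedChartAt π η₀.toE).jetCoord r η) v := by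
  rw [(adaptedChartAt π η₀.toE).dCoord_trans c h hc, dCoord_coordVec h]

theorem eq_coordVec {η₀ η : Jet π r} (h : η.toE ∈ (adaptedChartAt π η₀.toE).tot.source)
    {v : TJet η} {w : JetModel B F r} (e : (adaptedChartAt π η₀.toE).dCoord η v = w) :
    v = coordVec η₀ η w :=
  ((adaptedChartAt π η₀.toE).dCoord_bijective h).1 (e.trans (dCoord_coordVec h w).symm)

/-- The value `u = u_0` as a continuous linear function of the jet coordinates. -/
def valueL (B F : Type*) [NormedAddCommGroup B] [NormedSpace ℝ B] [NormedAddCommGroup F]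
    [NormedSpace ℝ F] (r : ℕ) : JetModel B F r →L[ℝ] F :=
  (ContinuousMultilinearMap.apply ℝ (fun _ : Fin ((0 : Fin (r + 1)) : ℕ) => B) F
    (fun _ => 0)) ∘L (SymMul.inclL _ ∘L
      (ContinuousLinearMap.proj 0 ∘L ContinuousLinearMap.snd ℝ B _))

theorem contMDiff_toE : ContMDiff 𝓘(ℝ, JetModel B F r) 𝓘(ℝ, B × F) ∞
    (Jet.toE : Jet π r → E) := by
  intro η
  let c := adaptedChartAt π η.toE
  have h : η.toE ∈ c.tot.source := mem_adaptedChartAt π η.toE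
  have h1 : ContMDiffAt 𝓘(ℝ, JetModel B F r) 𝓘(ℝ, B × F) ∞
      (fun p : JetModel B F r => (p.1, p.value)) (c.jetCoord r η) :=
    (contDiff_fst.prodMk (valueL B F r).contDiff).contMDiff.contMDiffAt
  have h2 : ContMDiffAt 𝓘(ℝ, B × F) 𝓘(ℝ, B × F) ∞ c.tot.symm
      ((c.jetCoord r η).1, (c.jetCoord r η).value) := by
    rw [c.jetCoord_point h]
    exact contMDiffAt_symm_of_mem_maximalAtlas c.tot_mem (c.tot.map_source h)
  refine (h2.comp η (h1.comp η (c.contMDiffAt_jetCoord h))).congr_of_eventuallyEq ?_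
  filter_upwards [(c.isOpen_jetSource r).mem_nhds h] with η' h'
  simp only [Function.comp_apply]
  rw [c.jetCoord_point h', c.tot.left_inv h']

theorem proj_toE (η : Jet π r) : π.proj η.toE = η.base :=
  η.rep.sec.proj_apply _ η.rep.mem

theorem base_jetMk (a : PointedSection π) : (jetMk r a).base = a.pt := (rep_jetMk a).1

theorem toE_proj (θ : Jet π (r + 1)) : θ.proj.toE = θ.toE := toE_jetMk r θ.rep

theorem proj_jetMk (a : PointedSection π) : (jetMk (r + 1) a).proj = jetMk r a := by
  refine Quotient.sound (s := jetSetoid π r) ?_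
  have h := rep_jetMk (r := r + 1) a
  exact ⟨h.1, h.2.1, fun c hc k hk => h.2.2 c hc k (hk.trans (Nat.le_succ r))⟩

theorem proj_surjective : Function.Surjective (Jet.proj : Jet π (r + 1) → Jet π r) := fun η =>
  ⟨jetMk (r + 1) η.rep, (proj_jetMk _).trans (jetMk_rep η)⟩

/-- Two jets with the same value in E lie in the domain of one induced chart and are separated
there; otherwise their values are separated in E. -/
instance [T2Space E] : T2Space (Jet π r) := by
  refine ⟨fun η η' hne => ?_⟩
  by_cases he : η.toE = η'.toE
  · let c := adaptedChartAt π η.toE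
    have h : η.toE ∈ c.tot.source := mem_adaptedChartAt π η.toE
    have h' : η'.toE ∈ c.tot.source := he ▸ h
    obtain ⟨U, V, hU, hV, hηU, hηV, hUV⟩ := t2_separation
      (fun e => hne (c.jetCoord_injOn h h' e) : c.jetCoord r η ≠ c.jetCoord r η')
    exact ⟨_, _, (c.jetHomeo r η).isOpen_inter_preimage hU,
      (c.jetHomeo r η).isOpen_inter_preimage hV, ⟨h, hηU⟩, ⟨h', hηV⟩,
      (hUV.preimage _).mono inter_subset_right inter_subset_right⟩
  · obtain ⟨U, V, hU, hV, hηU, hηV, hUV⟩ := t2_separation he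
    exact ⟨_, _, hU.preimage contMDiff_toE.continuous, hV.preimage contMDiff_toE.continuous,
      hηU, hηV, hUV.preimage _⟩

/-- Countably many adapted charts cover E, and the charts they induce cover the jet space. -/
instance [SecondCountableTopology E] : SecondCountableTopology (Jet π r) := by
  obtain ⟨s, hs, hcov⟩ := TopologicalSpace.countable_cover_nhds
    (f := fun y : E => (adaptedChartAt π y).tot.source)
    (fun y => (adaptedChartAt π y).tot.open_source.mem_nhds (mem_adaptedChartAt π y))
  have := hs.to_subtype
  have hsc : ∀ y : s, SecondCountableTopology
      {η : Jet π r | η.toE ∈ (adaptedChartAt π (y : E)).tot.source} := fun y => by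
    rcases isEmpty_or_nonempty (Jet π r) with h | ⟨⟨θ₀⟩⟩
    · infer_instance
    · exact ((adaptedChartAt π (y : E)).jetHomeo r θ₀).secondCountableTopology_source
  refine TopologicalSpace.secondCountableTopology_of_countable_cover
    (fun y : s => (adaptedChartAt π (y : E)).isOpen_jetSource r) ?_
  refine eq_univ_of_forall fun η => ?_
  have h : η.toE ∈ ⋃ y ∈ s, (adaptedChartAt π y).tot.source := hcov ▸ mem_univ _
  simp only [mem_iUnion] at h ⊢
  obtain ⟨y, hy, h⟩ := h
  exact ⟨⟨y, hy⟩, h⟩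

/-- Together with the Hausdorff property this provides the smooth partitions of unity on J^rπ. -/
instance [SecondCountableTopology E] : SigmaCompactSpace (Jet π r) := by
  have := Manifold.locallyCompact_of_finiteDimensional (M := Jet π r) 𝓘(ℝ, JetModel B F r)
  infer_instance

theorem contMDiff_base : ContMDiff 𝓘(ℝ, JetModel B F r) 𝓘(ℝ, B) ∞ (Jet.base : Jet π r → M) := by
  intro η
  let c := adaptedChartAt π η.toE
  have h : η.toE ∈ c.tot.source := mem_adaptedChartAt π η.toE
  have hb : ∀ η' : Jet π r, η'.toE ∈ c.tot.source → η'.base ∈ c.base.source := fun η' h' => by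
    rw [← proj_toE]; exact c.proj_mem _ h'
  have h2 : ContMDiffAt 𝓘(ℝ, B) 𝓘(ℝ, B) ∞ c.base.symm (c.jetCoord r η).1 :=
    contMDiffAt_symm_of_mem_maximalAtlas c.base_mem (c.base.map_source (hb η h))
  have h1 : ContMDiffAt 𝓘(ℝ, JetModel B F r) 𝓘(ℝ, B) ∞ (fun p : JetModel B F r => p.1)
      (c.jetCoord r η) := contDiff_fst.contMDiff.contMDiffAt
  refine (h2.comp η (h1.comp η (c.contMDiffAt_jetCoord h))).congr_of_eventuallyEq ?_
  filter_upwards [(c.isOpen_jetSource r).mem_nhds h] with η' h'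
  exact (c.base.left_inv (hb η' h')).symm

namespace AdaptedChart

theorem base_mem_of_toE (c : AdaptedChart π) {η : Jet π r} (h : η.toE ∈ c.tot.source) :
    η.base ∈ c.base.source := by
  rw [← proj_toE]; exact c.proj_mem _ h

theorem contMDiffAt_base (c : AdaptedChart π) {x : M} (h : x ∈ c.base.source) :
    ContMDiffAt 𝓘(ℝ, B) 𝓘(ℝ, B) ∞ c.base x :=
  contMDiffAt_of_mem_maximalAtlas c.base_mem h

theorem mfderiv_base_apply (c : AdaptedChart π) {η : Jet π r} (h : η.toE ∈ c.tot.source)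
    (v : TJet η) : mfderiv 𝓘(ℝ, B) 𝓘(ℝ, B) c.base η.base
      (mfderiv 𝓘(ℝ, JetModel B F r) 𝓘(ℝ, B) (Jet.base : Jet π r → M) η v) = (c.dCoord η v).1 := by
  have h1 := (((c.contMDiffAt_base (c.base_mem_of_toE h)).mdifferentiableAt (by simp)).hasMFDerivAt).comp
    η ((contMDiff_base (π := π) η).mdifferentiableAt (by simp)).hasMFDerivAt
  have h2 := (hasFDerivAt_fst (𝕜 := ℝ) (p := c.jetCoord r η)).hasMFDerivAt.comp η
    ((c.contMDiffAt_jetCoord h).mdifferentiableAt (by simp)).hasMFDerivAt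
  exact congrArg (fun L => L v) (hasMFDerivAt_unique h1 h2)

/-- The jet coordinates of a section along its points, as functions of the base coordinates. -/
def secCoord (c : AdaptedChart π) (r : ℕ) (s : LocalSection π) (z : B) : JetModel B F r :=
  (z, fun k => toSym k (iteratedFDeriv ℝ k (c.rep s) z))

theorem contDiffAt_secCoord (c : AdaptedChart π) (s : LocalSection π) {x : M} (hx : x ∈ s.dom)
    (h : s.toFun x ∈ c.tot.source) : ContDiffAt ℝ ∞ (c.secCoord r s) (c.base x) := by
  have h0 := c.contDiffAt_rep s hx h
  refine contDiffAt_id.prodMk (contDiffAt_pi.2 fun k => contDiffAt_toSym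
    (h0.iteratedFDeriv_right (m := ∞) (by exact_mod_cast le_top)) ?_)
  have hk : ∀ᶠ y in 𝓝 (c.base x), ContDiffAt ℝ (k : ℕ) (c.rep s) y :=
    (h0.of_le (by exact_mod_cast le_top : ((k : ℕ) : WithTop ℕ∞) ≤ ∞)).eventually (by simp)
  filter_upwards [hk] with y hy
  exact fun σ v => iteratedFDeriv_comp_perm' k hy σ v

theorem eventually_section (c : AdaptedChart π) (s : LocalSection π) {x : M} (hx : x ∈ s.dom)
    (h : s.toFun x ∈ c.tot.source) :
    ∀ᶠ y in 𝓝 x, y ∈ s.dom ∧ s.toFun y ∈ c.tot.source :=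
  (s.isOpen_dom.eventually_mem hx).and
    (((s.smooth.contMDiffAt (s.isOpen_dom.mem_nhds hx)).continuousAt).eventually
      (c.tot.open_source.mem_nhds h))

theorem jetCoord_prolong (c : AdaptedChart π) (a : PointedSection π) {y : M} (hy : y ∈ a.sec.dom)
    (h : a.sec.toFun y ∈ c.tot.source) :
    c.jetCoord r (prolong r a y) = c.secCoord r a.sec (c.base y) := by
  unfold prolong
  rw [dif_pos hy]
  exact c.jetCoord_jetMk r ⟨a.sec, y, hy⟩ h

theorem toE_prolong (a : PointedSection π) {y : M} (hy : y ∈ a.sec.dom) :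
    (prolong r a y).toE = a.sec.toFun y := by
  unfold prolong
  rw [dif_pos hy]
  exact toE_jetMk r ⟨a.sec, y, hy⟩

end AdaptedChart

/-! ### The horizontal and vertical projections in coordinates -/

theorem prolong_pt (a : PointedSection π) : prolong r a a.pt = jetMk r a := dif_pos a.mem

/-- In coordinates the prolongation is `secCoord`. Smoothness guarantees that the `mfderiv` in
`contactMap` is a genuine derivative and not the default value zero. -/
theorem contMDiffAt_prolong (a : PointedSection π) :
    ContMDiffAt 𝓘(ℝ, B) 𝓘(ℝ, JetModel B F r) ∞ (prolong r a) a.pt := by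
  let c := adaptedChartAt π (a.sec.toFun a.pt)
  have h : a.sec.toFun a.pt ∈ c.tot.source := mem_adaptedChartAt π _
  have h1 := c.contMDiffAt_base (c.base_mem_source a.sec a.mem h)
  have h2 : ContMDiffAt 𝓘(ℝ, B) 𝓘(ℝ, JetModel B F r) ∞ (c.secCoord r a.sec) (c.base a.pt) :=
    (c.contDiffAt_secCoord a.sec a.mem h).contMDiffAt
  have ht : c.secCoord r a.sec (c.base a.pt) ∈ (c.jetHomeo r (jetMk r a)).target := by
    rw [← c.jetCoord_prolong a a.mem h, ← c.coe_jetHomeo r (jetMk r a)]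
    refine (c.jetHomeo r (jetMk r a)).map_source ?_
    rw [c.jetHomeo_source, mem_ofPred_eq, AdaptedChart.toE_prolong a a.mem]
    exact h
  have h3 : ContMDiffAt 𝓘(ℝ, JetModel B F r) 𝓘(ℝ, JetModel B F r) ∞
      (c.jetHomeo r (jetMk r a)).symm (c.secCoord r a.sec (c.base a.pt)) :=
    contMDiffAt_symm_of_mem_maximalAtlas (c.jetHomeo_mem_maximalAtlas r (jetMk r a)) ht
  refine (h3.comp a.pt (h2.comp a.pt h1)).congr_of_eventuallyEq ?_
  filter_upwards [c.eventually_section a.sec a.mem h] with y hy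
  simp only [Function.comp_apply]
  rw [← c.jetCoord_prolong a hy.1 hy.2, ← c.coe_jetHomeo r (jetMk r a),
    (c.jetHomeo r (jetMk r a)).left_inv]
  rw [c.jetHomeo_source, mem_ofPred_eq, AdaptedChart.toE_prolong a hy.1]
  exact hy.2

theorem dCoord_contactMap (c : AdaptedChart π) (θ : Jet π (r + 1)) (h : θ.toE ∈ c.tot.source)
    (b : TangentSpace 𝓘(ℝ, B) θ.proj.base) :
    c.dCoord θ.proj (contactMap θ b) = fderiv ℝ (c.secCoord r θ.rep.sec) (c.base θ.base)
      (mfderiv 𝓘(ℝ, B) 𝓘(ℝ, B) c.base θ.base b) := by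
  have hp : prolong r θ.rep θ.rep.pt = θ.proj := prolong_pt θ.rep
  have h0 : θ.proj.toE ∈ c.tot.source := by rwa [toE_proj]
  have h1 : HasMFDerivAt 𝓘(ℝ, JetModel B F r) 𝓘(ℝ, JetModel B F r) (c.jetCoord r)
      (prolong r θ.rep θ.rep.pt) (c.dCoord (prolong r θ.rep θ.rep.pt)) :=
    ((c.contMDiffAt_jetCoord (hp ▸ h0)).mdifferentiableAt (by simp)).hasMFDerivAt
  have h2 := h1.comp θ.rep.pt
    ((contMDiffAt_prolong θ.rep).mdifferentiableAt (by simp)).hasMFDerivAt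
  have h3 := ((c.contDiffAt_secCoord (r := r) θ.rep.sec θ.rep.mem h).differentiableAt
    (by simp)).hasFDerivAt.hasMFDerivAt.comp θ.rep.pt
    (((c.contMDiffAt_base (c.base_mem_source _ θ.rep.mem h)).mdifferentiableAt (by simp)).hasMFDerivAt)
  have e : c.jetCoord r ∘ prolong r θ.rep =ᶠ[𝓝 θ.rep.pt] c.secCoord r θ.rep.sec ∘ c.base := by
    filter_upwards [c.eventually_section θ.rep.sec θ.rep.mem h] with y hy
    exact c.jetCoord_prolong θ.rep hy.1 hy.2
  have h4 := congrArg (fun L => L b) (hasMFDerivAt_unique h2 (h3.congr_of_eventuallyEq e))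
  -- The prolongation at the base point equals the projected jet only propositionally. All tangent
  -- spaces are copies of the model space, so the vector is carried across unchanged.
  have h5 : ∀ (η η' : Jet π r) (_ : η = η') (v : JetModel B F r),
      c.dCoord η v = c.dCoord η' v := by rintro _ _ rfl _; rfl
  exact (h5 _ _ hp.symm _).trans h4

theorem dCoord_hor (c : AdaptedChart π) (θ : Jet π (r + 1)) (h : θ.toE ∈ c.tot.source)
    (v : TJet θ.proj) : c.dCoord θ.proj (hor θ v) =
      fderiv ℝ (c.secCoord r θ.rep.sec) (c.base θ.base) (c.dCoord θ.proj v).1 := by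
  have h0 : θ.proj.toE ∈ c.tot.source := by rwa [toE_proj]
  have hb : θ.proj.base = θ.base := base_jetMk θ.rep
  rw [← c.mfderiv_base_apply h0 v]
  refine (dCoord_contactMap c θ h _).trans ?_
  have h5 : ∀ (x x' : M) (_ : x = x') (v : B), (mfderiv 𝓘(ℝ, B) 𝓘(ℝ, B) c.base x : B →L[ℝ] B) v =
      (mfderiv 𝓘(ℝ, B) 𝓘(ℝ, B) c.base x' : B →L[ℝ] B) v := by rintro _ _ rfl _; rfl
  exact congrArg (fderiv ℝ (c.secCoord r θ.rep.sec) (c.base θ.base)) (h5 _ _ hb.symm _)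

/-- The base component of the coordinates along a section is the identity, so the horizontal
projection keeps the dx-part. Since it also depends on nothing but the dx-part, it is idempotent and
its kernel consists of the vertical vectors. -/
theorem dCoord_hor_fst (c : AdaptedChart π) (θ : Jet π (r + 1)) (h : θ.toE ∈ c.tot.source)
    (v : TJet θ.proj) : (c.dCoord θ.proj (hor θ v)).1 = (c.dCoord θ.proj v).1 := by
  rw [dCoord_hor c θ h]
  have h1 := (((c.contDiffAt_secCoord (r := r) θ.rep.sec θ.rep.mem h).differentiableAt
    (by simp)).hasFDerivAt).fst
  have h2 : HasFDerivAt (fun z => (c.secCoord r θ.rep.sec z).1) (ContinuousLinearMap.id ℝ B)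
    (c.base θ.rep.pt) := hasFDerivAt_id _
  exact congrArg (fun L => L (c.dCoord θ.proj v).1) (h1.unique h2)

theorem hor_eq_zero_iff (c : AdaptedChart π) (θ : Jet π (r + 1)) (h : θ.toE ∈ c.tot.source)
    (v : TJet θ.proj) : hor θ v = 0 ↔ (c.dCoord θ.proj v).1 = 0 := by
  have h0 : θ.proj.toE ∈ c.tot.source := by rwa [toE_proj]
  constructor
  · intro e
    rw [← dCoord_hor_fst c θ h, e, map_zero]
    rfl
  · intro e
    apply (c.dCoord_bijective h0).1
    rw [dCoord_hor c θ h, e, map_zero, map_zero]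

theorem hor_hor (θ : Jet π (r + 1)) (v : TJet θ.proj) : hor θ (hor θ v) = hor θ v := by
  have h := mem_adaptedChartAt π θ.toE
  apply ((adaptedChartAt π θ.toE).dCoord_bijective (by rwa [toE_proj])).1
  rw [dCoord_hor _ θ h, dCoord_hor_fst _ θ h, ← dCoord_hor _ θ h]

theorem ver_apply (θ : Jet π (r + 1)) (v : TJet θ.proj) : ver θ v = v - hor θ v := rfl

theorem hor_ver (θ : Jet π (r + 1)) (v : TJet θ.proj) : hor θ (ver θ v) = 0 := by
  rw [ver_apply, map_sub, hor_hor, sub_self]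

theorem ver_eq_self_iff (θ : Jet π (r + 1)) (v : TJet θ.proj) : ver θ v = v ↔ hor θ v = 0 := by
  rw [ver_apply, sub_eq_self]

theorem mem_range_ver_iff (θ : Jet π (r + 1)) (v : TJet θ.proj) :
    v ∈ LinearMap.range (ver θ) ↔ hor θ v = 0 :=
  ⟨by rintro ⟨w, rfl⟩; exact hor_ver θ w, fun h => ⟨v, (ver_eq_self_iff θ v).2 h⟩⟩

theorem mem_range_ver_iff_coord (c : AdaptedChart π) (θ : Jet π (r + 1))
    (h : θ.toE ∈ c.tot.source) (v : TJet θ.proj) :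
    v ∈ LinearMap.range (ver θ) ↔ (c.dCoord θ.proj v).1 = 0 :=
  (mem_range_ver_iff θ v).trans (hor_eq_zero_iff c θ h v)

theorem ver_ver (θ : Jet π (r + 1)) (v : TJet θ.proj) : ver θ (ver θ v) = ver θ v :=
  (ver_eq_self_iff θ _).2 (hor_ver θ v)

theorem compLinearMap_hor_mem_killForms (θ : Jet π (r + 1)) {l : ℕ}
    (h : TJet θ.proj [⋀^Fin l]→ₗ[ℝ] ℝ) : h.compLinearMap (hor θ) ∈ killForms (ver θ) l := by
  intro w j hj
  exact h.map_coord_zero j ((mem_range_ver_iff θ _).1 hj)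

end JetGeometry
end FiniteJet

namespace FiniteJet

/-! ### Components of vertical fields and their total derivatives -/

section Fields

variable {B F M E : Type*}
  [NormedAddCommGroup B] [NormedSpace ℝ B] [NormedAddCommGroup F] [NormedSpace ℝ F]
  [TopologicalSpace M] [ChartedSpace B M] [TopologicalSpace E] [ChartedSpace (B × F) E]
  [FiniteDimensional ℝ B] [FiniteDimensional ℝ F] [IsManifold 𝓘(ℝ, B × F) ∞ E]
  {π : FibredManifold B F M E} {r : ℕ}

theorem contMDiff_proj (π : FibredManifold B F M E) :
    ContMDiff 𝓘(ℝ, B × F) 𝓘(ℝ, B) ∞ π.proj := by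
  intro y
  let c := adaptedChartAt π y
  have h : y ∈ c.tot.source := mem_adaptedChartAt π y
  have h2 : ContMDiffAt 𝓘(ℝ, B) 𝓘(ℝ, B) ∞ c.base.symm (c.tot y).1 :=
    contMDiffAt_symm_of_mem_maximalAtlas c.base_mem (c.target_base (c.tot.map_source h))
  have h1 : ContMDiffAt 𝓘(ℝ, B × F) 𝓘(ℝ, B) ∞ (fun p : B × F => p.1)
      (c.tot y) := contDiff_fst.contMDiff.contMDiffAt
  refine (h2.comp y (h1.comp y (contMDiffAt_of_mem_maximalAtlas c.tot_mem h))).congr_of_eventuallyEq ?_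
  filter_upwards [c.tot.open_source.mem_nhds h] with y' h'
  simp only [Function.comp_apply]
  rw [← c.base_proj _ h', c.base.left_inv (c.proj_mem _ h')]

namespace AdaptedChart

theorem contMDiffAt_tot (c : AdaptedChart π) {y : E} (h : y ∈ c.tot.source) :
    ContMDiffAt 𝓘(ℝ, B × F) 𝓘(ℝ, B × F) ∞ c.tot y :=
  contMDiffAt_of_mem_maximalAtlas c.tot_mem h

/-- The differential of the chart of the total space. -/
def dTot (c : AdaptedChart π) (y : E) : TangentSpace 𝓘(ℝ, B × F) y →L[ℝ] B × F :=
  mfderiv 𝓘(ℝ, B × F) 𝓘(ℝ, B × F) c.tot y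

theorem tot_mdifferentiable (c : AdaptedChart π) :
    c.tot.MDifferentiable 𝓘(ℝ, B × F) 𝓘(ℝ, B × F) :=
  ⟨(contMDiffOn_of_mem_maximalAtlas c.tot_mem).mdifferentiableOn (by simp),
    (contMDiffOn_symm_of_mem_maximalAtlas c.tot_mem).mdifferentiableOn (by simp)⟩

theorem dTot_injective (c : AdaptedChart π) {y : E} (h : y ∈ c.tot.source) :
    Function.Injective (c.dTot y) := c.tot_mdifferentiable.mfderiv_injective h

theorem dTot_fst (c : AdaptedChart π) {y : E} (h : y ∈ c.tot.source)
    (v : TangentSpace 𝓘(ℝ, B × F) y) : (c.dTot y v).1 =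
      mfderiv 𝓘(ℝ, B) 𝓘(ℝ, B) c.base (π.proj y) (mfderiv 𝓘(ℝ, B × F) 𝓘(ℝ, B) π.proj y v) := by
  have h1 := ((c.contMDiffAt_base (c.proj_mem _ h)).mdifferentiableAt (by simp)).hasMFDerivAt.comp
    y ((contMDiff_proj π y).mdifferentiableAt (by simp)).hasMFDerivAt
  have h2 := (hasFDerivAt_fst (𝕜 := ℝ) (p := c.tot y)).hasMFDerivAt.comp y
    ((c.contMDiffAt_tot h).mdifferentiableAt (by simp)).hasMFDerivAt
  have e : (fun p : B × F => p.1) ∘ c.tot =ᶠ[𝓝 y] c.base ∘ π.proj := by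
    filter_upwards [c.tot.open_source.mem_nhds h] with y' h'
    exact (c.base_proj y' h').symm
  exact congrArg (fun L => L v) (hasMFDerivAt_unique h2 (h1.congr_of_eventuallyEq e))

theorem dTot_field_fst (c : AdaptedChart π) {y : E} (h : y ∈ c.tot.source) (φ : VertField π) :
    (c.dTot y (φ.1 y)).1 = 0 := by
  rw [c.dTot_fst h, φ.2.2 y, map_zero]
  rfl

theorem dTot_field_eq_zero_iff (c : AdaptedChart π) {y : E} (h : y ∈ c.tot.source)
    (φ : VertField π) : (c.dTot y (φ.1 y)).2 = 0 ↔ φ.1 y = 0 := by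
  constructor
  · intro e
    apply c.dTot_injective h
    rw [map_zero]
    exact Prod.ext (c.dTot_field_fst h φ) e
  · intro e
    rw [e, map_zero]
    rfl

/-- The field is smooth as a section of the tangent bundle; composition with the tangent map of the
chart makes its components smooth functions. -/
theorem contMDiffOn_dTot_field (c : AdaptedChart π) (φ : VertField π) :
    ContMDiffOn 𝓘(ℝ, B × F) 𝓘(ℝ, B × F) ∞ (fun y => c.dTot y (φ.1 y)) c.tot.source := by
  have h1 := (contMDiffOn_of_mem_maximalAtlas c.tot_mem).contMDiffOn_tangentMapWithin (m := ∞)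
    le_rfl c.tot.open_source.uniqueMDiffOn
  have h2 := h1.comp φ.2.1.contMDiffOn (s := c.tot.source) (fun y hy => hy)
  have h3 := (contMDiff_snd_tangentBundle_modelSpace (B × F) 𝓘(ℝ, B × F) (n := ∞)).comp_contMDiffOn h2
  refine h3.congr fun y hy => ?_
  have h4 := mfderivWithin_of_isOpen (I := 𝓘(ℝ, B × F)) (I' := 𝓘(ℝ, B × F)) (f := c.tot)
    c.tot.open_source hy
  exact congrArg (fun L => L (φ.1 y)) h4.symm

/-- The components `φ^i` of a vertical field, as functions of the coordinates. -/
def fieldComp (c : AdaptedChart π) (φ : VertField π) (p : B × F) : F :=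
  (c.dTot (c.tot.symm p) (φ.1 (c.tot.symm p))).2

theorem contDiffAt_fieldComp (c : AdaptedChart π) (φ : VertField π) {p : B × F}
    (hp : p ∈ c.tot.target) : ContDiffAt ℝ ∞ (c.fieldComp φ) p := by
  have h0 := c.tot.map_target hp
  have h1 := (c.contMDiffOn_dTot_field φ).contMDiffAt (c.tot.open_source.mem_nhds h0)
  exact contDiff_snd.contDiffAt.comp p
    (h1.comp p (contMDiffAt_symm_of_mem_maximalAtlas c.tot_mem hp)).contDiffAt

theorem tot_section (c : AdaptedChart π) (s : LocalSection π) {x : M} (hx : x ∈ s.dom)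
    (h : s.toFun x ∈ c.tot.source) : c.tot (s.toFun x) = (c.base x, c.rep s (c.base x)) := by
  refine Prod.ext (c.fst_tot_sec s hx h) ?_
  simp only [rep, c.base.left_inv (c.base_mem_source s hx h)]

theorem eventually_symm_section (c : AdaptedChart π) (s : LocalSection π) {x : M}
    (hx : x ∈ s.dom) (h : s.toFun x ∈ c.tot.source) :
    ∀ᶠ z in 𝓝 (c.base x), z ∈ c.base.target ∧ c.base.symm z ∈ s.dom ∧
      s.toFun (c.base.symm z) ∈ c.tot.source := by
  have hb := c.base_mem_source s hx h
  refine (c.base.open_target.eventually_mem (c.base.map_source hb)).and ?_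
  refine (c.base.continuousAt_symm (c.base.map_source hb)).eventually
    (p := fun y => y ∈ s.dom ∧ s.toFun y ∈ c.tot.source) ?_
  rw [c.base.left_inv hb]
  exact c.eventually_section s hx h

theorem fieldRep_eventuallyEq (c : AdaptedChart π) (φ : VertField π) (s : LocalSection π) {x : M}
    (hx : x ∈ s.dom) (h : s.toFun x ∈ c.tot.source) :
    fieldRep c φ s =ᶠ[𝓝 (c.base x)] fun z => c.fieldComp φ (z, c.rep s z) := by
  filter_upwards [c.eventually_symm_section s hx h] with z hz
  have h1 := c.tot_section s hz.2.1 hz.2.2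
  rw [c.base.right_inv hz.1] at h1
  rw [fieldComp, ← h1, c.tot.left_inv hz.2.2]
  rfl

theorem contDiffAt_fieldRep (c : AdaptedChart π) (φ : VertField π) (s : LocalSection π) {x : M}
    (hx : x ∈ s.dom) (h : s.toFun x ∈ c.tot.source) :
    ContDiffAt ℝ ∞ (fieldRep c φ s) (c.base x) := by
  refine ContDiffAt.congr_of_eventuallyEq ?_ (c.fieldRep_eventuallyEq φ s hx h)
  refine ContDiffAt.comp (g := c.fieldComp φ) (f := fun z => (z, c.rep s z)) (c.base x) ?_
    (contDiffAt_id.prodMk (c.contDiffAt_rep s hx h))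
  refine c.contDiffAt_fieldComp φ ?_
  rw [← c.tot_section s hx h]
  exact c.tot.map_source h

theorem fieldRep_add (c : AdaptedChart π) (φ ψ : VertField π) (s : LocalSection π) :
    fieldRep c (φ + ψ) s = fieldRep c φ s + fieldRep c ψ s := by
  funext z
  have := (c.dTot (s.toFun (c.base.symm z))).map_add (φ.1 _) (ψ.1 _)
  exact congrArg Prod.snd this

theorem fieldRep_smul (c : AdaptedChart π) (a : ℝ) (φ : VertField π) (s : LocalSection π) :
    fieldRep c (a • φ) s = a • fieldRep c φ s := by
  funext z
  have := (c.dTot (s.toFun (c.base.symm z))).map_smul a (φ.1 _)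
  exact congrArg Prod.snd this

theorem fieldRep_mulField (c : AdaptedChart π) (a : C^∞⟮𝓘(ℝ, B × F), E; 𝓘(ℝ, ℝ), ℝ⟯)
    (φ : VertField π) (s : LocalSection π) (z : B) :
    fieldRep c (mulField a φ) s z = a (s.toFun (c.base.symm z)) • fieldRep c φ s z := by
  have := (c.dTot (s.toFun (c.base.symm z))).map_smul (a (s.toFun (c.base.symm z))) (φ.1 _)
  exact congrArg Prod.snd this

theorem fieldRep_eq_zero_iff (c : AdaptedChart π) (φ : VertField π) (s : LocalSection π) {z : B}
    (h : s.toFun (c.base.symm z) ∈ c.tot.source) :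
    fieldRep c φ s z = 0 ↔ φ.1 (s.toFun (c.base.symm z)) = 0 :=
  c.dTot_field_eq_zero_iff h φ

/-- The total derivatives `D_σ φ^i` as functions of the jet coordinates, collected in symmetric
multilinear maps. -/
def evoCoord (c : AdaptedChart π) (φ : VertField π) (p : JetModel B F r)
    (k : Fin (r + 1)) : SymMul B F k :=
  toSym k ((ftaylorSeries ℝ (c.fieldComp φ) (p.1, p.value)).taylorComp
    (pairSeries p.1 (jetSeries p)) k)

/-- By Faà di Bruno's formula the derivatives of φ^i ∘ s up to order r are expressions in the
derivatives of φ^i and the r-jet of s. The total derivatives are therefore functions on J^rπ,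
independent of the representative. -/
theorem iteratedFDeriv_fieldRep (c : AdaptedChart π) (φ : VertField π) (a : PointedSection π)
    (h : a.sec.toFun a.pt ∈ c.tot.source) {k : ℕ} (hk : k < r + 1) :
    iteratedFDeriv ℝ k (fieldRep c φ a.sec) (c.base a.pt) =
      (ftaylorSeries ℝ (c.fieldComp φ) ((c.coords r a).1, (c.coords r a).value)).taylorComp
        (pairSeries (c.coords r a).1 (jetSeries (c.coords r a))) k := by
  rw [((c.fieldRep_eventuallyEq φ a.sec a.mem h).iteratedFDeriv ℝ k).eq_of_nhds]
  have h0 := c.contDiffAt_rep a.sec a.mem h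
  have h1 : ContDiffAt ℝ ∞ (fun z => (z, c.rep a.sec z)) (c.base a.pt) :=
    contDiffAt_id.prodMk h0
  have h2 : ContDiffAt ℝ ∞ (c.fieldComp φ) (c.base a.pt, c.rep a.sec (c.base a.pt)) := by
    refine c.contDiffAt_fieldComp φ ?_
    rw [← c.tot_section a.sec a.mem h]
    exact c.tot.map_source h
  refine (iteratedFDeriv_comp (g := c.fieldComp φ) (f := fun z => (z, c.rep a.sec z)) h2 h1
    (by exact_mod_cast le_top)).trans ?_
  rw [c.coords_value r a h]
  refine taylorComp_congr (fun _ _ => rfl) fun j hj => ?_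
  have hj' : j < r + 1 := lt_of_le_of_lt hj hk
  simp only [ftaylorSeries, pairSeries, jetSeries, hj', dif_pos]
  refine (iteratedFDeriv_prodMk contDiffAt_id h0 (by exact_mod_cast le_top)).trans ?_
  congr 1
  exact (c.coe_coords r a h ⟨j, hj'⟩).symm

theorem coe_evoCoord (c : AdaptedChart π) (φ : VertField π) (a : PointedSection π)
    (h : a.sec.toFun a.pt ∈ c.tot.source) (k : Fin (r + 1)) :
    (c.evoCoord φ (c.coords r a) k).incl =
      iteratedFDeriv ℝ k (fieldRep c φ a.sec) (c.base a.pt) := by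
  rw [evoCoord, ← c.iteratedFDeriv_fieldRep φ a h k.2]
  exact coe_toSym (iteratedFDeriv_mem_symMul _ (c.contDiffAt_fieldRep φ a.sec a.mem h))

theorem contDiffAt_evoCoord (c : AdaptedChart π) (φ : VertField π) {p : JetModel B F r}
    (hp : (p.1, p.value) ∈ c.tot.target) :
    ContDiffAt ℝ ∞ (fun p : JetModel B F r => c.evoCoord φ p) p := by
  have hpair : ContDiff ℝ ∞ (fun p : JetModel B F r => (p.1, p.value)) :=
    contDiff_fst.prodMk (valueL B F r).contDiff
  refine contDiffAt_pi.2 fun k => contDiffAt_toSym ?_ ?_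
  · refine contDiffAt_taylorComp (fun j hj => ?_) (fun i hi => ?_)
    · exact ((c.contDiffAt_fieldComp φ hp).iteratedFDeriv_right (m := ∞)
        (by exact_mod_cast le_top)).comp p hpair.contDiffAt
    · have h1 : ContDiff ℝ ∞ (iteratedFDeriv ℝ i (fun w : B => w)) :=
        (contDiff_id (𝕜 := ℝ) (E := B) (n := ∞)).iteratedFDeriv_right (m := ∞)
          (by exact_mod_cast le_top)
      have hir : i < r + 1 := lt_of_le_of_lt hi k.2
      have h2 : ContDiff ℝ ∞ (fun p : JetModel B F r => jetSeries p i) := by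
        simp only [jetSeries, hir, dif_pos]
        exact contDiff_coord ⟨i, hir⟩
      have h3 : ContDiff ℝ ∞ (ContinuousMultilinearMap.prodL ℝ (fun _ : Fin i => B) B F) :=
        LinearIsometryEquiv.contDiff _
      have h4 : ContDiff ℝ ∞ (fun p : JetModel B F r =>
          iteratedFDeriv ℝ i (fun w : B => w) p.1) := h1.comp contDiff_fst
      exact (h3.comp (h4.prodMk h2)).contDiffAt
  -- The composed series is symmetric at nearby points because each of them is the jet of a
  -- polynomial section, where the series consists of actual derivatives.
  · filter_upwards [hpair.continuous.continuousAt.eventually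
      (c.tot.open_target.mem_nhds hp)] with p' h
    have h1 := c.polyPointed_mem p' h
    have h2 := c.iteratedFDeriv_fieldRep φ (c.polyPointed p' h) h1 k.2
    rw [coords_polyPointed] at h2
    rw [← h2]
    exact iteratedFDeriv_mem_symMul _ (c.contDiffAt_fieldRep φ _ (c.polyPointed p' h).mem h1)

theorem rep_polySection_eventuallyEq (c : AdaptedChart π) {p : JetModel B F r}
    (hp : (p.1, p.value) ∈ c.tot.target) : c.rep (c.polySection p) =ᶠ[𝓝 p.1] poly p := by
  have e1 : ∀ᶠ z in 𝓝 p.1, z ∈ c.base.target :=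
    c.base.open_target.mem_nhds (c.target_base hp)
  have e2 : ∀ᶠ z in 𝓝 p.1, (z, poly p z) ∈ c.tot.target := by
    refine (continuous_id.prodMk (contDiff_poly p).continuous).continuousAt.eventually ?_
    exact c.tot.open_target.mem_nhds (by simpa [poly_base] using hp)
  filter_upwards [e1, e2] with z h1 h2
  simp only [rep, polySection, c.base.right_inv h1, c.tot.right_inv h2]

/-- The dx-part of a vertical field is zero, so only the partial derivatives of the new fibre
coordinates with respect to the old ones act on its components. -/
theorem fieldComp_trans (c c' : AdaptedChart π) (φ : VertField π) {p : B × F}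
    (hp : p ∈ c.tot.target) (hp' : c.tot.symm p ∈ c'.tot.source) :
    (c'.dTot (c.tot.symm p) (φ.1 (c.tot.symm p))).2 =
      fderiv ℝ (fibTrans c c') p (0, c.fieldComp φ p) := by
  have h0 := c.tot.map_target hp
  have e : (fun y => (c'.tot y).2) =ᶠ[𝓝 (c.tot.symm p)] fibTrans c c' ∘ c.tot := by
    filter_upwards [c.tot.open_source.mem_nhds h0] with y hy
    simp only [fibTrans, Function.comp_apply, c.tot.left_inv hy]
  have h1 := (hasFDerivAt_snd (𝕜 := ℝ) (p := c'.tot (c.tot.symm p))).hasMFDerivAt.comp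
    (c.tot.symm p) ((c'.contMDiffAt_tot hp').mdifferentiableAt (by simp)).hasMFDerivAt
  have h2 : HasFDerivAt (fibTrans c c') (fderiv ℝ (fibTrans c c') p) (c.tot (c.tot.symm p)) := by
    rw [c.tot.right_inv hp]
    exact ((contDiffAt_fibTrans c c' hp hp').differentiableAt (by simp)).hasFDerivAt
  have h3 := h2.hasMFDerivAt.comp (c.tot.symm p)
    ((c.contMDiffAt_tot h0).mdifferentiableAt (by simp)).hasMFDerivAt
  have h4 := congrArg (fun L => L (φ.1 (c.tot.symm p)))
    (hasMFDerivAt_unique h1 (h3.congr_of_eventuallyEq e))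
  refine Eq.trans h4 (congrArg (fderiv ℝ (fibTrans c c') p) ?_)
  exact Prod.ext (c.dTot_field_fst h0 φ) rfl

end AdaptedChart

end Fields
end FiniteJet

namespace FiniteJet

/-! ### Evolutionary fields in arbitrary adapted charts -/

section Poly

variable {B F : Type*} [NormedAddCommGroup B] [NormedSpace ℝ B]
  [NormedAddCommGroup F] [NormedSpace ℝ F] {r : ℕ}

theorem poly_add (z₀ : B) (u w : (k : Fin (r + 1)) → SymMul B F k) (z : B) :
    poly (z₀, u + w) z = poly (z₀, u) z + poly (z₀, w) z := by
  simp only [poly, ← Finset.sum_add_distrib]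
  refine Finset.sum_congr rfl fun k _ => ?_
  simp only [polySeries]
  split
  · rw [← _root_.add_apply, ← smul_add]
    rfl
  · simp

theorem poly_smul (z₀ : B) (t : ℝ) (w : (k : Fin (r + 1)) → SymMul B F k) (z : B) :
    poly (z₀, t • w) z = t • poly (z₀, w) z := by
  simp only [poly, Finset.smul_sum]
  refine Finset.sum_congr rfl fun k _ => ?_
  simp only [polySeries]
  split
  · rw [← _root_.smul_apply, smul_comm]
    rfl
  · simp

end Poly

section Evo

variable {B F M E : Type*}
  [NormedAddCommGroup B] [NormedSpace ℝ B] [NormedAddCommGroup F] [NormedSpace ℝ F]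
  [TopologicalSpace M] [ChartedSpace B M] [TopologicalSpace E] [ChartedSpace (B × F) E]
  [FiniteDimensional ℝ B] [FiniteDimensional ℝ F] [IsManifold 𝓘(ℝ, B × F) ∞ E]
  {π : FibredManifold B F M E} {r : ℕ}

namespace AdaptedChart

/-- The change of coordinates of a section which is polynomial in the first chart. -/
theorem transMap_incl (c c' : AdaptedChart π) {p : JetModel B F r}
    (hp : (p.1, p.value) ∈ c.tot.target) (hp' : c.tot.symm (p.1, p.value) ∈ c'.tot.source)
    (k : Fin (r + 1)) :
    ((transMap c c' r p).2 k).incl = iteratedFDeriv ℝ k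
      (fun z' => fibTrans c c' (baseTrans c' c z', poly p (baseTrans c' c z')))
      (baseTrans c c' p.1) := by
  have h := c.polyPointed_mem p hp
  have h' : (c.polyPointed p hp).sec.toFun (c.polyPointed p hp).pt ∈ c'.tot.source := by
    rw [polyPointed_val]; exact hp'
  have e1 := coords_trans c c' r _ h h'
  rw [coords_polyPointed] at e1
  have hb : c.base (c.polyPointed p hp).pt = p.1 := c.base.right_inv (c.target_base hp)
  rw [← e1, c'.coe_coords r _ h' k]
  have e2 := rep_eventuallyEq c c' (c.polyPointed p hp).sec (c.polyPointed p hp).mem h h'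
  have e3 : c'.base (c.polyPointed p hp).pt = baseTrans c c' p.1 := rfl
  have hb' := c'.base_mem_source _ (c.polyPointed p hp).mem h'
  have e4 : baseTrans c' c (baseTrans c c' p.1) = p.1 := by
    rw [← e3, baseTrans, c'.base.left_inv hb', hb]
  have hcont : ContinuousAt (baseTrans c' c) (baseTrans c c' p.1) := by
    rw [← e3]
    refine (contDiffAt_baseTrans c' c (c'.base.map_source hb') ?_).continuousAt
    rw [c'.base.left_inv hb']
    exact c.base_mem_source _ (c.polyPointed p hp).mem h
  have e5 : ∀ᶠ z' in 𝓝 (baseTrans c c' p.1),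
      c.rep (c.polySection p) (baseTrans c' c z') = poly p (baseTrans c' c z') := by
    refine hcont.eventually (p := fun z => c.rep (c.polySection p) z = poly p z) ?_
    rw [e4]
    exact c.rep_polySection_eventuallyEq hp
  rw [e3] at e2 ⊢
  refine Filter.EventuallyEq.eq_of_nhds (Filter.EventuallyEq.iteratedFDeriv ℝ ?_ k)
  filter_upwards [e2, e5] with z' h1 h2
  rw [h1]
  simp only [Function.comp_apply]
  rw [← h2]
  rfl

theorem fieldRep_trans_eventuallyEq (c c' : AdaptedChart π) (φ : VertField π)
    (s : LocalSection π) {x : M} (hx : x ∈ s.dom) (h : s.toFun x ∈ c.tot.source)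
    (h' : s.toFun x ∈ c'.tot.source) :
    fieldRep c' φ s =ᶠ[𝓝 (c'.base x)] fun z' =>
      fderiv ℝ (fibTrans c c') (baseTrans c' c z', c.rep s (baseTrans c' c z'))
        (0, fieldRep c φ s (baseTrans c' c z')) := by
  have hb' := c'.base_mem_source s hx h'
  have ev : ∀ᶠ z' in 𝓝 (c'.base x), c'.base.symm z' ∈ s.dom ∧
      s.toFun (c'.base.symm z') ∈ c.tot.source := by
    refine (c'.base.continuousAt_symm (c'.base.map_source hb')).eventually
      (p := fun y => y ∈ s.dom ∧ s.toFun y ∈ c.tot.source) ?_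
    rw [c'.base.left_inv hb']
    exact c.eventually_section s hx h
  filter_upwards [ev, c'.eventually_symm_section s hx h'] with z' h1 h2
  have e1 := c.tot_section s h1.1 h1.2
  have e2 : c.base.symm (baseTrans c' c z') = c'.base.symm z' :=
    c.base.left_inv (c.base_mem_source s h1.1 h1.2)
  have e3 := c.fieldComp_trans c' φ (p := c.tot (s.toFun (c'.base.symm z')))
    (c.tot.map_source h1.2) (by rw [c.tot.left_inv h1.2]; exact h2.2.2)
  rw [fieldComp, c.tot.left_inv h1.2, e1] at e3
  refine Eq.trans e3 ?_
  have e4 : fieldRep c φ s (baseTrans c' c z') = (c.dTot (s.toFun (c'.base.symm z'))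
      (φ.1 (s.toFun (c'.base.symm z')))).2 := by
    rw [← e2]; rfl
  rw [e4]
  rfl

/-- Evolutionary fields do not depend on the chart. Deform the polynomial section through p by t
times the polynomial with derivatives w. The velocity of its jet in the second chart is obtained by
exchanging d/dt with the derivatives in z, which leaves the derivatives of ∂u'/∂u applied to that
polynomial. The polynomial has the same r-jet as the components of φ along the section, so the
result is the jet of the components of φ in the second chart. -/
theorem fderiv_transMap_evoCoord (c c' : AdaptedChart π) (φ : VertField π) {p : JetModel B F r}
    (hp : (p.1, p.value) ∈ c.tot.target) (hp' : c.tot.symm (p.1, p.value) ∈ c'.tot.source) :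
    fderiv ℝ (transMap c c' r) p (0, c.evoCoord φ p) =
      (0, c'.evoCoord φ (transMap c c' r p)) := by
  have h := c.polyPointed_mem p hp
  have h' : (c.polyPointed p hp).sec.toFun (c.polyPointed p hp).pt ∈ c'.tot.source := by
    rw [polyPointed_val]; exact hp'
  set a := c.polyPointed p hp with ha
  set w := c.evoCoord φ p with hw
  have hb : c.base a.pt = p.1 := c.base.right_inv (c.target_base hp)
  have e3 : c'.base a.pt = baseTrans c c' p.1 := rfl
  have hbs := c.base_mem_source _ a.mem h
  have hb' := c'.base_mem_source _ a.mem h'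
  have e4 : baseTrans c' c (baseTrans c c' p.1) = p.1 := by
    rw [← e3, baseTrans, c'.base.left_inv hb', hb]
  have hbt : ContDiffAt ℝ ∞ (baseTrans c' c) (baseTrans c c' p.1) := by
    rw [← e3]
    refine contDiffAt_baseTrans c' c (c'.base.map_source hb') ?_
    rwa [c'.base.left_inv hb']
  have hline : HasDerivAt (fun t : ℝ => p + t • ((0, w) : JetModel B F r)) (0, w) 0 := by
    simpa using ((hasDerivAt_id (0 : ℝ)).smul_const ((0, w) : JetModel B F r)).const_add p
  have hdiff : HasFDerivAt (transMap c c' r) (fderiv ℝ (transMap c c' r) p)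
      (p + (0 : ℝ) • ((0, w) : JetModel B F r)) := by
    rw [zero_smul, add_zero]
    exact ((contDiffAt_transMap c c' hp hp').differentiableAt (by simp)).hasFDerivAt
  have hder := hdiff.comp_hasDerivAt (0 : ℝ) hline
  have hnear : ∀ᶠ t : ℝ in 𝓝 0,
      ((p + t • ((0, w) : JetModel B F r)).1, (p + t • ((0, w) : JetModel B F r)).value)
        ∈ c.tot.target ∧ c.tot.symm ((p + t • ((0, w) : JetModel B F r)).1,
        (p + t • ((0, w) : JetModel B F r)).value) ∈ c'.tot.source := by
    have hpair : Continuous (fun q : JetModel B F r => (q.1, q.value)) :=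
      (contDiff_fst.prodMk (valueL B F r).contDiff).continuous (n := ∞)
    have hc : ContinuousAt (fun t : ℝ => ((p + t • ((0, w) : JetModel B F r)).1,
        (p + t • ((0, w) : JetModel B F r)).value)) 0 :=
      hpair.continuousAt.comp hline.continuousAt
    refine hc.eventually (p := fun q => q ∈ c.tot.target ∧ c.tot.symm q ∈ c'.tot.source) ?_
    have ho := (c.tot.symm ≫ₕ c'.tot).open_source
    rw [OpenPartialHomeomorph.trans_source] at ho
    simp only [zero_smul, add_zero]
    exact ho.eventually_mem ⟨hp, hp'⟩
  -- The deformation leaves the base point fixed, and the base component of the transformation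
  -- depends on that point only.
  have hfst : (fderiv ℝ (transMap c c' r) p (0, w)).1 = 0 := by
    have h1 := (ContinuousLinearMap.fst ℝ B ((k : Fin (r + 1)) → SymMul B F k)).hasFDerivAt.comp_hasDerivAt
      (0 : ℝ) hder
    have h2 : HasDerivAt (fun t : ℝ => (transMap c c' r (p + t • ((0, w) : JetModel B F r))).1) 0 0 := by
      refine (hasDerivAt_const (0 : ℝ) (baseTrans c c' p.1)).congr_of_eventuallyEq ?_
      refine Eventually.of_forall fun t => ?_
      change baseTrans c c' (p.1 + t • (0 : B)) = _
      rw [smul_zero, add_zero]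
    exact h1.unique h2
  refine Prod.ext hfst (funext fun k => ?_)
  have hinj : Function.Injective (SymMul.inclL (B := B) (F := F) k) := Subtype.val_injective
  apply hinj
  ext v
  -- the left-hand side as a derivative of a family of iterated derivatives
  let ev : JetModel B F r →L[ℝ] F := ContinuousMultilinearMap.apply ℝ (fun _ : Fin k => B) F v ∘L
    (SymMul.inclL k ∘L (ContinuousLinearMap.proj k ∘L ContinuousLinearMap.snd ℝ B _))
  have h1 := ev.hasFDerivAt.comp_hasDerivAt (0 : ℝ) hder
  -- The deformed section written in the second chart, jointly in the parameter and the new base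
  -- coordinates.
  let H : ℝ × B → F := fun q => fibTrans c c'
    (baseTrans c' c q.2, poly p (baseTrans c' c q.2) + q.1 • poly (p.1, w) (baseTrans c' c q.2))
  have hval : (baseTrans c' c (baseTrans c c' p.1), poly p (baseTrans c' c (baseTrans c c' p.1)) +
      (0 : ℝ) • poly (p.1, w) (baseTrans c' c (baseTrans c c' p.1))) = (p.1, p.value) := by
    rw [e4, zero_smul, add_zero, poly_base]
  have hfib : ContDiffAt ℝ ∞ (fibTrans c c') (p.1, p.value) := contDiffAt_fibTrans c c' hp hp'
  have hinner : ContDiffAt ℝ ∞ (fun q : ℝ × B => (baseTrans c' c q.2,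
      poly p (baseTrans c' c q.2) + q.1 • poly (p.1, w) (baseTrans c' c q.2)))
      (0, baseTrans c c' p.1) := by
    have h2 : ContDiffAt ℝ ∞ (fun q : ℝ × B => baseTrans c' c q.2) (0, baseTrans c c' p.1) :=
      ContDiffAt.comp (g := baseTrans c' c) _ hbt contDiffAt_snd
    exact h2.prodMk (((contDiff_poly p).contDiffAt.comp _ h2).add
      (contDiffAt_fst.smul ((contDiff_poly _).contDiffAt.comp _ h2)))
  have hH : ContDiffAt ℝ ∞ H (0, baseTrans c c' p.1) := by
    refine ContDiffAt.comp (g := fibTrans c c') _ ?_ hinner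
    rw [hval]
    exact hfib
  have hpoly : ∀ (t : ℝ) (z : B), poly (p + t • ((0, w) : JetModel B F r)) z =
      poly p z + t • poly (p.1, w) z := by
    intro t z
    have : p + t • ((0, w) : JetModel B F r) = (p.1, p.2 + t • w) :=
      Prod.ext (by simp) rfl
    rw [this, poly_add, poly_smul]
  have h2 : HasDerivAt (fun t : ℝ => ev (transMap c c' r (p + t • ((0, w) : JetModel B F r))))
      (iteratedFDeriv ℝ k (fun y => fderiv ℝ H (0, y) (1, 0)) (baseTrans c c' p.1) v) 0 := by
    refine (hasDerivAt_iteratedFDeriv_slice hH k v).congr_of_eventuallyEq ?_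
    filter_upwards [hnear] with t ht
    have h3 := c.transMap_incl c' ht.1 ht.2 k
    have h4 : (p + t • ((0, w) : JetModel B F r)).1 = p.1 := by simp
    rw [h4] at h3
    simp only [hpoly] at h3
    exact congrArg (fun L => L v) h3
  refine Eq.trans (h1.unique h2) ?_
  -- the right-hand side
  have e1 := coords_trans c c' r a h h'
  have hac : c.coords r a = p := c.coords_polyPointed p hp
  rw [hac] at e1
  have h5 := c'.coe_evoCoord φ a h' k
  rw [e1] at h5
  refine Eq.trans ?_ (congrArg (fun L => L v) h5.symm)
  rw [e3]
  refine congrArg (fun L : B [×k]→L[ℝ] F => L v) ?_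
  have hz0 : (p.1, poly p p.1) = (p.1, p.value) := by rw [poly_base]
  -- `G₁` is the velocity of the deformation and `G₂` is φ along the section, both in the second
  -- fibre coordinates but over the old base coordinates. They are composites of one smooth map with
  -- two maps having the same k-jet at p.1.
  let G₁ : B → F := fun z => fderiv ℝ (fibTrans c c') (z, poly p z) (0, poly (p.1, w) z)
  let G₂ : B → F := fun z => fderiv ℝ (fibTrans c c') (z, c.rep a.sec z) (0, fieldRep c φ a.sec z)
  have hG₁ : (fun y => fderiv ℝ H (0, y) (1, 0)) =ᶠ[𝓝 (baseTrans c c' p.1)]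
      fun y => G₁ (baseTrans c' c y) := by
    have hH1 : ∀ᶠ y in 𝓝 (baseTrans c c' p.1), ContDiffAt ℝ 1 H (0, y) :=
      (Continuous.prodMk_right (0 : ℝ)).continuousAt.eventually
        ((hH.of_le (by exact_mod_cast le_top)).eventually (by simp))
    have hF1 : ∀ᶠ y in 𝓝 (baseTrans c c' p.1), ContDiffAt ℝ 1 (fibTrans c c')
        (baseTrans c' c y, poly p (baseTrans c' c y)) := by
      have hc : ContinuousAt (fun y => (baseTrans c' c y, poly p (baseTrans c' c y)))
          (baseTrans c c' p.1) :=
        hbt.continuousAt.prodMk ((contDiff_poly p).continuous.continuousAt.comp hbt.continuousAt)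
      refine hc.eventually (p := fun q => ContDiffAt ℝ 1 (fibTrans c c') q) ?_
      simp only [e4, poly_base]
      exact (hfib.of_le (by exact_mod_cast le_top)).eventually (by simp)
    filter_upwards [hH1, hF1] with y h6 h7
    have h8 := (h6.differentiableAt one_ne_zero).hasFDerivAt.comp_hasDerivAt (0 : ℝ)
      (hasFDerivAt_prodMk_left (0 : ℝ) y).hasDerivAt
    have h9 : HasDerivAt (fun t : ℝ => (baseTrans c' c y,
        poly p (baseTrans c' c y) + t • poly (p.1, w) (baseTrans c' c y)))
        (0, poly (p.1, w) (baseTrans c' c y)) 0 := by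
      refine (hasDerivAt_const _ _).prodMk ?_
      simpa using ((hasDerivAt_id (0 : ℝ)).smul_const
        (poly (p.1, w) (baseTrans c' c y))).const_add (poly p (baseTrans c' c y))
    have h10 : HasFDerivAt (fibTrans c c') (fderiv ℝ (fibTrans c c')
        (baseTrans c' c y, poly p (baseTrans c' c y))) (baseTrans c' c y,
        poly p (baseTrans c' c y) + (0 : ℝ) • poly (p.1, w) (baseTrans c' c y)) := by
      rw [zero_smul, add_zero]
      exact (h7.differentiableAt one_ne_zero).hasFDerivAt
    exact h8.unique (h10.comp_hasDerivAt (0 : ℝ) h9)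
  have hG₂ := c.fieldRep_trans_eventuallyEq c' φ a.sec a.mem h h'
  rw [e3] at hG₂
  rw [(hG₁.iteratedFDeriv ℝ k).eq_of_nhds, (hG₂.iteratedFDeriv ℝ k).eq_of_nhds]
  have hrep : c.rep a.sec =ᶠ[𝓝 p.1] poly p := c.rep_polySection_eventuallyEq hp
  have hK : ContDiffAt ℝ ∞ (fun q : B × F × F => fderiv ℝ (fibTrans c c') (q.1, q.2.1) (0, q.2.2))
      (p.1, poly p p.1, poly (p.1, w) p.1) := by
    have h6 : ContDiffAt ℝ ∞ (fderiv ℝ (fibTrans c c')) (p.1, poly p p.1) := by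
      rw [hz0]; exact hfib.fderiv_right (m := ∞) le_rfl
    exact (ContDiffAt.comp (g := fderiv ℝ (fibTrans c c')) (p.1, poly p p.1, poly (p.1, w) p.1) h6
      (contDiffAt_fst.prodMk (contDiffAt_fst.comp _ contDiffAt_snd))).clm_apply
        (contDiffAt_const.prodMk (contDiffAt_snd.comp _ contDiffAt_snd))
  have hf0 : ContDiffAt ℝ ∞ (fieldRep c φ a.sec) p.1 := by
    rw [← hb]; exact c.contDiffAt_fieldRep φ a.sec a.mem h
  have hr0 : ContDiffAt ℝ ∞ (c.rep a.sec) p.1 := by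
    rw [← hb]; exact c.contDiffAt_rep a.sec a.mem h
  have hp0 : ContDiffAt ℝ ∞ (poly p) p.1 := (contDiff_poly p).contDiffAt
  have hw0 : ContDiffAt ℝ ∞ (poly (p.1, w)) p.1 := (contDiff_poly _).contDiffAt
  -- This is the choice of w: the prescribed derivatives of the polynomial are the total derivatives
  -- of φ at p.
  have hjet : ∀ j ≤ (k : ℕ), iteratedFDeriv ℝ j (poly (p.1, w)) p.1 =
      iteratedFDeriv ℝ j (fieldRep c φ a.sec) p.1 := by
    intro j hj
    have hj' : j < r + 1 := lt_of_le_of_lt hj k.2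
    have h6 := c.coe_evoCoord φ a h ⟨j, hj'⟩
    rw [hac, hb] at h6
    exact (iteratedFDeriv_poly (p.1, w) ⟨j, hj'⟩).trans h6
  have hjet' : ∀ j ≤ (k : ℕ), iteratedFDeriv ℝ j (fun z => (z, poly p z, poly (p.1, w) z)) p.1 =
      iteratedFDeriv ℝ j (fun z => (z, c.rep a.sec z, fieldRep c φ a.sec z)) p.1 := by
    intro j hj
    have hle : ((j : ℕ) : WithTop ℕ∞) ≤ ∞ := by exact_mod_cast le_top
    refine (iteratedFDeriv_prodMk contDiffAt_id (hp0.prodMk hw0) hle).trans (Eq.trans ?_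
      (iteratedFDeriv_prodMk contDiffAt_id (hr0.prodMk hf0) hle).symm)
    rw [iteratedFDeriv_prodMk hp0 hw0 hle, iteratedFDeriv_prodMk hr0 hf0 hle, hjet j hj,
      (hrep.iteratedFDeriv ℝ j).eq_of_nhds]
  have hzero : (p.1, poly p p.1, poly (p.1, w) p.1) =
      (p.1, c.rep a.sec p.1, fieldRep c φ a.sec p.1) := by
    have h6 := congrArg (fun L => L (fun _ => 0)) (hjet 0 (Nat.zero_le _))
    simp only [iteratedFDeriv_zero_apply] at h6
    rw [h6, hrep.eq_of_nhds]
  have hGjet : ∀ j ≤ (k : ℕ), iteratedFDeriv ℝ j G₁ p.1 = iteratedFDeriv ℝ j G₂ p.1 := fun j hj =>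
    iteratedFDeriv_comp_congr
      (G := fun q : B × F × F => fderiv ℝ (fibTrans c c') (q.1, q.2.1) (0, q.2.2))
      (G' := fun q : B × F × F => fderiv ℝ (fibTrans c c') (q.1, q.2.1) (0, q.2.2))
      (g := fun z => (z, poly p z, poly (p.1, w) z))
      (g' := fun z => (z, c.rep a.sec z, fieldRep c φ a.sec z)) hzero hK hK
      (contDiffAt_id.prodMk (hp0.prodMk hw0)) (contDiffAt_id.prodMk (hr0.prodMk hf0))
      (fun i hi => hjet' i (hi.trans hj)) (fun _ _ => rfl)
  refine iteratedFDeriv_comp_congr (G := G₁) (G' := G₂) rfl ?_ ?_ hbt hbt (fun _ _ => rfl) ?_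
  · rw [e4]
    exact ContDiffAt.comp (f := fun z => (z, poly p z, poly (p.1, w) z)) p.1 hK
      (contDiffAt_id.prodMk (hp0.prodMk hw0))
  · rw [e4]
    rw [hzero] at hK
    exact ContDiffAt.comp (f := fun z => (z, c.rep a.sec z, fieldRep c φ a.sec z)) p.1 hK
      (contDiffAt_id.prodMk (hr0.prodMk hf0))
  · rw [e4]
    exact hGjet

end AdaptedChart

theorem evo_eq (φ : VertField π) (η : Jet π r) : Evo φ η = coordVec η η
    (0, (adaptedChartAt π η.toE).evoCoord φ ((adaptedChartAt π η.toE).jetCoord r η)) := by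
  have h := mem_adaptedChartAt π η.toE
  unfold Evo
  congr 2
  funext k
  exact congrArg (toSym k) ((adaptedChartAt π η.toE).iteratedFDeriv_fieldRep φ η.rep h k.2)

/-- `Evo` is defined through one chosen chart and one chosen representative; this frees it from both
choices. -/
theorem dCoord_evo (c : AdaptedChart π) (φ : VertField π) {η : Jet π r}
    (h : η.toE ∈ c.tot.source) : c.dCoord η (Evo φ η) = (0, c.evoCoord φ (c.jetCoord r η)) := by
  have h0 := mem_adaptedChartAt π η.toE
  rw [evo_eq, dCoord_coordVec' h0 c h, AdaptedChart.jetCoord_trans _ c h0 h]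
  apply AdaptedChart.fderiv_transMap_evoCoord
  · rw [AdaptedChart.jetCoord_point _ h0]; exact OpenPartialHomeomorph.map_source _ h0
  · rw [AdaptedChart.jetCoord_point _ h0, OpenPartialHomeomorph.left_inv _ h0]; exact h

theorem evo_eq_coordVec (φ : VertField π) {η₀ η : Jet π r}
    (h : η.toE ∈ (adaptedChartAt π η₀.toE).tot.source) : Evo φ η = coordVec η₀ η
    (0, (adaptedChartAt π η₀.toE).evoCoord φ ((adaptedChartAt π η₀.toE).jetCoord r η)) :=
  eq_coordVec h (dCoord_evo _ φ h)

end Evo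
end FiniteJet

namespace FiniteJet

/-! ### Cut-off functions and vertical fields with prescribed components -/

theorem exists_smooth_cutoff {H₀ H X : Type*} [NormedAddCommGroup H₀] [NormedSpace ℝ H₀]
    [FiniteDimensional ℝ H₀] [TopologicalSpace H] (I : ModelWithCorners ℝ H₀ H)
    [TopologicalSpace X] [ChartedSpace H X] [T2Space X] [IsManifold I ∞ X] {U : Set X} {x : X}
    (hU : U ∈ 𝓝 x) : ∃ χ : X → ℝ, ContMDiff I 𝓘(ℝ, ℝ) ∞ χ ∧ tsupport χ ⊆ U ∧ χ =ᶠ[𝓝 x] 1 := by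
  obtain ⟨f, -, hf⟩ := (SmoothBumpFunction.nhds_basis_tsupport (I := I) x).mem_iff.1 hU
  exact ⟨f, f.contMDiff, hf, f.eventuallyEq_one⟩

/-- A smooth germ extends to the whole space after multiplication by a cut-off function; Hadamard's
lemma is then available in its global form. -/
theorem exists_contDiff_eventuallyEq {B F : Type*} [NormedAddCommGroup B] [NormedSpace ℝ B]
    [FiniteDimensional ℝ B] [NormedAddCommGroup F] [NormedSpace ℝ F] {f : B → F} {z : B}
    (hf : ∃ U ∈ 𝓝 z, ContDiffOn ℝ ∞ f U) : ∃ g : B → F, ContDiff ℝ ∞ g ∧ g =ᶠ[𝓝 z] f := by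
  obtain ⟨U, hU, hf⟩ := hf
  obtain ⟨χ, h1, h2, h3⟩ := exists_smooth_cutoff 𝓘(ℝ, B) (interior_mem_nhds.2 hU)
  refine ⟨fun y => χ y • f y, ?_, ?_⟩
  · rw [contDiff_iff_contDiffAt]
    intro y
    by_cases hy : y ∈ tsupport χ
    · exact h1.contDiff.contDiffAt.smul (hf.contDiffAt (mem_interior_iff_mem_nhds.1 (h2 hy)))
    · refine (contDiffAt_const (c := (0 : F))).congr_of_eventuallyEq ?_
      filter_upwards [notMem_tsupport_iff_eventuallyEq.1 hy] with y' h'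
      rw [h']
      simp
  · filter_upwards [h3] with y hy
    rw [hy]
    simp

section Fields

variable {B F M E : Type*}
  [NormedAddCommGroup B] [NormedSpace ℝ B] [NormedAddCommGroup F] [NormedSpace ℝ F]
  [TopologicalSpace M] [ChartedSpace B M] [TopologicalSpace E] [ChartedSpace (B × F) E]
  [FiniteDimensional ℝ B] [FiniteDimensional ℝ F] [IsManifold 𝓘(ℝ, B × F) ∞ E]
  {π : FibredManifold B F M E} {r : ℕ}

namespace AdaptedChart

theorem exists_contDiffOn_fieldRep (c : AdaptedChart π) (φ : VertField π) (s : LocalSection π)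
    {x : M} (hx : x ∈ s.dom) (h : s.toFun x ∈ c.tot.source) :
    ∃ U ∈ 𝓝 (c.base x), ContDiffOn ℝ ∞ (fieldRep c φ s) U := by
  refine ⟨_, c.eventually_symm_section s hx h, fun z hz => ?_⟩
  have h1 := c.contDiffAt_fieldRep φ s hz.2.1 hz.2.2
  rw [c.base.right_inv hz.1] at h1
  exact h1.contDiffWithinAt

/-- The smooth function on `E` which is `χ · (g ∘ c)`, for a cut-off function `χ` supported in the
domain of the chart `c`. -/
theorem contMDiff_cutoff_smul (c : AdaptedChart π) {χ : E → ℝ}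
    (hχ : ContMDiff 𝓘(ℝ, B × F) 𝓘(ℝ, ℝ) ∞ χ) (hs : tsupport χ ⊆ c.tot.source) {g : B × F → ℝ}
    (hg : ContDiff ℝ ∞ g) :
    ContMDiff 𝓘(ℝ, B × F) 𝓘(ℝ, ℝ) ∞ (fun y => χ y • g (c.tot y)) := by
  refine contMDiff_of_tsupport fun y hy => ?_
  have h1 : y ∈ c.tot.source := hs (tsupport_smul_subset_left χ _ hy)
  exact (hχ y).smul (hg.contMDiff.contMDiffAt.comp y (c.contMDiffAt_tot h1))

/-- The differential of the inverse of the chart of the total space. -/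
def invTot (c : AdaptedChart π) (y : E) : (B × F) →L[ℝ] TangentSpace 𝓘(ℝ, B × F) y :=
  mfderiv 𝓘(ℝ, B × F) 𝓘(ℝ, B × F) c.tot.symm (c.tot y)

theorem dTot_invTot (c : AdaptedChart π) {y : E} (hy : y ∈ c.tot.source) (v : B × F) :
    c.dTot y (c.invTot y v) = v := by
  have h1 := c.tot_mdifferentiable.comp_symm_deriv (c.tot.map_source hy)
  rw [c.tot.left_inv hy] at h1
  exact congrArg (fun L => L v) h1

theorem contMDiffOn_invTot (c : AdaptedChart π) {g : B × F → B × F} (hg : ContDiff ℝ ∞ g) :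
    ContMDiffOn 𝓘(ℝ, B × F) (𝓘(ℝ, B × F).prod 𝓘(ℝ, B × F)) ∞
      (fun y => (⟨y, c.invTot y (g (c.tot y))⟩ : TangentBundle 𝓘(ℝ, B × F) E)) c.tot.source := by
  have h1 := (contMDiffOn_symm_of_mem_maximalAtlas c.tot_mem).contMDiffOn_tangentMapWithin (m := ∞)
    le_rfl c.tot.open_target.uniqueMDiffOn
  have h2 : ContMDiffOn 𝓘(ℝ, B × F) (𝓘(ℝ, B × F).prod 𝓘(ℝ, B × F)) ∞
      (fun y => (⟨c.tot y, g (c.tot y)⟩ : TangentBundle 𝓘(ℝ, B × F) (B × F))) c.tot.source := by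
    intro y hy
    have h3 := c.contMDiffAt_tot hy
    refine ContMDiffAt.contMDiffWithinAt (Bundle.contMDiffAt_totalSpace.2 ⟨h3, ?_⟩)
    have h4 := hg.contMDiff.contMDiffAt.comp y h3
    convert! h4 using 2 with y'
    simp
  refine (h1.comp h2 (fun y hy => c.tot.map_source hy)).congr fun y hy => ?_
  have h5 : ∀ (y y' : E) (v v' : B × F) (_ : y = y') (_ : v = v'),
      (⟨y, v⟩ : TangentBundle 𝓘(ℝ, B × F) E) = ⟨y', v'⟩ := by rintro _ _ _ _ rfl rfl; rfl
  refine h5 _ _ _ _ (c.tot.left_inv hy).symm ?_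
  have h4 := mfderivWithin_of_isOpen (I := 𝓘(ℝ, B × F)) (I' := 𝓘(ℝ, B × F)) (f := c.tot.symm)
    c.tot.open_target (c.tot.map_source hy)
  exact congrArg (fun L => L (g (c.tot y))) h4.symm

/-- The vertical field `χ g^i ∂/∂u^i`, for functions `g^i` of the base coordinates. -/
def mkField (c : AdaptedChart π) {χ : E → ℝ} (hχ : ContMDiff 𝓘(ℝ, B × F) 𝓘(ℝ, ℝ) ∞ χ)
    (hs : tsupport χ ⊆ c.tot.source) (g : B → F) (hg : ContDiff ℝ ∞ g) : VertField π where
  val y := χ y • c.invTot y (0, g (c.tot y).1)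
  property := by
    constructor
    · intro y
      by_cases hy : y ∈ tsupport χ
      · have h1 := c.contMDiffOn_invTot (g := fun q => (0, g q.1))
          (contDiff_const.prodMk (hg.comp contDiff_fst))
        exact (hχ y).smul_section (h1.contMDiffAt (c.tot.open_source.mem_nhds (hs hy)))
      · refine (Bundle.contMDiff_zeroSection ℝ
          (TangentSpace 𝓘(ℝ, B × F) : E → Type _) y).congr_of_eventuallyEq ?_
        filter_upwards [notMem_tsupport_iff_eventuallyEq.1 hy] with y' h'
        rw [h']
        simp [Bundle.zeroSection]
    · intro y
      by_cases hy : y ∈ c.tot.source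
      · have h1 := c.dTot_fst hy (χ y • c.invTot y (0, g (c.tot y).1))
        rw [map_smul, c.dTot_invTot hy] at h1
        -- Verticality may be tested after applying the differential of the base chart, where it
        -- says that the first component is zero.
        have h2 : Function.Injective (mfderiv 𝓘(ℝ, B) 𝓘(ℝ, B) c.base (π.proj y)) := by
          have hm : c.base.MDifferentiable 𝓘(ℝ, B) 𝓘(ℝ, B) :=
            ⟨(contMDiffOn_of_mem_maximalAtlas c.base_mem).mdifferentiableOn (by simp),
              (contMDiffOn_symm_of_mem_maximalAtlas c.base_mem).mdifferentiableOn (by simp)⟩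
          exact hm.mfderiv_injective (c.proj_mem _ hy)
        apply h2
        rw [map_zero]
        refine h1.symm.trans ?_
        simp
        rfl
      · dsimp only
        rw [image_eq_zero_of_notMem_tsupport fun h => hy (hs h), zero_smul, map_zero]

theorem dTot_mkField (c : AdaptedChart π) {χ : E → ℝ} (hχ : ContMDiff 𝓘(ℝ, B × F) 𝓘(ℝ, ℝ) ∞ χ)
    (hs : tsupport χ ⊆ c.tot.source) (g : B → F) (hg : ContDiff ℝ ∞ g) {y : E}
    (hy : y ∈ c.tot.source) : c.dTot y ((c.mkField hχ hs g hg).1 y) = χ y • (0, g (c.tot y).1) := by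
  change c.dTot y (χ y • c.invTot y (0, g (c.tot y).1)) = _
  rw [map_smul, c.dTot_invTot hy]

theorem fieldRep_mkField (c : AdaptedChart π) {χ : E → ℝ}
    (hχ : ContMDiff 𝓘(ℝ, B × F) 𝓘(ℝ, ℝ) ∞ χ) (hs : tsupport χ ⊆ c.tot.source) (g : B → F)
    (hg : ContDiff ℝ ∞ g) (s : LocalSection π) {x : M} (hx : x ∈ s.dom)
    (h : s.toFun x ∈ c.tot.source) :
    fieldRep c (c.mkField hχ hs g hg) s (c.base x) = χ (s.toFun x) • g (c.base x) := by
  have h1 := congrArg Prod.snd (c.dTot_mkField hχ hs g hg h)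
  rw [c.tot_section s hx h] at h1
  have e : c.base.symm (c.base x) = x := c.base.left_inv (c.base_mem_source s hx h)
  have h2 : fieldRep c (c.mkField hχ hs g hg) s (c.base x) =
      (c.dTot (s.toFun x) ((c.mkField hχ hs g hg).1 (s.toFun x))).2 := by
    conv_rhs => rw [← e]
    rfl
  exact h2.trans h1

theorem fieldRep_mkField_eventuallyEq (c : AdaptedChart π) {χ : E → ℝ}
    (hχ : ContMDiff 𝓘(ℝ, B × F) 𝓘(ℝ, ℝ) ∞ χ) (hs : tsupport χ ⊆ c.tot.source) (g : B → F)
    (hg : ContDiff ℝ ∞ g) (s : LocalSection π) {x : M} (hx : x ∈ s.dom)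
    (h : s.toFun x ∈ c.tot.source) (h1 : χ =ᶠ[𝓝 (s.toFun x)] 1) :
    fieldRep c (c.mkField hχ hs g hg) s =ᶠ[𝓝 (c.base x)] g := by
  have hb := c.base_mem_source s hx h
  have h2 : ∀ᶠ y in 𝓝 x, χ (s.toFun y) = 1 :=
    ((s.smooth.contMDiffAt (s.isOpen_dom.mem_nhds hx)).continuousAt).eventually h1
  have h3 : ∀ᶠ z in 𝓝 (c.base x), χ (s.toFun (c.base.symm z)) = 1 := by
    refine (c.base.continuousAt_symm (c.base.map_source hb)).eventually
      (p := fun y => χ (s.toFun y) = 1) ?_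
    rwa [c.base.left_inv hb]
  filter_upwards [c.eventually_symm_section s hx h, h3] with z hz hz'
  have h4 := c.fieldRep_mkField hχ hs g hg s hz.2.1 hz.2.2
  rw [c.base.right_inv hz.1, hz', one_smul] at h4
  exact h4

/-- The field `χ g^i ∂/∂u^i` with polynomial coefficients `g`, as a linear function of the
derivatives of `g` at a point. -/
def polyField (c : AdaptedChart π) {χ : E → ℝ} (hχ : ContMDiff 𝓘(ℝ, B × F) 𝓘(ℝ, ℝ) ∞ χ)
    (hs : tsupport χ ⊆ c.tot.source) (r : ℕ) (z₀ : B) :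
    ((k : Fin (r + 1)) → SymMul B F k) →ₗ[ℝ] VertField π where
  toFun w := c.mkField hχ hs (poly (z₀, w)) (contDiff_poly _)
  map_add' u w := by
    refine Subtype.ext (funext fun y => ?_)
    change χ y • c.invTot y (0, poly (z₀, u + w) (c.tot y).1) =
      χ y • c.invTot y (0, poly (z₀, u) (c.tot y).1) +
        χ y • c.invTot y (0, poly (z₀, w) (c.tot y).1)
    rw [← smul_add, ← map_add, poly_add, Prod.mk_add_mk, add_zero]
  map_smul' t w := by
    refine Subtype.ext (funext fun y => ?_)
    change χ y • c.invTot y (0, poly (z₀, t • w) (c.tot y).1) =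
      t • χ y • c.invTot y (0, poly (z₀, w) (c.tot y).1)
    rw [poly_smul, smul_comm t, ← map_smul (c.invTot y) t, Prod.smul_mk, smul_zero]

end AdaptedChart

theorem AdaptedChart.coe_evoCoord_jetCoord (c : AdaptedChart π) (φ : VertField π) {η : Jet π r}
    (h : η.toE ∈ c.tot.source) (k : Fin (r + 1)) :
    (c.evoCoord φ (c.jetCoord r η) k).incl =
      iteratedFDeriv ℝ k (fieldRep c φ η.rep.sec) (c.base η.base) :=
  c.coe_evoCoord φ η.rep h k

theorem SymMul.incl_injective (k : ℕ) :
    Function.Injective (SymMul.incl : SymMul B F k → (B [×k]→L[ℝ] F)) := Subtype.val_injective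

/-- The evolutionary field at a point as a linear function of the vertical field. -/
def evoL (η : Jet π r) : VertField π →ₗ[ℝ] TJet η where
  toFun φ := Evo φ η
  map_add' φ ψ := by
    let c := adaptedChartAt π η.toE
    have h : η.toE ∈ c.tot.source := mem_adaptedChartAt π η.toE
    apply (c.dCoord_bijective h).1
    rw [map_add, dCoord_evo c _ h, dCoord_evo c _ h, dCoord_evo c _ h]
    refine Prod.ext (add_zero _).symm (funext fun k => SymMul.incl_injective k ?_)
    refine (c.coe_evoCoord_jetCoord _ h k).trans ?_
    have hφ := c.contDiffAt_fieldRep φ η.rep.sec η.rep.mem h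
    have hψ := c.contDiffAt_fieldRep ψ η.rep.sec η.rep.mem h
    have hle : ((k : ℕ) : WithTop ℕ∞) ≤ ∞ := by exact_mod_cast le_top
    rw [c.fieldRep_add]
    refine (iteratedFDeriv_add_apply (hφ.of_le hle) (hψ.of_le hle)).trans ?_
    exact congrArg₂ (· + ·) (c.coe_evoCoord_jetCoord φ h k).symm
      (c.coe_evoCoord_jetCoord ψ h k).symm
  map_smul' t φ := by
    let c := adaptedChartAt π η.toE
    have h : η.toE ∈ c.tot.source := mem_adaptedChartAt π η.toE
    apply (c.dCoord_bijective h).1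
    rw [RingHom.id_apply, map_smul, dCoord_evo c _ h, dCoord_evo c _ h]
    refine Prod.ext (smul_zero _).symm (funext fun k => SymMul.incl_injective k ?_)
    refine (c.coe_evoCoord_jetCoord _ h k).trans ?_
    have hφ := c.contDiffAt_fieldRep φ η.rep.sec η.rep.mem h
    have hle : ((k : ℕ) : WithTop ℕ∞) ≤ ∞ := by exact_mod_cast le_top
    rw [c.fieldRep_smul]
    refine (iteratedFDeriv_const_smul_apply (hφ.of_le hle)).trans ?_
    exact congrArg (t • ·) (c.coe_evoCoord_jetCoord φ h k).symm

theorem evoL_apply (η : Jet π r) (φ : VertField π) : evoL η φ = Evo φ η := rfl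

/-- This translates between the geometric condition at a jet and flatness to order r of the
components along a representing section. The first suits forms, the second suits differential
operators. -/
theorem evo_eq_zero_iff (c : AdaptedChart π) (φ : VertField π) (a : PointedSection π)
    (h : a.sec.toFun a.pt ∈ c.tot.source) : Evo φ (jetMk r a) = 0 ↔
      ∀ k < r + 1, iteratedFDeriv ℝ k (fieldRep c φ a.sec) (c.base a.pt) = 0 := by
  have h' : (jetMk r a).toE ∈ c.tot.source := by rwa [toE_jetMk]
  rw [← (map_eq_zero_iff _ (c.dCoord_bijective h').1), dCoord_evo c φ h', c.jetCoord_jetMk r a h]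
  constructor
  · intro e k hk
    refine (c.coe_evoCoord φ a h ⟨k, hk⟩).symm.trans ?_
    exact congrArg (fun q : JetModel B F r => (q.2 ⟨k, hk⟩).incl) e
  · intro e
    refine Prod.ext rfl (funext fun k => SymMul.incl_injective k ?_)
    exact (c.coe_evoCoord φ a h k).trans (e k k.2)

theorem evo_mem_range_ver (φ : VertField π) (θ : Jet π (r + 1)) :
    Evo φ θ.proj ∈ LinearMap.range (ver θ) := by
  have h := mem_adaptedChartAt π θ.toE
  rw [mem_range_ver_iff_coord _ θ h, dCoord_evo _ φ (by rwa [toE_proj])]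

end Fields
end FiniteJet

namespace FiniteJet

/-! ### The operator defined by a form -/

section Operator

variable {B F M E : Type*}
  [NormedAddCommGroup B] [NormedSpace ℝ B] [NormedAddCommGroup F] [NormedSpace ℝ F]
  [TopologicalSpace M] [ChartedSpace B M] [TopologicalSpace E] [ChartedSpace (B × F) E]
  [FiniteDimensional ℝ B] [FiniteDimensional ℝ F] [IsManifold 𝓘(ℝ, B × F) ∞ E]
  {π : FibredManifold B F M E} {r p l : ℕ}

theorem mem_killForms_of_mem_barForms {β : RelForm π r l} (hβ : β ∈ barForms π r l)
    (θ : Jet π (r + 1)) : β θ ∈ killForms (ver θ) l := by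
  obtain ⟨b, -, e⟩ := hβ
  rw [e θ]
  exact compLinearMap_hor_mem_killForms θ _

/-- Membership at a single point needs only one local expression as a sum of products, since
`biForms` is a linear subspace at θ. -/
theorem mem_biForms_of_mem_contactBar {α : RelForm π r (l + p)} (hα : α ∈ contactBar π r p l)
    (θ : Jet π (r + 1)) : α θ ∈ biForms (ver θ) p l := by
  obtain ⟨α', h', e⟩ := hα θ.proj
  rw [e.self_of_nhds θ rfl]
  clear e
  induction h' using Submodule.span_induction with
  | mem δ hδ =>
    obtain ⟨γ, hγ, β, hβ, rfl⟩ := hδ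
    exact wedgeAt_mem_biForms (hγ.1 θ).symm (mem_killForms_of_mem_barForms hβ θ)
  | zero => exact zero_mem _
  | add x y _ _ hx hy => exact add_mem hx hy
  | smul f x _ hx => exact Submodule.smul_mem _ (f θ.proj) hx

theorem nabla_add (α α' : RelForm π r (l + p)) (φ : Fin p → VertField π) :
    nabla (α + α') φ = nabla α φ + nabla α' φ :=
  funext fun θ => (contractL p l fun i => Evo (φ i) θ.proj).map_add (α θ) (α' θ)

theorem nabla_smul (f : JetFun π r) (α : RelForm π r (l + p)) (φ : Fin p → VertField π) :
    nabla (f • α) φ = f • nabla α φ :=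
  funext fun θ => (contractL p l fun i => Evo (φ i) θ.proj).map_smul (f θ.proj) (α θ)

theorem nabla_zero (φ : Fin p → VertField π) : nabla (0 : RelForm π r (l + p)) φ = 0 :=
  funext fun θ => (contractL p l fun i => Evo (φ i) θ.proj).map_zero

/-- Evolutionary fields are vertical and barred forms are killed by vertical vectors, so the one
surviving shuffle is the trivial one. -/
theorem nabla_wedge (γ : RelForm π r p) {β : RelForm π r l} (hβ : β ∈ barForms π r l)
    (φ : Fin p → VertField π) (θ : Jet π (r + 1)) :
    nabla (wedge γ β) φ θ = γ θ (fun i => Evo (φ i.rev) θ.proj) • β θ :=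
  contract_wedgeAt_of_mem (γ θ) (mem_killForms_of_mem_barForms hβ θ)
    fun i => evo_mem_range_ver (φ i) θ

/-! ### Contact forms on smooth families of vectors -/

/-- The vertical vector at `η` with given components, as a linear function of the components. -/
def vertVecL (η₀ η : Jet π r) : ((k : Fin (r + 1)) → SymMul B F k) →ₗ[ℝ] TJet η :=
  ((trivializationAt (JetModel B F r)
    (TangentSpace 𝓘(ℝ, JetModel B F r) : Jet π r → Type _) η₀).symmL ℝ η).toLinearMap ∘ₗ
      LinearMap.inr ℝ B _

/-- The coefficients of a contact form are given as functions on J^rπ for constant vertical vectors.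
Multilinearity extends this to vertical vectors with smooth components. -/
theorem exists_smooth_contactForm_apply {γ : RelForm π r p} (hγ : γ ∈ contactForms π r p)
    (η₀ : Jet π r) {m : Fin p → Jet π r → (k : Fin (r + 1)) → SymMul B F k}
    (hm : ∀ i, ContMDiffAt 𝓘(ℝ, JetModel B F r) 𝓘(ℝ, (k : Fin (r + 1)) → SymMul B F k) ∞
      (m i) η₀) :
    ∃ f : Jet π r → ℝ, ContMDiffAt 𝓘(ℝ, JetModel B F r) 𝓘(ℝ, ℝ) ∞ f η₀ ∧
      ∀ᶠ η in 𝓝 η₀, ∀ θ : Jet π (r + 1), θ.proj = η →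
        γ θ (fun i => coordVec η₀ θ.proj (0, m i θ.proj)) = f η := by
  let A : Jet π (r + 1) → MultilinearMap ℝ
      (fun _ : Fin p => (k : Fin (r + 1)) → SymMul B F k) ℝ := fun θ =>
    ((γ θ).compLinearMap (vertVecL η₀ θ.proj)).toMultilinearMap
  -- A set-theoretic section of J^{r+1}π → J^rπ. No regularity is needed, because the values on
  -- constant vertical vectors near η₀ do not depend on the choice in the fibre.
  obtain ⟨σ, hσ⟩ := (proj_surjective (π := π) (r := r)).hasRightInverse
  choose f hf ef using hγ.2 η₀
  have hA : ∀ w, ∀ᶠ η in 𝓝 η₀, ∀ θ : Jet π (r + 1), θ.proj = η → A θ w = f w η := ef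
  let b := Module.finBasis ℝ ((k : Fin (r + 1)) → SymMul B F k)
  refine ⟨fun η => A (σ η) (fun i => m i η), contMDiffAt_multilinear_apply
    (A := fun η => A (σ η)) (fun w => (hf w).congr_of_eventuallyEq ?_) hm, ?_⟩
  · filter_upwards [hA w] with η h
    exact h _ (hσ η)
  · have h1 : ∀ᶠ η in 𝓝 η₀, ∀ v : Fin p → Fin _, ∀ θ : Jet π (r + 1), θ.proj = η →
        A θ (fun i => b (v i)) = f (fun i => b (v i)) η :=
      eventually_all.2 fun v => hA _
    filter_upwards [h1] with η h θ hθ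
    -- Multilinear maps that agree on tuples of basis vectors agree, so the values on moving vectors
    -- are also independent of the point θ over η.
    have e : A θ = A (σ η) := Module.Basis.ext_multilinear (fun _ => b) fun v => (h v θ hθ).trans (h v _ (hσ η)).symm
    have e' := congrArg (fun L => L (fun i => m i η)) e
    refine Eq.trans ?_ e'
    rw [← hθ]
    rfl

theorem contMDiffAt_evoCoord (c : AdaptedChart π) (φ : VertField π) {η : Jet π r}
    (h : η.toE ∈ c.tot.source) :
    ContMDiffAt 𝓘(ℝ, JetModel B F r) 𝓘(ℝ, (k : Fin (r + 1)) → SymMul B F k) ∞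
      (fun η : Jet π r => c.evoCoord φ (c.jetCoord r η)) η := by
  have h1 : ((c.jetCoord r η).1, (c.jetCoord r η).value) ∈ c.tot.target := by
    rw [c.jetCoord_point h]
    exact c.tot.map_source h
  exact (c.contDiffAt_evoCoord φ h1).contMDiffAt.comp η (c.contMDiffAt_jetCoord h)

/-- Both the coefficients of γ and the total derivatives in Evo are smooth functions on J^rπ. Hence
contraction of γ ∧ β multiplies β by an element of 𝓕_r and stays among the barred forms. -/
theorem exists_jetFun_contactForm_evo {γ : RelForm π r p} (hγ : γ ∈ contactForms π r p)
    (φ : Fin p → VertField π) : ∃ g : JetFun π r, ∀ θ : Jet π (r + 1),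
      γ θ (fun i => Evo (φ i) θ.proj) = g θ.proj := by
  obtain ⟨σ, hσ⟩ := (proj_surjective (π := π) (r := r)).hasRightInverse
  have key : ∀ η₀ : Jet π r, ∃ f : Jet π r → ℝ,
      ContMDiffAt 𝓘(ℝ, JetModel B F r) 𝓘(ℝ, ℝ) ∞ f η₀ ∧
      ∀ᶠ η in 𝓝 η₀, ∀ θ : Jet π (r + 1), θ.proj = η →
        γ θ (fun i => Evo (φ i) θ.proj) = f η := by
    intro η₀
    let c := adaptedChartAt π η₀.toE
    have h0 : η₀.toE ∈ c.tot.source := mem_adaptedChartAt π η₀.toE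
    obtain ⟨f, hf, e⟩ := exists_smooth_contactForm_apply hγ η₀
      (m := fun i η => c.evoCoord (φ i) (c.jetCoord r η))
      (fun i => contMDiffAt_evoCoord c (φ i) h0)
    refine ⟨f, hf, ?_⟩
    filter_upwards [e, (c.isOpen_jetSource r).mem_nhds h0] with η h1 h2 θ hθ
    rw [← h1 θ hθ]
    congr 1
    funext i
    refine evo_eq_coordVec (φ i) ?_
    rw [hθ]
    exact h2
  refine ⟨⟨fun η => γ (σ η) (fun i => Evo (φ i) (σ η).proj), fun η₀ => ?_⟩, fun θ => ?_⟩
  · obtain ⟨f, hf, e⟩ := key η₀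
    refine hf.congr_of_eventuallyEq ?_
    filter_upwards [e] with η h
    exact h _ (hσ η)
  · obtain ⟨f, hf, e⟩ := key θ.proj
    exact (e.self_of_nhds θ rfl).trans (e.self_of_nhds _ (hσ _)).symm

theorem nabla_mem_barForms_of_mem_span {α : RelForm π r (l + p)}
    (hα : α ∈ Submodule.span (JetFun π r)
      {δ | ∃ γ ∈ contactForms π r p, ∃ β ∈ barForms π r l, δ = wedge γ β})
    (φ : Fin p → VertField π) : nabla α φ ∈ barForms π r l := by
  induction hα using Submodule.span_induction with
  | mem δ hδ =>
    obtain ⟨γ, hγ, β, hβ, rfl⟩ := hδ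
    obtain ⟨g, hg⟩ := exists_jetFun_contactForm_evo hγ fun i => φ i.rev
    have e : nabla (wedge γ β) φ = g • β := funext fun θ => by
      rw [nabla_wedge γ hβ φ θ, hg θ, RelForm.smul_apply]
    rw [e]
    exact Submodule.smul_mem _ g hβ
  | zero => rw [nabla_zero]; exact zero_mem _
  | add x y _ _ hx hy => rw [nabla_add]; exact add_mem hx hy
  | smul f x _ hx => rw [nabla_smul]; exact Submodule.smul_mem _ f hx

/-- The local forms on J^rπ whose horizontal parts agree with α are averaged with a partition of
unity; taking horizontal parts is linear over functions on J^rπ. -/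
theorem mem_barForms_of_locally [T2Space E] [SecondCountableTopology E] {α : RelForm π r l}
    (h : ∀ η₀ : Jet π r, ∃ δ ∈ barForms π r l, ∀ᶠ η in 𝓝 η₀, ∀ θ : Jet π (r + 1),
      θ.proj = η → α θ = δ θ) : α ∈ barForms π r l := by
  choose δ hδ e using h
  choose β hβ eβ using hδ
  obtain ⟨f, hf⟩ := SmoothPartitionOfUnity.exists_isSubordinate 𝓘(ℝ, JetModel B F r)
    (isClosed_univ (X := Jet π r))
    (fun η₀ => interior {η | ∀ θ : Jet π (r + 1), θ.proj = η → α θ = δ η₀ θ})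
    (fun _ => isOpen_interior)
    (fun η _ => mem_iUnion.2 ⟨η, mem_interior_iff_mem_nhds.2 (e η)⟩)
  have hfin : ∀ η : Jet π r, (Function.support fun i => f i η).Finite := fun η =>
    f.locallyFinite.point_finite η
  have hev : ∀ (η : Jet π r) (w : Fin l → TJet η),
      (∑ᶠ i, f i η • β i η) w = ∑ᶠ i, f i η • β i η w := fun η w => by
    let ev : (TJet η [⋀^Fin l]→ₗ[ℝ] ℝ) →+ ℝ :=
      { toFun := fun a => a w, map_zero' := rfl, map_add' := fun _ _ => rfl }
    exact ev.map_finsum ((hfin η).subset fun i hi h0 => hi (by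
      change f i η • β i η = 0
      rw [show f i η = 0 from h0, zero_smul]))
  refine ⟨fun η => ∑ᶠ i, f i η • β i η, fun η₀ v => ?_, fun θ => ?_⟩
  · simp only [hev]
    exact SmoothPartitionOfUnity.contMDiffAt_finsum (f := f)
      (g := fun i η => β i η fun j => coordVec η₀ η (v j)) fun i _ => hβ i η₀ v
  · ext w
    change _ = (∑ᶠ i, f i θ.proj • β i θ.proj) (fun j => hor θ (w j))
    rw [hev]
    -- Wherever the weight f_i is nonzero, the horizontal part of β_i is α, so the weighted sum is
    -- (Σ f_i) α.
    have h1 : ∀ i, f i θ.proj • β i θ.proj (fun j => hor θ (w j)) = f i θ.proj • α θ w := by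
      intro i
      by_cases h0 : f i θ.proj = 0
      · rw [h0, zero_smul, zero_smul]
      · have h2 := interior_subset (hf i (subset_tsupport _ h0)) θ rfl
        rw [h2, eβ i θ]
        rfl
    rw [finsum_congr h1, ← finsum_smul, f.sum_eq_one (mem_univ θ.proj), one_smul]

theorem nabla_mem_barForms [T2Space E] [SecondCountableTopology E] {α : RelForm π r (l + p)}
    (hα : α ∈ contactBar π r p l) (φ : Fin p → VertField π) : nabla α φ ∈ barForms π r l := by
  refine mem_barForms_of_locally fun η₀ => ?_
  obtain ⟨α', h', e⟩ := hα η₀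
  refine ⟨nabla α' φ, nabla_mem_barForms_of_mem_span h' φ, ?_⟩
  filter_upwards [e] with η h θ hθ
  simp only [nabla, h θ hθ]

/-! ### Contraction as an alternating map -/

/-- The contraction of a form with vectors as an alternating function of the vectors. -/
def contractAlt {V : Type*} [AddCommGroup V] [Module ℝ V] {p l : ℕ}
    (a : V [⋀^Fin (l + p)]→ₗ[ℝ] ℝ) : V [⋀^Fin p]→ₗ[ℝ] (V [⋀^Fin l]→ₗ[ℝ] ℝ) := by
  classical
  let e : Fin p ⊕ Fin l ≃ Fin (l + p) := finSumFinEquiv.trans (finCongr (Nat.add_comm p l))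
  -- Changing the i-th contracted vector changes one argument of a, namely that in the reversed
  -- slot; additivity, homogeneity and alternation are then inherited from a.
  have hu : ∀ (v : Fin p → V) (i : Fin p) (x : V) (w : Fin l → V),
      contract p a (Function.update v i x) w =
        a (Function.update (fun k => Sum.elim (v ∘ Fin.rev) w (e.symm k)) (e (Sum.inl i.rev)) x) := by
    intro v i x w
    rw [contract_apply]
    congr 1
    funext k
    obtain ⟨k, rfl⟩ := e.surjective k
    change Sum.elim _ w (e.symm (e k)) = _
    rw [e.symm_apply_apply]
    by_cases hk : k = Sum.inl i.rev
    · subst hk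
      simp
    · rw [Function.update_of_ne (fun h => hk (e.injective h)), e.symm_apply_apply]
      rcases k with k | k
      · have : k.rev ≠ i := fun h => hk (by rw [← h, Fin.rev_rev])
        simp [Function.update_of_ne this]
      · rfl
  refine
    { toFun := contract p a
      map_update_add' := fun v i x y => ?_
      map_update_smul' := fun v i c x => ?_
      map_eq_zero_of_eq' := ?_ }
  · ext w
    rw [AlternatingMap.add_apply]
    convert a.map_update_add (fun k => Sum.elim (v ∘ Fin.rev) w (e.symm k)) (e (Sum.inl i.rev)) x y
      using 1
    · convert hu v i (x + y) w
    · congr 1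
      · convert hu v i x w
      · convert hu v i y w
  · ext w
    rw [AlternatingMap.smul_apply]
    convert a.map_update_smul (fun k => Sum.elim (v ∘ Fin.rev) w (e.symm k)) (e (Sum.inl i.rev)) c x
      using 1
    · convert hu v i (c • x) w
    · congr 1
      convert hu v i x w
  · intro v i j hij hne
    ext w
    rw [contract_apply]
    refine a.map_eq_zero_of_eq _ (i := e (Sum.inl i.rev)) (j := e (Sum.inl j.rev)) ?_ ?_
    · change Sum.elim (v ∘ Fin.rev) w (e.symm (e _)) = Sum.elim (v ∘ Fin.rev) w (e.symm (e _))
      rw [e.symm_apply_apply, e.symm_apply_apply]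
      simpa using hij
    · intro h
      exact hne (Fin.rev_injective (Sum.inl_injective (e.injective h)))

/-- The operator `∇_α` at a point. -/
def nablaAt (α : RelForm π r (l + p)) (θ : Jet π (r + 1)) :
    VertField π [⋀^Fin p]→ₗ[ℝ] (TJet θ.proj [⋀^Fin l]→ₗ[ℝ] ℝ) :=
  (contractAlt (α θ)).compLinearMap (evoL θ.proj)

/-- The operator `∇_α` as an alternating map. -/
def nablaAlt [T2Space E] [SecondCountableTopology E] (α : contactBar π r p l) :
    VertField π [⋀^Fin p]→ₗ[ℝ] barForms π r l where
  toFun φ := ⟨nabla α.1 φ, nabla_mem_barForms α.2 φ⟩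
  map_update_add' φ i x y := Subtype.ext (funext fun θ => (nablaAt α.1 θ).map_update_add φ i x y)
  map_update_smul' φ i c x :=
    Subtype.ext (funext fun θ => (nablaAt α.1 θ).map_update_smul φ i c x)
  map_eq_zero_of_eq' φ _ _ h hne :=
    Subtype.ext (funext fun θ => (nablaAt α.1 θ).map_eq_zero_of_eq φ h hne)

/-! ### Differential operators -/

/-- At θ the commutator with a is Δ applied to (a(θ) - a) φ, and the vanishing factor raises the
order of flatness of φ along the section by one. Thus [a, Δ] satisfies the hypothesis with k - 1,
and for k = 0 it vanishes on every field. -/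
theorem isDiffOp_of_flat (k : ℕ) (Δ : VertField π →ₗ[ℝ] RelForm π r l)
    (h : ∀ (θ : Jet π (r + 1)) (φ : VertField π), (∀ j < k + 1, iteratedFDeriv ℝ j
      (fieldRep (adaptedChartAt π θ.toE) φ θ.rep.sec)
        ((adaptedChartAt π θ.toE).base θ.rep.pt) = 0) → Δ φ θ = 0) : IsDiffOp k Δ := by
  have key : ∀ (k : ℕ) (Δ : VertField π →ₗ[ℝ] RelForm π r l)
      (_ : ∀ (θ : Jet π (r + 1)) (φ : VertField π), (∀ j < k + 1, iteratedFDeriv ℝ j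
        (fieldRep (adaptedChartAt π θ.toE) φ θ.rep.sec)
          ((adaptedChartAt π θ.toE).base θ.rep.pt) = 0) → Δ φ θ = 0)
      (a : C^∞⟮𝓘(ℝ, B × F), E; 𝓘(ℝ, ℝ), ℝ⟯) (θ : Jet π (r + 1)) (φ : VertField π),
      (∀ j < k, iteratedFDeriv ℝ j (fieldRep (adaptedChartAt π θ.toE) φ θ.rep.sec)
        ((adaptedChartAt π θ.toE).base θ.rep.pt) = 0) → commutator a Δ φ θ = 0 := by
    intro k Δ h a θ φ hφ
    let c := adaptedChartAt π θ.toE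
    have hc : θ.rep.sec.toFun θ.rep.pt ∈ c.tot.source := mem_adaptedChartAt π θ.toE
    have hb := c.base_mem_source θ.rep.sec θ.rep.mem hc
    let b : C^∞⟮𝓘(ℝ, B × F), E; 𝓘(ℝ, ℝ), ℝ⟯ :=
      ⟨fun y => a θ.toE - a y, contMDiff_const.sub a.contMDiff⟩
    have e1 : mulField b φ = a θ.toE • φ - mulField a φ :=
      Subtype.ext (funext fun y => sub_smul (a θ.toE) (a y) (φ.1 y))
    have e2 : commutator a Δ φ θ = Δ (mulField b φ) θ := by
      rw [e1, map_sub, map_smul]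
      change a θ.proj.toE • Δ φ θ - Δ (mulField a φ) θ = a θ.toE • Δ φ θ - Δ (mulField a φ) θ
      rw [toE_proj]
    rw [e2]
    refine h θ _ fun j hj => ?_
    have e3 : fieldRep c (mulField b φ) θ.rep.sec = fun z =>
        b (θ.rep.sec.toFun (c.base.symm z)) • fieldRep c φ θ.rep.sec z :=
      funext fun z => c.fieldRep_mulField b φ θ.rep.sec z
    change iteratedFDeriv ℝ j (fieldRep c (mulField b φ) θ.rep.sec) (c.base θ.rep.pt) = 0
    rw [e3]
    refine iteratedFDeriv_smul_eq_zero (k := k)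
      (f := fun z => b (θ.rep.sec.toFun (c.base.symm z))) ?_
      (c.contDiffAt_fieldRep φ _ θ.rep.mem hc) ?_ hφ j hj
    · have h1 : ContMDiffAt 𝓘(ℝ, B) 𝓘(ℝ, B) ∞ c.base.symm (c.base θ.rep.pt) :=
        contMDiffAt_symm_of_mem_maximalAtlas c.base_mem (c.base.map_source hb)
      have h2 : ContMDiffAt 𝓘(ℝ, B) 𝓘(ℝ, B × F) ∞ θ.rep.sec.toFun
          (c.base.symm (c.base θ.rep.pt)) := by
        rw [c.base.left_inv hb]
        exact θ.rep.sec.smooth.contMDiffAt (θ.rep.sec.isOpen_dom.mem_nhds θ.rep.mem)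
      exact ((b.contMDiff _).comp _ (h2.comp _ h1)).contDiffAt
    · rw [c.base.left_inv hb]
      exact sub_self (a θ.toE)
  induction k generalizing Δ with
  | zero =>
    intro a
    ext φ : 1
    funext θ
    exact key 0 Δ h a θ φ fun j hj => absurd hj (Nat.not_lt_zero j)
  | succ k ih => exact fun a => ih _ (key (k + 1) Δ h a)

/-- The field enters at θ only as one vector contracted into α. Both the bound on the order and the
C-differential property follow from this. -/
theorem nablaAlt_partialOp_eq_zero [T2Space E] [SecondCountableTopology E]
    (α : contactBar π r p l) (φ : Fin p → VertField π) (i : Fin p) (X : VertField π)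
    (θ : Jet π (r + 1)) (h : Evo X θ.proj = 0) : partialOp (nablaAlt α) φ i X θ = 0 := by
  refine (contractAlt (α.1 θ)).map_coord_zero i ?_
  change Evo (Function.update φ i X i) θ.proj = 0
  rwa [Function.update_self]

theorem nablaAlt_mem_CDiffAlt [T2Space E] [SecondCountableTopology E] (α : contactBar π r p l) :
    nablaAlt α ∈ CDiffAlt π r p l := by
  intro φ i
  constructor
  · refine isDiffOp_of_flat r _ fun θ X hX => nablaAlt_partialOp_eq_zero α φ i X θ ?_
    exact (evo_eq_zero_iff (adaptedChartAt π θ.toE) X θ.rep (mem_adaptedChartAt π θ.toE)).2 hX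
  · intro s X hX x hx
    refine nablaAlt_partialOp_eq_zero α φ i X _ ?_
    rw [proj_jetMk]
    let c := adaptedChartAt π (s.toFun x)
    have hc : s.toFun x ∈ c.tot.source := mem_adaptedChartAt π (s.toFun x)
    refine (evo_eq_zero_iff c X ⟨s, x, hx⟩ hc).2 fun k _ => ?_
    have e : fieldRep c X s =ᶠ[𝓝 (c.base x)] fun _ => 0 := by
      filter_upwards [c.eventually_symm_section s hx hc] with z hz
      exact (c.fieldRep_eq_zero_iff X s hz.2.2).2 (hX _ hz.2.1)
    refine (e.iteratedFDeriv ℝ k).eq_of_nhds.trans ?_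
    simp

/-- The map `α ↦ ∇_α`. -/
def nablaHom [T2Space E] [SecondCountableTopology E] :
    contactBar π r p l →ₗ[JetFun π r] CDiffAlt π r p l where
  toFun α := ⟨nablaAlt α, nablaAlt_mem_CDiffAlt α⟩
  map_add' α α' := Subtype.ext (AlternatingMap.ext fun φ => Subtype.ext (nabla_add α.1 α'.1 φ))
  map_smul' f α := Subtype.ext (AlternatingMap.ext fun φ => Subtype.ext (nabla_smul f α.1 φ))

/-! ### Injectivity -/

/-- The components of v are taken as the derivatives of polynomial coefficients at the base point; a
cut-off function equal to 1 near the value of the jet does not disturb them. -/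
theorem exists_evo_eq [T2Space E] (θ : Jet π (r + 1)) {v : TJet θ.proj}
    (hv : v ∈ LinearMap.range (ver θ)) : ∃ φ : VertField π, Evo φ θ.proj = v := by
  let c := adaptedChartAt π θ.toE
  have hc : θ.toE ∈ c.tot.source := mem_adaptedChartAt π θ.toE
  have hc' : θ.proj.toE ∈ c.tot.source := by rwa [toE_proj]
  rw [mem_range_ver_iff_coord c θ hc] at hv
  obtain ⟨χ, h1, h2, h3⟩ := exists_smooth_cutoff 𝓘(ℝ, B × F) (c.tot.open_source.mem_nhds hc)
  let w := (c.dCoord θ.proj v).2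
  refine ⟨c.polyField h1 h2 r (c.base θ.base) w, (c.dCoord_bijective hc').1 ?_⟩
  rw [dCoord_evo c _ hc']
  refine Prod.ext hv.symm (funext fun k => SymMul.incl_injective k ?_)
  have e1 : c.jetCoord r θ.proj = c.coords r θ.rep := c.jetCoord_jetMk r θ.rep hc
  rw [e1]
  refine (c.coe_evoCoord _ θ.rep hc k).trans ?_
  have e2 := c.fieldRep_mkField_eventuallyEq h1 h2 (poly (c.base θ.base, w)) (contDiff_poly _)
    θ.rep.sec θ.rep.mem hc h3
  refine (e2.iteratedFDeriv ℝ k).eq_of_nhds.trans ?_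
  exact iteratedFDeriv_poly (c.base θ.base, w) k

/-- Injectivity at a single point θ. It gives the global injectivity and, in the proof of
surjectivity, the agreement of local solutions. -/
theorem eq_zero_of_nabla_eq_zero [T2Space E] {θ : Jet π (r + 1)} {α : RelForm π r (l + p)}
    (hα : α θ ∈ biForms (ver θ) p l) (h : ∀ φ : Fin p → VertField π, nabla α φ θ = 0) :
    α θ = 0 := by
  refine eq_zero_of_contract_eq_zero hα fun v hv => ?_
  choose φ hφ using fun i => exists_evo_eq θ (hv i)
  rw [← h φ]
  exact congrArg (contract p (α θ)) (funext fun i => (hφ i).symm)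

theorem nablaHom_injective [T2Space E] [SecondCountableTopology E] :
    Function.Injective (nablaHom : contactBar π r p l →ₗ[JetFun π r] CDiffAlt π r p l) := by
  rw [injective_iff_map_eq_zero]
  intro α h
  refine Subtype.ext (funext fun θ => ?_)
  refine eq_zero_of_nabla_eq_zero (mem_biForms_of_mem_contactBar α.2 θ) fun φ => ?_
  have h1 := congrArg (fun Δ : CDiffAlt π r p l => (Δ.1 φ).1 θ) h
  exact h1

end Operator
end FiniteJet

namespace FiniteJet

/-! ### Localization of differential operators at jets -/

section Localization

variable {B F M E : Type*}
  [NormedAddCommGroup B] [NormedSpace ℝ B] [NormedAddCommGroup F] [NormedSpace ℝ F]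
  [TopologicalSpace M] [ChartedSpace B M] [TopologicalSpace E] [ChartedSpace (B × F) E]
  [FiniteDimensional ℝ B] [FiniteDimensional ℝ F] [IsManifold 𝓘(ℝ, B × F) ∞ E]
  {π : FibredManifold B F M E} {r p l : ℕ}

/-- At a zero of b one has D(bY) = -[b, D]Y. Each of the k + 1 factors is absorbed by one
commutator, and k + 1 commutators annihilate D. -/
theorem IsDiffOp.apply_mulField_prod {k : ℕ} {D : VertField π →ₗ[ℝ] RelForm π r l}
    (hD : IsDiffOp k D) (a : Fin (k + 1) → C^∞⟮𝓘(ℝ, B × F), E; 𝓘(ℝ, ℝ), ℝ⟯)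
    {θ : Jet π (r + 1)} (ha : ∀ j, a j θ.toE = 0) (X : VertField π) :
    D (mulField (∏ j, a j) X) θ = 0 := by
  have key : ∀ (D : VertField π →ₗ[ℝ] RelForm π r l) (b : C^∞⟮𝓘(ℝ, B × F), E; 𝓘(ℝ, ℝ), ℝ⟯)
      (_ : b θ.toE = 0) (Y : VertField π), D (mulField b Y) θ = -(commutator b D Y θ) := by
    intro D b hb Y
    change _ = -(b θ.proj.toE • D Y θ - D (mulField b Y) θ)
    rw [toE_proj, hb, zero_smul, zero_sub, neg_neg]
  have hmul : ∀ (b b' : C^∞⟮𝓘(ℝ, B × F), E; 𝓘(ℝ, ℝ), ℝ⟯), mulField (b * b') X =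
      mulField b (mulField b' X) := fun b b' =>
    Subtype.ext (funext fun y => mul_smul (b y) (b' y) (X.1 y))
  induction k generalizing D with
  | zero =>
    rw [Fin.prod_univ_one, key D _ (ha 0), hD (a 0)]
    exact neg_zero
  | succ k ih =>
    rw [Fin.prod_univ_succ, hmul, key D _ (ha 0), ih (hD (a 0)) (fun j => a j.succ) fun j => ha _,
      neg_zero]

/-- The restriction of a local section to an open subset. -/
def LocalSection.restrict (s : LocalSection π) {U : Set M} (hU : IsOpen U) : LocalSection π where
  toFun := s.toFun
  dom := s.dom ∩ U
  isOpen_dom := s.isOpen_dom.inter hU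
  smooth := s.smooth.mono inter_subset_left
  proj_apply x hx := s.proj_apply x hx.1

/-- The definition requires vanishing on the whole domain of a section. Restriction of the section
to a neighbourhood does not change its jet, so vanishing near the point suffices. -/
theorem IsCDiff.apply_eq_zero {D : VertField π →ₗ[ℝ] RelForm π r l} (hD : IsCDiff D)
    (θ : Jet π (r + 1)) {X : VertField π}
    (hX : ∀ᶠ x in 𝓝 θ.rep.pt, X.1 (θ.rep.sec.toFun x) = 0) : D X θ = 0 := by
  obtain ⟨U, hU, hUo, hx⟩ := eventually_nhds_iff.1 hX
  have h1 := hD (θ.rep.sec.restrict hUo) X (fun x hx => hU x hx.2) θ.rep.pt ⟨θ.rep.mem, hx⟩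
  have e : jetMk (r + 1) ⟨θ.rep.sec.restrict hUo, θ.rep.pt, ⟨θ.rep.mem, hx⟩⟩ = θ :=
    Eq.trans (b := jetMk (r + 1) θ.rep)
      (Quotient.sound (s := jetSetoid π (r + 1)) ⟨rfl, rfl, fun _ _ _ _ => rfl⟩) (jetMk_rep θ)
  rwa [e] at h1

theorem fieldRep_sub (c : AdaptedChart π) (X Y : VertField π) (s : LocalSection π) :
    fieldRep c (X - Y) s = fieldRep c X s - fieldRep c Y s := by
  funext z
  have := (c.dTot (s.toFun (c.base.symm z))).map_sub (X.1 _) (Y.1 _)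
  exact congrArg Prod.snd this

theorem fieldRep_sum (c : AdaptedChart π) {ι : Type*} (t : Finset ι) (X : ι → VertField π)
    (s : LocalSection π) : fieldRep c (∑ i ∈ t, X i) s = ∑ i ∈ t, fieldRep c (X i) s := by
  classical
  induction t using Finset.induction_on with
  | empty => simpa using c.fieldRep_smul 0 0 s
  | insert i t hi ih => rw [Finset.sum_insert hi, Finset.sum_insert hi, c.fieldRep_add, ih]

/-- The two conditions on D share the work. A field Y made from Hadamard's factorisation of X along
the section is annihilated at θ because D has order at most r. The difference X - Y vanishes along
the section near the point and is annihilated because D is C-differential. -/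
theorem apply_eq_zero_of_evo_eq_zero [T2Space E] {D : VertField π →ₗ[ℝ] RelForm π r l}
    (hD : IsDiffOp r D) (hC : IsCDiff D) (θ : Jet π (r + 1)) {X : VertField π}
    (hX : Evo X θ.proj = 0) : D X θ = 0 := by
  let c := adaptedChartAt π θ.toE
  let s := θ.rep.sec
  have hx : θ.rep.pt ∈ s.dom := θ.rep.mem
  have hc : s.toFun θ.rep.pt ∈ c.tot.source := mem_adaptedChartAt π θ.toE
  let z₀ := c.base θ.rep.pt
  -- The components of X along s are smooth only near the point, whereas the factorisation is
  -- applied to a globally smooth function.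
  obtain ⟨g, hg, eg⟩ := exists_contDiff_eventuallyEq (c.exists_contDiffOn_fieldRep X s hx hc)
  have hflat : ∀ j < r + 1, iteratedFDeriv ℝ j g z₀ = 0 := fun j hj =>
    (eg.iteratedFDeriv ℝ j).eq_of_nhds.trans ((evo_eq_zero_iff c X θ.rep hc).1 hX j hj)
  let b := Module.finBasis ℝ B
  have : CompleteSpace F := FiniteDimensional.complete ℝ F
  obtain ⟨G, hG, hsum⟩ := exists_eq_sum_prod_smul b z₀ (r + 1) hg hflat
  obtain ⟨χ, h1, h2, h3⟩ := exists_smooth_cutoff 𝓘(ℝ, B × F) (c.tot.open_source.mem_nhds hc)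
  have hcoord : ∀ i, ContDiff ℝ ∞ fun q : B × F => b.coord i (q.1 - z₀) := fun i =>
    ((b.coord i).toContinuousLinearMap.contDiff).comp (contDiff_fst.sub contDiff_const)
  -- The base coordinates centred at the point, cut off so as to become functions on all of E; they
  -- vanish at the value of the jet.
  let a : Fin (Module.finrank ℝ B) → C^∞⟮𝓘(ℝ, B × F), E; 𝓘(ℝ, ℝ), ℝ⟯ := fun i =>
    ⟨_, c.contMDiff_cutoff_smul h1 h2 (hcoord i)⟩
  have ha : ∀ i, a i θ.toE = 0 := fun i => by
    change χ (s.toFun θ.rep.pt) • b.coord i ((c.tot (s.toFun θ.rep.pt)).1 - z₀) = 0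
    rw [c.tot_section s hx hc, sub_self, map_zero, smul_zero]
  -- Each summand carries r + 1 vanishing factors, one more than the order of D.
  let Y : VertField π := ∑ m, mulField (∏ j, a (m j)) (c.mkField h1 h2 (G m) (hG m))
  have hY : D Y θ = 0 := by
    have e : D Y = ∑ m, D (mulField (∏ j, a (m j)) (c.mkField h1 h2 (G m) (hG m))) :=
      map_sum D _ _
    rw [e]
    refine (Finset.sum_apply θ _ _).trans (Finset.sum_eq_zero fun m _ => ?_)
    exact hD.apply_mulField_prod (fun j => a (m j)) (fun j => ha _) _
  -- Where the cut-off equals 1 along s, the components of Y are exactly the sum given by Hadamard's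
  -- lemma. Away from s the fields X and Y are unrelated.
  have hrep : fieldRep c (X - Y) s =ᶠ[𝓝 z₀] 0 := by
    have e1 : ∀ᶠ z in 𝓝 z₀, ∀ m, fieldRep c (c.mkField h1 h2 (G m) (hG m)) s z = G m z :=
      eventually_all.2 fun m => c.fieldRep_mkField_eventuallyEq h1 h2 (G m) (hG m) s hx hc h3
    have e2 : ∀ᶠ z in 𝓝 z₀, χ (s.toFun (c.base.symm z)) = 1 := by
      have hb := c.base_mem_source s hx hc
      refine (c.base.continuousAt_symm (c.base.map_source hb)).eventually
        (p := fun y => χ (s.toFun y) = 1) ?_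
      rw [c.base.left_inv hb]
      exact ((s.smooth.contMDiffAt (s.isOpen_dom.mem_nhds hx)).continuousAt).eventually h3
    filter_upwards [e1, e2, eg, c.eventually_symm_section s hx hc] with z e1 e2 eg hz
    rw [fieldRep_sub, fieldRep_sum, Pi.sub_apply, ← eg, hsum, Finset.sum_apply, Pi.zero_apply,
      sub_eq_zero]
    refine Finset.sum_congr rfl fun m _ => ?_
    rw [c.fieldRep_mulField, e1 m]
    congr 1
    have e4 : (∏ j, a (m j)) (s.toFun (c.base.symm z)) =
        ∏ j, a (m j) (s.toFun (c.base.symm z)) :=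
      map_prod (ContMDiffMap.evalRingHom (s.toFun (c.base.symm z)) :
        C^∞⟮𝓘(ℝ, B × F), E; 𝓘(ℝ, ℝ), ℝ⟯ →+* ℝ) _ _
    rw [e4]
    refine Finset.prod_congr rfl fun j _ => ?_
    change _ = χ (s.toFun (c.base.symm z)) •
      b.coord (m j) ((c.tot (s.toFun (c.base.symm z))).1 - z₀)
    rw [e2, one_smul, c.tot_section s hz.2.1 hz.2.2, c.base.right_inv hz.1]
  have hXY : D (X - Y) θ = 0 := by
    refine hC.apply_eq_zero θ ?_
    have hb := c.base_mem_source s hx hc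
    filter_upwards [(c.base.continuousAt hb).eventually hrep, c.eventually_section s hx hc,
      c.base.open_source.mem_nhds hb] with y h4 h5 h6
    have h7 : s.toFun (c.base.symm (c.base y)) ∈ c.tot.source := by
      rw [c.base.left_inv h6]; exact h5.2
    have h8 := (c.fieldRep_eq_zero_iff (X - Y) s h7).1 h4
    rwa [c.base.left_inv h6] at h8
  have e : D X = D (X - Y) + D Y := by rw [map_sub, sub_add_cancel]
  rw [e]
  change D (X - Y) θ + D Y θ = 0
  rw [hXY, hY, add_zero]

theorem apply_congr_of_evo_eq [T2Space E] {Δ : VertField π [⋀^Fin p]→ₗ[ℝ] barForms π r l}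
    (hΔ : Δ ∈ CDiffAlt π r p l) (θ : Jet π (r + 1)) {φ ψ : Fin p → VertField π}
    (h : ∀ i, Evo (φ i) θ.proj = Evo (ψ i) θ.proj) : (Δ φ).1 θ = (Δ ψ).1 θ := by
  classical
  -- The fields are exchanged one slot at a time; each exchange alters the value by a term whose
  -- argument has Evo = 0 at θ.
  have key : ∀ t : Finset (Fin p), (Δ (t.piecewise ψ φ)).1 θ = (Δ φ).1 θ := by
    intro t
    induction t using Finset.induction_on with
    | empty => rw [Finset.piecewise_empty]
    | insert i t hi ih =>
      rw [← ih, Finset.piecewise_insert]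
      let u := t.piecewise ψ φ
      have hu : Function.update u i (φ i) = u := by
        rw [Function.update_eq_iff]
        exact ⟨(t.piecewise_eq_of_notMem ψ φ hi).symm, fun _ _ => rfl⟩
      have h1 : partialOp Δ u i (ψ i - φ i) θ = 0 := by
        refine apply_eq_zero_of_evo_eq_zero (hΔ u i).1 (hΔ u i).2 θ ?_
        rw [← evoL_apply, map_sub, evoL_apply, evoL_apply, h, sub_self]
      rw [map_sub] at h1
      have h2 : partialOp Δ u i (ψ i) θ - partialOp Δ u i (φ i) θ = 0 := h1
      have h3 : ∀ X, partialOp Δ u i X θ = (Δ (Function.update u i X)).1 θ := fun X => by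
        change (Δ _).1 θ = _
        congr!
      rw [h3, h3, hu] at h2
      exact sub_eq_zero.1 h2
  have h1 := key Finset.univ
  rw [Finset.piecewise_univ] at h1
  exact h1.symm

end Localization
end FiniteJet

namespace FiniteJet

/-! ### Forms defined by operators -/

/-- In finite dimension an operator is a fixed linear expression in its values on a basis. -/
theorem contMDiffAt_of_forall_apply {V G H₀ H X : Type*} [NormedAddCommGroup V] [NormedSpace ℝ V]
    [FiniteDimensional ℝ V] [NormedAddCommGroup G] [NormedSpace ℝ G] [NormedAddCommGroup H₀]
    [NormedSpace ℝ H₀] [TopologicalSpace H] {I : ModelWithCorners ℝ H₀ H} [TopologicalSpace X]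
    [ChartedSpace H X] {f : X → V →L[ℝ] G} {x : X}
    (h : ∀ v, ContMDiffAt I 𝓘(ℝ, G) ∞ (fun y => f y v) x) :
    ContMDiffAt I 𝓘(ℝ, V →L[ℝ] G) ∞ f x := by
  let b := Module.finBasis ℝ V
  have e : f = fun y => ∑ i, ContinuousLinearMap.smulRightL ℝ V G
      (b.coord i).toContinuousLinearMap (f y (b i)) := by
    funext y
    ext v
    rw [sum_apply]
    conv_lhs => rw [← b.sum_repr v, map_sum]
    refine Finset.sum_congr rfl fun i _ => ?_
    rw [map_smul]
    rfl
  rw [e]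
  refine ContMDiffAt.sum fun i _ => ?_
  exact (ContinuousLinearMap.contDiff _).contMDiff.contMDiffAt.comp x (h (b i))

section Surjectivity

variable {B F M E : Type*}
  [NormedAddCommGroup B] [NormedSpace ℝ B] [NormedAddCommGroup F] [NormedSpace ℝ F]
  [TopologicalSpace M] [ChartedSpace B M] [TopologicalSpace E] [ChartedSpace (B × F) E]
  [FiniteDimensional ℝ B] [FiniteDimensional ℝ F] [IsManifold 𝓘(ℝ, B × F) ∞ E]
  {π : FibredManifold B F M E} {r p l : ℕ}

/-- The total derivatives in a chart of a linear family of vertical fields. -/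
def evoMatrix {W : Type*} [NormedAddCommGroup W] [NormedSpace ℝ W] [FiniteDimensional ℝ W]
    (c : AdaptedChart π) (R : W →ₗ[ℝ] VertField π) (η : Jet π r) :
    W →L[ℝ] ((k : Fin (r + 1)) → SymMul B F k) :=
  LinearMap.toContinuousLinearMap
    (LinearMap.snd ℝ B _ ∘ₗ (c.dCoord η).toLinearMap ∘ₗ evoL η ∘ₗ R)

theorem evoMatrix_apply {W : Type*} [NormedAddCommGroup W] [NormedSpace ℝ W]
    [FiniteDimensional ℝ W] (c : AdaptedChart π) (R : W →ₗ[ℝ] VertField π) {η : Jet π r}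
    (h : η.toE ∈ c.tot.source) (w : W) :
    evoMatrix c R η w = c.evoCoord (R w) (c.jetCoord r η) :=
  congrArg Prod.snd (dCoord_evo c (R w) h)

theorem contMDiffAt_evoMatrix {W : Type*} [NormedAddCommGroup W] [NormedSpace ℝ W]
    [FiniteDimensional ℝ W] (c : AdaptedChart π) (R : W →ₗ[ℝ] VertField π) {η : Jet π r}
    (h : η.toE ∈ c.tot.source) :
    ContMDiffAt 𝓘(ℝ, JetModel B F r) 𝓘(ℝ, W →L[ℝ] ((k : Fin (r + 1)) → SymMul B F k)) ∞
      (evoMatrix c R) η := by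
  refine contMDiffAt_of_forall_apply fun w => ?_
  refine (contMDiffAt_evoCoord c (R w) h).congr_of_eventuallyEq ?_
  filter_upwards [(c.isOpen_jetSource r).mem_nhds h] with η' h'
  exact evoMatrix_apply c R h' w

/-- The fields are those with polynomial coefficients centred at the base point of η: at η the total
derivatives are the prescribed derivatives. -/
theorem exists_evoMatrix_eq_one [T2Space E] (c : AdaptedChart π) {η : Jet π r}
    (h : η.toE ∈ c.tot.source) :
    ∃ R : ((k : Fin (r + 1)) → SymMul B F k) →ₗ[ℝ] VertField π, evoMatrix c R η = 1 := by
  obtain ⟨χ, h1, h2, h3⟩ := exists_smooth_cutoff 𝓘(ℝ, B × F) (c.tot.open_source.mem_nhds h)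
  refine ⟨c.polyField h1 h2 r (c.base η.base), ?_⟩
  ext1 w
  rw [evoMatrix_apply c _ h]
  refine funext fun k => SymMul.incl_injective k ?_
  refine (c.coe_evoCoord_jetCoord _ h k).trans ?_
  have e2 := c.fieldRep_mkField_eventuallyEq h1 h2 (poly (c.base η.base, w)) (contDiff_poly _)
    η.rep.sec η.rep.mem h h3
  refine (e2.iteratedFDeriv ℝ k).eq_of_nhds.trans ?_
  exact iteratedFDeriv_poly (c.base η.base, w) k

/-- The contact form `χ · ε(N ω, …, N ω)` (with reversed arguments), where `ω` are the components
of the vertical projection in a chart. -/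
def mkContact (c : AdaptedChart π) (χ : Jet π r → ℝ)
    (N : Jet π r → ((k : Fin (r + 1)) → SymMul B F k) →L[ℝ] ((k : Fin (r + 1)) → SymMul B F k))
    (ε : ((k : Fin (r + 1)) → SymMul B F k) [⋀^Fin p]→ₗ[ℝ] ℝ) : RelForm π r p := fun θ =>
  χ θ.proj • ((ε.domDomCongr Fin.revPerm).compLinearMap
    ((N θ.proj).toLinearMap ∘ₗ LinearMap.snd ℝ B _ ∘ₗ (c.dCoord θ.proj).toLinearMap ∘ₗ ver θ))

theorem mkContact_apply (c : AdaptedChart π) (χ : Jet π r → ℝ)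
    (N : Jet π r → ((k : Fin (r + 1)) → SymMul B F k) →L[ℝ] ((k : Fin (r + 1)) → SymMul B F k))
    (ε : ((k : Fin (r + 1)) → SymMul B F k) [⋀^Fin p]→ₗ[ℝ] ℝ) (θ : Jet π (r + 1))
    {v : Fin p → TJet θ.proj} (hv : ∀ i, v i ∈ LinearMap.range (ver θ)) :
    mkContact c χ N ε θ v =
      χ θ.proj • ε (fun i => N θ.proj (c.dCoord θ.proj (v i.rev)).2) := by
  have h : ∀ i, ver θ (v i) = v i := fun i =>
    (ver_eq_self_iff θ _).2 ((mem_range_ver_iff θ _).1 (hv i))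
  change χ θ.proj • ε (fun i => N θ.proj (c.dCoord θ.proj (ver θ (v i.rev))).2) = _
  simp only [h]

theorem mkContact_mem_contactForms (c : AdaptedChart π) {χ : Jet π r → ℝ}
    (hχ : ContMDiff 𝓘(ℝ, JetModel B F r) 𝓘(ℝ, ℝ) ∞ χ)
    (hs : tsupport χ ⊆ {η | η.toE ∈ c.tot.source})
    {N : Jet π r → ((k : Fin (r + 1)) → SymMul B F k) →L[ℝ] ((k : Fin (r + 1)) → SymMul B F k)}
    (hN : ∀ η ∈ tsupport χ, ContMDiffAt 𝓘(ℝ, JetModel B F r)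
      𝓘(ℝ, ((k : Fin (r + 1)) → SymMul B F k) →L[ℝ] ((k : Fin (r + 1)) → SymMul B F k)) ∞ N η)
    (ε : ((k : Fin (r + 1)) → SymMul B F k) [⋀^Fin p]→ₗ[ℝ] ℝ) :
    mkContact c χ N ε ∈ contactForms π r p := by
  refine ⟨fun θ => ?_, fun η₁ w => ?_⟩
  · ext v
    have h : ∀ i, ver θ (ver θ (v i)) = ver θ (v i) := fun i => ver_ver θ _
    change χ θ.proj • ε (fun i => N θ.proj (c.dCoord θ.proj (ver θ (v i.rev))).2) =
      χ θ.proj • ε (fun i => N θ.proj (c.dCoord θ.proj (ver θ (ver θ (v i.rev)))).2)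
    simp only [h]
  · let c₁ := adaptedChartAt π η₁.toE
    have h₁ : η₁.toE ∈ c₁.tot.source := mem_adaptedChartAt π η₁.toE
    refine ⟨fun η => χ η • ε (fun i => N η (c.dCoord η (coordVec η₁ η (0, w i.rev))).2), ?_, ?_⟩
    -- On the support of χ the chart c and the matrix N are smooth; off the support the form
    -- vanishes near η₁, whatever N is there.
    · by_cases hη : η₁ ∈ tsupport χ
      · have hc : η₁.toE ∈ c.tot.source := hs hη
        refine (hχ η₁).smul (contMDiffAt_multilinear_apply
          (A := fun _ => ε.toMultilinearMap) (fun _ => contMDiffAt_const) fun i => ?_)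
        refine (hN η₁ hη).clm_apply ?_
        have h2 : ContMDiffAt 𝓘(ℝ, JetModel B F r) 𝓘(ℝ, JetModel B F r) ∞
            (fun q => fderiv ℝ (AdaptedChart.transMap c₁ c r) q (0, w i.rev))
            (c₁.jetCoord r η₁) :=
          (((c₁.contDiffAt_transMap_jetCoord c h₁ hc).fderiv_right (m := ∞) (by simp)).clm_apply
            contDiffAt_const).contMDiffAt
        have h3 : ContMDiffAt 𝓘(ℝ, JetModel B F r) 𝓘(ℝ, (k : Fin (r + 1)) → SymMul B F k) ∞
            (fun η : Jet π r =>
              (fderiv ℝ (AdaptedChart.transMap c₁ c r) (c₁.jetCoord r η) (0, w i.rev)).2) η₁ :=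
          ((ContinuousLinearMap.snd ℝ B ((k : Fin (r + 1)) →
            SymMul B F k)).contDiff.contMDiff.contMDiffAt).comp η₁
            (h2.comp η₁ (c₁.contMDiffAt_jetCoord h₁))
        refine h3.congr_of_eventuallyEq ?_
        filter_upwards [(c.isOpen_jetSource r).mem_nhds hc, (c₁.isOpen_jetSource r).mem_nhds h₁]
          with η h4 h5
        exact congrArg Prod.snd (dCoord_coordVec' h5 c h4 _)
      · refine (contMDiffAt_const (c := (0 : ℝ))).congr_of_eventuallyEq ?_
        filter_upwards [notMem_tsupport_iff_eventuallyEq.1 hη] with η h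
        rw [h]
        exact zero_smul _ _
    · filter_upwards [(c₁.isOpen_jetSource r).mem_nhds h₁] with η h θ hθ
      subst hθ
      refine mkContact_apply c χ N ε θ fun i => ?_
      have h' : θ.toE ∈ c₁.tot.source := by
        rw [← toE_proj]; exact h
      rw [mem_range_ver_iff_coord c₁ θ h', dCoord_coordVec h]

theorem span_wedge_le_contactBar :
    Submodule.span (JetFun π r)
      {δ | ∃ γ ∈ contactForms π r p, ∃ β ∈ barForms π r l, δ = wedge γ β} ≤
    contactBar π r p l := fun _ h _ => ⟨_, h, Eventually.of_forall fun _ _ _ => rfl⟩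

theorem nabla_sum {ι : Type*} (t : Finset ι) (α : ι → RelForm π r (l + p))
    (φ : Fin p → VertField π) (θ : Jet π (r + 1)) :
    nabla (∑ j ∈ t, α j) φ θ = ∑ j ∈ t, nabla (α j) φ θ := by
  have h := map_sum (contractL p l fun i => Evo (φ i) θ.proj) (fun j => α j θ) t
  refine Eq.trans ?_ h
  exact congrArg (contractL p l fun i => Evo (φ i) θ.proj) (Finset.sum_apply θ t α)

/-- Near η₀ the fields R w have evolutionary fields forming a frame of the vertical vectors. Each
φ_i may be replaced at θ by the member of the family with the same evolutionary vector, and on the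
family Δ is a sum of ε_j n_j with fixed barred forms n_j. The contact factors are the ε_j applied to
the frame coordinates of vertical vectors. -/
theorem exists_local_form [T2Space E] {Δ : VertField π [⋀^Fin p]→ₗ[ℝ] barForms π r l}
    (hΔ : Δ ∈ CDiffAlt π r p l) (η₀ : Jet π r) :
    ∃ α ∈ Submodule.span (JetFun π r)
      {δ | ∃ γ ∈ contactForms π r p, ∃ β ∈ barForms π r l, δ = wedge γ β},
      ∀ᶠ η in 𝓝 η₀, ∀ θ : Jet π (r + 1), θ.proj = η → ∀ φ, nabla α φ θ = (Δ φ).1 θ := by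
  let c := adaptedChartAt π η₀.toE
  have h₀ : η₀.toE ∈ c.tot.source := mem_adaptedChartAt π η₀.toE
  obtain ⟨R, hR⟩ := exists_evoMatrix_eq_one c h₀
  let U : Set (Jet π r) := {η | η.toE ∈ c.tot.source} ∩ {η | IsUnit (evoMatrix c R η)}
  have hcomp : CompleteSpace ((k : Fin (r + 1)) → SymMul B F k) := FiniteDimensional.complete ℝ _
  have hU : U ∈ 𝓝 η₀ := by
    refine inter_mem ((c.isOpen_jetSource r).mem_nhds h₀) ?_
    refine (contMDiffAt_evoMatrix c R h₀).continuousAt.eventually (p := IsUnit) ?_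
    refine Units.isOpen.mem_nhds ?_
    change IsUnit (evoMatrix c R η₀)
    rw [hR]
    exact isUnit_one
  obtain ⟨χ, h1, h2, h3⟩ := exists_smooth_cutoff 𝓘(ℝ, JetModel B F r) hU
  let N : Jet π r → ((k : Fin (r + 1)) → SymMul B F k) →L[ℝ] ((k : Fin (r + 1)) → SymMul B F k) :=
    -- The inverse matrix gives the frame coordinates of a vertical vector. It is meaningful on U
    -- only; elsewhere `Ring.inverse` is a default value, hidden by the cut-off χ.
    fun η => Ring.inverse (evoMatrix c R η)
  have hN : ∀ η ∈ tsupport χ, ContMDiffAt 𝓘(ℝ, JetModel B F r)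
      𝓘(ℝ, ((k : Fin (r + 1)) → SymMul B F k) →L[ℝ] ((k : Fin (r + 1)) → SymMul B F k)) ∞ N η := by
    intro η hη
    obtain ⟨u, hu⟩ := (h2 hη).2
    have h4 := contDiffAt_ringInverse (n := ∞) ℝ u
    rw [hu] at h4
    exact h4.contMDiffAt.comp η (contMDiffAt_evoMatrix c R (h2 hη).1)
  have hs : tsupport χ ⊆ {η | η.toE ∈ c.tot.source} := fun η hη => (h2 hη).1
  obtain ⟨d, ε, n, hsum⟩ := exists_alternatingMap_eq_sum (Δ.compLinearMap R)
  refine ⟨∑ j, wedge (mkContact c χ N (ε j)) (n j).1, Submodule.sum_mem _ fun j _ =>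
    Submodule.subset_span ⟨_, mkContact_mem_contactForms c h1 hs hN (ε j), _, (n j).2, rfl⟩, ?_⟩
  filter_upwards [h3, hU] with η hχ hη θ hθ φ
  subst hθ
  let w : Fin p → (k : Fin (r + 1)) → SymMul B F k := fun i =>
    N θ.proj (c.dCoord θ.proj (Evo (φ i) θ.proj)).2
  -- The matrix times its inverse is 1, so R (w i) and φ i have the same evolutionary vector at this
  -- point. For each θ the fields R (w i) are again global vertical fields, as Δ requires.
  have e1 : (Δ φ).1 θ = (Δ fun i => R (w i)).1 θ := by
    refine apply_congr_of_evo_eq hΔ θ fun i => (c.dCoord_bijective hη.1).1 ?_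
    have h5 : evoMatrix c R θ.proj (w i) = (c.dCoord θ.proj (Evo (φ i) θ.proj)).2 :=
      congrArg (fun L : ((k : Fin (r + 1)) → SymMul B F k) →L[ℝ]
        ((k : Fin (r + 1)) → SymMul B F k) => L _) (Ring.mul_inverse_cancel _ hη.2)
    refine Prod.ext ?_ h5.symm
    rw [dCoord_evo c _ hη.1, dCoord_evo c _ hη.1]
  have e2 : (Δ fun i => R (w i)).1 θ = ∑ j, ε j w • (n j).1 θ := by
    have h6 := congrArg (fun β : barForms π r l => β.1 θ) (hsum w)
    refine h6.trans ?_
    let ev : barForms π r l →ₗ[ℝ] (TJet θ.proj [⋀^Fin l]→ₗ[ℝ] ℝ) :=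
      { toFun := fun β => β.1 θ, map_add' := fun _ _ => rfl, map_smul' := fun _ _ => rfl }
    exact (map_sum ev _ _).trans (Finset.sum_congr rfl fun j _ => ev.map_smul (ε j w) (n j))
  rw [e1, e2, nabla_sum]
  refine Finset.sum_congr rfl fun j _ => ?_
  rw [nabla_wedge _ (n j).2, mkContact_apply c χ N (ε j) θ fun i => evo_mem_range_ver _ θ]
  have h7 : χ θ.proj = 1 := hχ
  rw [h7, one_smul]
  -- The reversal built into `mkContact` cancels the one produced by contraction.
  simp only [Fin.rev_rev]
  rfl

/-- At θ take the value of the local form chosen for the projection of θ. Near η₀ it coincides with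
the local form chosen for η₀, since both have the same contractions; hence membership, being local,
holds without a partition of unity. -/
theorem exists_nabla_eq [T2Space E] {Δ : VertField π [⋀^Fin p]→ₗ[ℝ] barForms π r l}
    (hΔ : Δ ∈ CDiffAlt π r p l) : ∃ α ∈ contactBar π r p l, ∀ φ, nabla α φ = (Δ φ).1 := by
  choose α hα e using exists_local_form hΔ
  refine ⟨fun θ => α θ.proj θ, fun η₀ => ⟨α η₀, hα η₀, ?_⟩, fun φ => funext fun θ => ?_⟩
  · filter_upwards [e η₀] with η h θ hθ
    have h1 := eq_zero_of_nabla_eq_zero (α := α θ.proj - α η₀)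
      (mem_biForms_of_mem_contactBar
        (span_wedge_le_contactBar (sub_mem (hα θ.proj) (hα η₀))) θ) fun φ => by
      have h2 := (contractL p l fun i => Evo (φ i) θ.proj).map_sub (α θ.proj θ) (α η₀ θ)
      refine h2.trans (sub_eq_zero.2 ?_)
      exact ((e θ.proj).self_of_nhds θ rfl φ).trans (h θ hθ φ).symm
    exact sub_eq_zero.1 h1
  · exact (e θ.proj).self_of_nhds θ rfl φ

theorem nablaHom_surjective [T2Space E] [SecondCountableTopology E] :
    Function.Surjective (nablaHom : contactBar π r p l →ₗ[JetFun π r] CDiffAlt π r p l) := by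
  intro Δ
  obtain ⟨α, hα, h⟩ := exists_nabla_eq Δ.2
  exact ⟨⟨α, hα⟩, Subtype.ext (AlternatingMap.ext fun φ => Subtype.ext (h φ))⟩

end Surjectivity
end FiniteJet

namespace FiniteJet

/-! ### Pull-back of charts and jets along an isomorphism -/

section Algebra

variable {V V' : Type*} [AddCommGroup V] [Module ℝ V] [AddCommGroup V'] [Module ℝ V']

theorem contract_compLinearMap {p l : ℕ} (a : V' [⋀^Fin (l + p)]→ₗ[ℝ] ℝ) (T : V →ₗ[ℝ] V')
    (v : Fin p → V) : contract p (a.compLinearMap T) v =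
      (contract p a fun i => T (v i)).compLinearMap T := by
  ext w
  rw [AlternatingMap.compLinearMap_apply, contract_apply, contract_apply,
    AlternatingMap.compLinearMap_apply]
  congr 1
  funext k
  rcases (finSumFinEquiv.trans (finCongr (Nat.add_comm p l))).symm k with j | j <;> rfl

theorem wedgeAt_compLinearMap {p l : ℕ} (g : V' [⋀^Fin p]→ₗ[ℝ] ℝ) (h : V' [⋀^Fin l]→ₗ[ℝ] ℝ)
    (T : V →ₗ[ℝ] V') : (wedgeAt g h).compLinearMap T =
      wedgeAt (g.compLinearMap T) (h.compLinearMap T) := by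
  ext w
  have key : ∀ u : Fin p ⊕ Fin l → V,
      g.domCoprod h (fun k => T (u k)) = (g.compLinearMap T).domCoprod (h.compLinearMap T) u := by
    intro u
    change (∑ σ, AlternatingMap.domCoprod.summand g h σ) _ =
      (∑ σ, AlternatingMap.domCoprod.summand (g.compLinearMap T) (h.compLinearMap T) σ) u
    rw [sum_apply, sum_apply]
    refine Finset.sum_congr rfl fun σ _ => ?_
    induction σ using Quotient.inductionOn' with | _ σ => ?_
    rfl
  exact congrArg (LinearMap.mul' ℝ ℝ) (key _)

end Algebra

section Naturality

variable {B F M E E' : Type*}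
  [NormedAddCommGroup B] [NormedSpace ℝ B] [NormedAddCommGroup F] [NormedSpace ℝ F]
  [TopologicalSpace M] [ChartedSpace B M] [TopologicalSpace E] [ChartedSpace (B × F) E]
  [TopologicalSpace E'] [ChartedSpace (B × F) E']
  [FiniteDimensional ℝ B] [FiniteDimensional ℝ F] [IsManifold 𝓘(ℝ, B × F) ∞ E]
  [IsManifold 𝓘(ℝ, B × F) ∞ E']
  {π : FibredManifold B F M E} {π' : FibredManifold B F M E'} {r p l : ℕ}

namespace FibredIso

/-- The pull-back of an adapted chart along an isomorphism. -/
def pullChart (Ψ : FibredIso π π') (c : AdaptedChart π') : AdaptedChart π where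
  tot := Ψ.diffeo.toHomeomorph.toOpenPartialHomeomorph ≫ₕ c.tot
  base := c.base
  tot_mem := by
    rw [IsManifold.maximalAtlas, mem_maximalAtlas_iff]
    intro e he
    have h1 := contMDiffOn_of_mem_maximalAtlas
      (IsManifold.subset_maximalAtlas (I := 𝓘(ℝ, B × F)) (n := ∞) he)
    have h2 := contMDiffOn_symm_of_mem_maximalAtlas
      (IsManifold.subset_maximalAtlas (I := 𝓘(ℝ, B × F)) (n := ∞) he)
    have h3 := contMDiffOn_of_mem_maximalAtlas c.tot_mem
    have h4 := contMDiffOn_symm_of_mem_maximalAtlas c.tot_mem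
    have h5 : ContMDiffOn 𝓘(ℝ, B × F) 𝓘(ℝ, B × F) ∞
        (fun q => e (Ψ.diffeo.symm (c.tot.symm q)))
        (((Ψ.diffeo.toHomeomorph.toOpenPartialHomeomorph ≫ₕ c.tot).symm ≫ₕ e).source) := by
      refine h1.comp (Ψ.diffeo.symm.contMDiff.comp_contMDiffOn (h4.mono fun q hq => ?_))
        fun q hq => ?_
      · simpa using hq.1
      · exact hq.2
    have h6 : ContMDiffOn 𝓘(ℝ, B × F) 𝓘(ℝ, B × F) ∞
        (fun q => c.tot (Ψ.diffeo (e.symm q)))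
        ((e.symm ≫ₕ (Ψ.diffeo.toHomeomorph.toOpenPartialHomeomorph ≫ₕ c.tot)).source) := by
      refine h3.comp (Ψ.diffeo.contMDiff.comp_contMDiffOn (h2.mono fun q hq => ?_))
        fun q hq => ?_
      · exact hq.1
      · simpa using hq.2
    have key : ∀ u : OpenPartialHomeomorph (B × F) (B × F), ContDiffOn ℝ ∞ u u.source →
        ContDiffOn ℝ ∞ u.symm u.target → u ∈ contDiffGroupoid ∞ 𝓘(ℝ, B × F) := fun u hu hu' => by
      rw [contDiffGroupoid, mem_groupoid_of_pregroupoid]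
      simpa [contDiffPregroupoid] using And.intro hu hu'
    exact ⟨key _ h5.contDiffOn h6.contDiffOn, key _ h6.contDiffOn h5.contDiffOn⟩
  base_mem := c.base_mem
  proj_mem y hy := by
    rw [← Ψ.proj_apply]
    exact c.proj_mem _ (by simpa using hy)
  base_proj y hy := by
    rw [← Ψ.proj_apply]
    exact c.base_proj _ (by simpa using hy)

theorem mem_pullChart_source (Ψ : FibredIso π π') (c : AdaptedChart π') (y : E) :
    y ∈ (Ψ.pullChart c).tot.source ↔ Ψ.diffeo y ∈ c.tot.source := by
  simp [pullChart]

/-- The components of the image section in c are by construction those of the original section in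
the pulled-back chart. -/
theorem jetEquiv_mapSection (Ψ : FibredIso π π') {a b : PointedSection π} (h : JetEquiv r a b) :
    JetEquiv r (Ψ.mapSection a) (Ψ.mapSection b) :=
  ⟨h.1, congrArg Ψ.diffeo h.2.1, fun c hc k hk =>
    h.2.2 (Ψ.pullChart c) ((Ψ.mem_pullChart_source c _).2 hc) k hk⟩

theorem jetMap_jetMk (Ψ : FibredIso π π') (a : PointedSection π) :
    Ψ.jetMap r (jetMk r a) = jetMk r (Ψ.mapSection a) :=
  Quotient.sound (s := jetSetoid π' r) (Ψ.jetEquiv_mapSection (rep_jetMk a))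

theorem proj_jetMap (Ψ : FibredIso π π') (θ : Jet π (r + 1)) :
    (Ψ.jetMap (r + 1) θ).proj = Ψ.jetMap r θ.proj :=
  (proj_jetMk _).trans (Ψ.jetMap_jetMk θ.rep).symm

theorem toE_jetMap (Ψ : FibredIso π π') (η : Jet π r) :
    (Ψ.jetMap r η).toE = Ψ.diffeo η.toE := toE_jetMk r _

theorem toE_jetMap_mem (Ψ : FibredIso π π') (c : AdaptedChart π') {η : Jet π r} :
    (Ψ.jetMap r η).toE ∈ c.tot.source ↔ η.toE ∈ (Ψ.pullChart c).tot.source := by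
  rw [toE_jetMap, mem_pullChart_source]

/-- In corresponding charts the prolongation is the identity map; its smoothness and its
differential are read off from this. -/
theorem jetCoord_jetMap (Ψ : FibredIso π π') (c : AdaptedChart π') {η : Jet π r}
    (h : η.toE ∈ (Ψ.pullChart c).tot.source) :
    c.jetCoord r (Ψ.jetMap r η) = (Ψ.pullChart c).jetCoord r η :=
  c.jetCoord_jetMk r (Ψ.mapSection η.rep) ((Ψ.mem_pullChart_source c _).1 h)

theorem contMDiff_jetMap (Ψ : FibredIso π π') :
    ContMDiff 𝓘(ℝ, JetModel B F r) 𝓘(ℝ, JetModel B F r) ∞ (Ψ.jetMap r) := by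
  intro η
  let c := adaptedChartAt π' (Ψ.jetMap r η).toE
  have h' : (Ψ.jetMap r η).toE ∈ c.tot.source := mem_adaptedChartAt π' _
  have h := (Ψ.toE_jetMap_mem c).1 h'
  have h1 : ContMDiffAt 𝓘(ℝ, JetModel B F r) 𝓘(ℝ, JetModel B F r) ∞
      (c.jetHomeo r (Ψ.jetMap r η)).symm ((Ψ.pullChart c).jetCoord r η) := by
    rw [← Ψ.jetCoord_jetMap c h]
    exact contMDiffAt_symm_of_mem_maximalAtlas (c.jetHomeo_mem_maximalAtlas r _)
      ((c.jetHomeo r (Ψ.jetMap r η)).map_source h')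
  refine (h1.comp η ((Ψ.pullChart c).contMDiffAt_jetCoord h)).congr_of_eventuallyEq ?_
  filter_upwards [((Ψ.pullChart c).isOpen_jetSource r).mem_nhds h] with η₁ h₁
  simp only [Function.comp_apply]
  rw [← Ψ.jetCoord_jetMap c h₁, ← c.coe_jetHomeo r (Ψ.jetMap r η)]
  exact ((c.jetHomeo r (Ψ.jetMap r η)).left_inv ((Ψ.toE_jetMap_mem c).2 h₁)).symm

/-- The differential of the prolongation of an isomorphism. -/
def tMap (Ψ : FibredIso π π') (η : Jet π r) : TJet η →ₗ[ℝ] TJet (Ψ.jetMap r η) :=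
  (mfderiv 𝓘(ℝ, JetModel B F r) 𝓘(ℝ, JetModel B F r) (Ψ.jetMap r) η).toLinearMap

theorem dCoord_tMap (Ψ : FibredIso π π') (c : AdaptedChart π') {η : Jet π r}
    (h : η.toE ∈ (Ψ.pullChart c).tot.source) (v : TJet η) :
    c.dCoord (Ψ.jetMap r η) (Ψ.tMap η v) = (Ψ.pullChart c).dCoord η v := by
  have h1 := ((c.contMDiffAt_jetCoord ((Ψ.toE_jetMap_mem c).2 h)).mdifferentiableAt
    (by simp)).hasMFDerivAt.comp η ((Ψ.contMDiff_jetMap η).mdifferentiableAt (by simp)).hasMFDerivAt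
  have h2 := (((Ψ.pullChart c).contMDiffAt_jetCoord h).mdifferentiableAt (by simp)).hasMFDerivAt
  have e : c.jetCoord r ∘ Ψ.jetMap r =ᶠ[𝓝 η] (Ψ.pullChart c).jetCoord r := by
    filter_upwards [((Ψ.pullChart c).isOpen_jetSource r).mem_nhds h] with η₁ h₁
    exact Ψ.jetCoord_jetMap c h₁
  exact congrArg (fun L : TJet η →L[ℝ] JetModel B F r => L v)
    (hasMFDerivAt_unique h1 (h2.congr_of_eventuallyEq e))

/-- The differential of `J^r Ψ` at the projection of a point of `J^{r+1} π`. -/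
def tMapProj (Ψ : FibredIso π π') (θ : Jet π (r + 1)) :
    TJet θ.proj →ₗ[ℝ] TJet (Ψ.jetMap (r + 1) θ).proj :=
  (mfderiv 𝓘(ℝ, JetModel B F r) 𝓘(ℝ, JetModel B F r) (Ψ.jetMap r) θ.proj).toLinearMap

theorem pullback_apply (Ψ : FibredIso π π') {k : ℕ} (α : RelForm π' r k) (θ : Jet π (r + 1)) :
    Ψ.pullback α θ = (α (Ψ.jetMap (r + 1) θ)).compLinearMap (Ψ.tMapProj θ) := rfl

theorem dCoord_tMapProj (Ψ : FibredIso π π') (c : AdaptedChart π') {θ : Jet π (r + 1)}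
    (h : θ.toE ∈ (Ψ.pullChart c).tot.source) (v : TJet θ.proj) :
    c.dCoord (Ψ.jetMap (r + 1) θ).proj (Ψ.tMapProj θ v) = (Ψ.pullChart c).dCoord θ.proj v := by
  -- Projection and prolongation commute only propositionally, so the coordinate differential has to
  -- be carried from one name of the point to the other.
  have h5 : ∀ (η η' : Jet π' r) (_ : η = η') (v : JetModel B F r),
      c.dCoord η v = c.dCoord η' v := by rintro _ _ rfl _; rfl
  exact (h5 _ _ (Ψ.proj_jetMap θ) _).trans (Ψ.dCoord_tMap c (by rwa [toE_proj]) v)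

theorem dCoord_tMapProj_injective (Ψ : FibredIso π π') (c : AdaptedChart π') {θ : Jet π (r + 1)}
    (h : θ.toE ∈ (Ψ.pullChart c).tot.source) :
    Function.Injective (c.dCoord (Ψ.jetMap (r + 1) θ).proj) := by
  refine (c.dCoord_bijective ?_).1
  rw [toE_proj]
  exact (Ψ.toE_jetMap_mem c).2 h

/-- Differentiating the coordinates of the r-jet along a section yields its derivatives up to order
r + 1, hence depends only on the (r+1)-jet. This is needed because the representative of the image
jet need not be the image of the chosen representative. -/
theorem fderiv_secCoord_congr (c : AdaptedChart π) {a b : PointedSection π}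
    (h : JetEquiv (r + 1) a b) (ha : a.sec.toFun a.pt ∈ c.tot.source) :
    fderiv ℝ (c.secCoord r a.sec) (c.base a.pt) = fderiv ℝ (c.secCoord r b.sec) (c.base b.pt) := by
  have key : ∀ (a : PointedSection π) (_ : a.sec.toFun a.pt ∈ c.tot.source) (v : B),
      (fderiv ℝ (c.secCoord r a.sec) (c.base a.pt) v).1 = v ∧ ∀ k : Fin (r + 1),
      ∀ m : Fin k → B, ((fderiv ℝ (c.secCoord r a.sec) (c.base a.pt) v).2 k).incl m =
        iteratedFDeriv ℝ (k + 1) (c.rep a.sec) (c.base a.pt) (Fin.cons v m) := by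
    intro a ha v
    have h1 := ((c.contDiffAt_secCoord (r := r) a.sec a.mem ha).differentiableAt
      (by simp)).hasFDerivAt
    have h0 := c.contDiffAt_rep a.sec a.mem ha
    constructor
    · have h2 : HasFDerivAt (fun z => (c.secCoord r a.sec z).1) (ContinuousLinearMap.id ℝ B)
        (c.base a.pt) := hasFDerivAt_id _
      exact congrArg (fun L : B →L[ℝ] B => L v) (h1.fst.unique h2)
    · intro k m
      let L : JetModel B F r →L[ℝ] F := (ContinuousMultilinearMap.apply ℝ (fun _ : Fin k => B) F m)
        ∘L (SymMul.inclL (k : ℕ) ∘L (ContinuousLinearMap.proj k ∘L ContinuousLinearMap.snd ℝ B _))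
      have h2 := L.hasFDerivAt.comp (c.base a.pt) h1
      have e : L ∘ c.secCoord r a.sec =ᶠ[𝓝 (c.base a.pt)]
          fun z => iteratedFDeriv ℝ k (c.rep a.sec) z m := by
        have hk : ∀ᶠ y in 𝓝 (c.base a.pt), ContDiffAt ℝ (k : ℕ) (c.rep a.sec) y :=
          (h0.of_le (by exact_mod_cast le_top : ((k : ℕ) : WithTop ℕ∞) ≤ ∞)).eventually (by simp)
        filter_upwards [hk] with y hy
        exact congrArg (fun L : B [×k]→L[ℝ] F => L m)
          (coe_toSym fun σ v => iteratedFDeriv_comp_perm' k hy σ v)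
      have h3 := (h2.congr_of_eventuallyEq e.symm).fderiv
      have h4 := iteratedFDeriv_succ_eval (k : ℕ) (c.base a.pt)
        (h0.of_le (by exact_mod_cast le_top)) (Fin.cons v m)
      rw [Fin.tail_cons, Fin.cons_zero, h3] at h4
      exact h4.symm
  have hb : b.sec.toFun b.pt ∈ c.tot.source := by rw [← h.2.1]; exact ha
  ext1 v
  refine Prod.ext ((key a ha v).1.trans (key b hb v).1.symm)
    (funext fun k => SymMul.incl_injective k (ContinuousMultilinearMap.ext fun m => ?_))
  rw [(key a ha v).2 k m, (key b hb v).2 k m, h.2.2 c ha _ k.2]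

theorem tMapProj_hor (Ψ : FibredIso π π') (θ : Jet π (r + 1)) (v : TJet θ.proj) :
    hor (Ψ.jetMap (r + 1) θ) (Ψ.tMapProj θ v) = Ψ.tMapProj θ (hor θ v) := by
  let c := adaptedChartAt π' (Ψ.jetMap (r + 1) θ).toE
  have h' : (Ψ.jetMap (r + 1) θ).toE ∈ c.tot.source := mem_adaptedChartAt π' _
  have h := (Ψ.toE_jetMap_mem c).1 h'
  apply Ψ.dCoord_tMapProj_injective c h
  rw [dCoord_hor c _ h', Ψ.dCoord_tMapProj c h, Ψ.dCoord_tMapProj c h, dCoord_hor _ θ h]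
  exact congrArg (fun L : B →L[ℝ] JetModel B F r => L _)
    (fderiv_secCoord_congr c (rep_jetMk (r := r + 1) (Ψ.mapSection θ.rep)) h')

theorem tMapProj_ver (Ψ : FibredIso π π') (θ : Jet π (r + 1)) (v : TJet θ.proj) :
    ver (Ψ.jetMap (r + 1) θ) (Ψ.tMapProj θ v) = Ψ.tMapProj θ (ver θ v) := by
  rw [ver_apply, ver_apply, map_sub, tMapProj_hor]

theorem dTot_pullChart (Ψ : FibredIso π π') (c : AdaptedChart π') {y : E}
    (h : y ∈ (Ψ.pullChart c).tot.source) (v : TangentSpace 𝓘(ℝ, B × F) y) :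
    (Ψ.pullChart c).dTot y v =
      c.dTot (Ψ.diffeo y) (mfderiv 𝓘(ℝ, B × F) 𝓘(ℝ, B × F) Ψ.diffeo y v) := by
  have h1 := ((c.contMDiffAt_tot ((Ψ.mem_pullChart_source c y).1 h)).mdifferentiableAt
    (by simp)).hasMFDerivAt.comp y ((Ψ.diffeo.contMDiff y).mdifferentiableAt (by simp)).hasMFDerivAt
  have h2 := (((Ψ.pullChart c).contMDiffAt_tot h).mdifferentiableAt (by simp)).hasMFDerivAt
  exact congrArg (fun L : TangentSpace 𝓘(ℝ, B × F) y →L[ℝ] B × F => L v)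
    (hasMFDerivAt_unique h2 h1)

/-- For related fields the components along a section in the pulled-back chart equal those along the
image section in c, so all total derivatives agree. -/
theorem evo_jetMap (Ψ : FibredIso π π') {φ : VertField π} {φ' : VertField π'}
    (hφ : Ψ.Related φ φ') (θ : Jet π (r + 1)) :
    Evo φ' (Ψ.jetMap (r + 1) θ).proj = Ψ.tMapProj θ (Evo φ θ.proj) := by
  let c := adaptedChartAt π' (Ψ.jetMap (r + 1) θ).toE
  have h' : (Ψ.jetMap (r + 1) θ).toE ∈ c.tot.source := mem_adaptedChartAt π' _
  have h := (Ψ.toE_jetMap_mem c).1 h'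
  have hp : θ.proj.toE ∈ (Ψ.pullChart c).tot.source := by rwa [toE_proj]
  apply Ψ.dCoord_tMapProj_injective c h
  rw [Ψ.dCoord_tMapProj c h, dCoord_evo c φ' (by rwa [toE_proj]), dCoord_evo _ φ hp,
    Ψ.proj_jetMap, Ψ.jetCoord_jetMap c hp]
  refine Prod.ext rfl (funext fun k => SymMul.incl_injective k ?_)
  have e1 : (Ψ.pullChart c).jetCoord r θ.proj = (Ψ.pullChart c).coords r θ.rep :=
    (Ψ.pullChart c).jetCoord_jetMk r θ.rep h
  rw [e1]
  have h2 := c.coe_evoCoord (r := r) φ' (Ψ.mapSection θ.rep) ((Ψ.mem_pullChart_source c _).1 h) k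
  refine h2.trans (Eq.trans ?_ ((Ψ.pullChart c).coe_evoCoord φ θ.rep h k).symm)
  have e2 : fieldRep c φ' (Ψ.mapSection θ.rep).sec =ᶠ[𝓝 (c.base θ.rep.pt)]
      fieldRep (Ψ.pullChart c) φ θ.rep.sec := by
    filter_upwards [(Ψ.pullChart c).eventually_symm_section θ.rep.sec θ.rep.mem h] with z hz
    refine congrArg Prod.snd (Eq.trans ?_ (Ψ.dTot_pullChart c hz.2.2 _).symm)
    exact congrArg (c.dTot _) (hφ _)
  exact (e2.iteratedFDeriv ℝ k).eq_of_nhds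

/-- Contraction commutes with pull-back once the contracted vectors are carried along by the
differential, and that differential maps evolutionary vectors to evolutionary vectors. -/
theorem pullback_nabla (Ψ : FibredIso π π') (α : RelForm π' r (l + p)) {φ : Fin p → VertField π}
    {φ' : Fin p → VertField π'} (h : ∀ i, Ψ.Related (φ i) (φ' i)) :
    Ψ.pullback (nabla α φ') = nabla (Ψ.pullback α) φ := by
  funext θ
  have h1 := contract_compLinearMap (α (Ψ.jetMap (r + 1) θ)) (Ψ.tMapProj θ)
    fun i => Evo (φ i) θ.proj
  refine Eq.trans ?_ h1.symm
  refine congrArg (fun v => (contract p (α (Ψ.jetMap (r + 1) θ)) v).compLinearMap (Ψ.tMapProj θ)) ?_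
  exact funext fun i => Ψ.evo_jetMap (h i) θ

/-! ### Pull-back of the modules of forms -/

/-- The pull-back of functions along the prolongation of an isomorphism. -/
def pullFun (Ψ : FibredIso π π') (g : JetFun π' r) : JetFun π r :=
  ⟨fun η => g (Ψ.jetMap r η), g.contMDiff.comp Ψ.contMDiff_jetMap⟩

theorem pullback_smul (Ψ : FibredIso π π') {k : ℕ} (g : JetFun π' r) (α : RelForm π' r k) :
    Ψ.pullback (g • α) = Ψ.pullFun g • Ψ.pullback α := by
  funext θ
  change (g (Ψ.jetMap (r + 1) θ).proj • α (Ψ.jetMap (r + 1) θ)).compLinearMap (Ψ.tMapProj θ) =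
    g (Ψ.jetMap r θ.proj) • (α (Ψ.jetMap (r + 1) θ)).compLinearMap (Ψ.tMapProj θ)
  rw [proj_jetMap]
  rfl

theorem pullback_wedge (Ψ : FibredIso π π') (γ : RelForm π' r p) (β : RelForm π' r l) :
    Ψ.pullback (wedge γ β) = wedge (Ψ.pullback γ) (Ψ.pullback β) :=
  funext fun θ => wedgeAt_compLinearMap (γ (Ψ.jetMap (r + 1) θ)) (β (Ψ.jetMap (r + 1) θ))
    (Ψ.tMapProj θ)

theorem tMap_coordVec (Ψ : FibredIso π π') {η₀ η : Jet π r}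
    (h : η.toE ∈ (adaptedChartAt π η₀.toE).tot.source)
    (h' : η.toE ∈ (Ψ.pullChart (adaptedChartAt π' (Ψ.jetMap r η₀).toE)).tot.source)
    (v : JetModel B F r) :
    Ψ.tMap η (coordVec η₀ η v) = coordVec (Ψ.jetMap r η₀) (Ψ.jetMap r η)
      (fderiv ℝ (AdaptedChart.transMap (adaptedChartAt π η₀.toE)
        (Ψ.pullChart (adaptedChartAt π' (Ψ.jetMap r η₀).toE)) r)
        ((adaptedChartAt π η₀.toE).jetCoord r η) v) := by
  refine eq_coordVec ((Ψ.toE_jetMap_mem _).2 h') ?_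
  rw [Ψ.dCoord_tMap _ h', dCoord_coordVec' h _ h']

theorem tMapProj_coordVec (Ψ : FibredIso π π') {η₀ : Jet π r} {θ : Jet π (r + 1)}
    (h : θ.proj.toE ∈ (adaptedChartAt π η₀.toE).tot.source)
    (h' : θ.proj.toE ∈ (Ψ.pullChart (adaptedChartAt π' (Ψ.jetMap r η₀).toE)).tot.source)
    (v : JetModel B F r) :
    Ψ.tMapProj θ (coordVec η₀ θ.proj v) =
      coordVec (Ψ.jetMap r η₀) (Ψ.jetMap (r + 1) θ).proj
        (fderiv ℝ (AdaptedChart.transMap (adaptedChartAt π η₀.toE)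
          (Ψ.pullChart (adaptedChartAt π' (Ψ.jetMap r η₀).toE)) r)
          ((adaptedChartAt π η₀.toE).jetCoord r θ.proj) v) := by
  have h5 : ∀ (η η' : Jet π' r) (_ : η = η') (v : JetModel B F r),
      (coordVec (Ψ.jetMap r η₀) η v : JetModel B F r) = coordVec (Ψ.jetMap r η₀) η' v := by
    rintro _ _ rfl _; rfl
  exact (Ψ.tMap_coordVec h h' v).trans (h5 _ _ (Ψ.proj_jetMap θ).symm _)

theorem contDiffAt_fderiv_transMap (c c' : AdaptedChart π) {η : Jet π r}
    (h : η.toE ∈ c.tot.source) (h' : η.toE ∈ c'.tot.source) (v : JetModel B F r) :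
    ContDiffAt ℝ ∞ (fun q => fderiv ℝ (AdaptedChart.transMap c c' r) q v) (c.jetCoord r η) :=
  ((c.contDiffAt_transMap_jetCoord c' h h').fderiv_right (m := ∞) (by simp)).clm_apply
    contDiffAt_const

theorem pullback_mem_contactForms (Ψ : FibredIso π π') {γ : RelForm π' r p}
    (hγ : γ ∈ contactForms π' r p) : Ψ.pullback γ ∈ contactForms π r p := by
  refine ⟨fun θ => ?_, fun η₀ w => ?_⟩
  · ext v
    change γ (Ψ.jetMap (r + 1) θ) (fun i => Ψ.tMapProj θ (v i)) =
      γ (Ψ.jetMap (r + 1) θ) (fun i => Ψ.tMapProj θ (ver θ (v i)))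
    simp only [← tMapProj_ver]
    exact congrArg (fun g => g fun i => Ψ.tMapProj θ (v i)) (hγ.1 (Ψ.jetMap (r + 1) θ))
  · let c₀ := adaptedChartAt π η₀.toE
    let c' := adaptedChartAt π' (Ψ.jetMap r η₀).toE
    let c := Ψ.pullChart c'
    have h₀ : η₀.toE ∈ c₀.tot.source := mem_adaptedChartAt π η₀.toE
    have h' : (Ψ.jetMap r η₀).toE ∈ c'.tot.source := mem_adaptedChartAt π' _
    have h : η₀.toE ∈ c.tot.source := (Ψ.toE_jetMap_mem c').1 h'
    -- The images of constant vertical vectors have the entries of a Jacobian as components. These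
    -- are functions on J^rπ, but are rewritten on J^rπ' through the inverse change of coordinates,
    -- since γ is evaluated there.
    have hm : ∀ i, ContMDiffAt 𝓘(ℝ, JetModel B F r) 𝓘(ℝ, (k : Fin (r + 1)) → SymMul B F k) ∞
        (fun η' : Jet π' r => (fderiv ℝ (AdaptedChart.transMap c₀ c r)
          (AdaptedChart.transMap c c₀ r (c'.jetCoord r η')) (0, w i)).2) (Ψ.jetMap r η₀) := by
      intro i
      have h1 : ContDiffAt ℝ ∞ (fun q => (fderiv ℝ (AdaptedChart.transMap c₀ c r)
          (AdaptedChart.transMap c c₀ r q) (0, w i)).2) (c'.jetCoord r (Ψ.jetMap r η₀)) := by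
        rw [Ψ.jetCoord_jetMap c' h]
        have h2 := contDiffAt_fderiv_transMap c₀ c h₀ h (0, w i)
        rw [c.jetCoord_trans c₀ h h₀] at h2
        exact contDiff_snd.contDiffAt.comp _
          (h2.comp _ (c.contDiffAt_transMap_jetCoord c₀ h h₀))
      exact h1.contMDiffAt.comp _ (c'.contMDiffAt_jetCoord h')
    obtain ⟨f, hf, e⟩ := exists_smooth_contactForm_apply hγ (Ψ.jetMap r η₀) hm
    refine ⟨fun η => f (Ψ.jetMap r η), hf.comp η₀ (Ψ.contMDiff_jetMap η₀), ?_⟩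
    filter_upwards [Ψ.contMDiff_jetMap.continuous.continuousAt.eventually e,
      (c₀.isOpen_jetSource r).mem_nhds h₀, (c.isOpen_jetSource r).mem_nhds h] with η e h1 h2 θ hθ
    subst hθ
    rw [← e (Ψ.jetMap (r + 1) θ) (Ψ.proj_jetMap θ)]
    refine congrArg (γ (Ψ.jetMap (r + 1) θ)) (funext fun i => ?_)
    refine (Ψ.tMapProj_coordVec h1 h2 _).trans (congrArg _ (Prod.ext ?_ ?_))
    · have h3 : θ.toE ∈ c₀.tot.source := by rw [← toE_proj]; exact h1
      have h4 : θ.toE ∈ c.tot.source := by rw [← toE_proj]; exact h2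
      -- Verticality does not depend on the chart, so the images have no dx-component.
      have h5 : coordVec η₀ θ.proj (0, w i) ∈ LinearMap.range (ver θ) := by
        rw [mem_range_ver_iff_coord c₀ θ h3, dCoord_coordVec h1]
      rw [mem_range_ver_iff_coord c θ h4, dCoord_coordVec' h1 c h2] at h5
      exact h5
    · rw [Ψ.proj_jetMap, Ψ.jetCoord_jetMap c' h2, ← c.jetCoord_trans c₀ h2 h1]

theorem pullback_mem_barForms (Ψ : FibredIso π π') {β : RelForm π' r l}
    (hβ : β ∈ barForms π' r l) : Ψ.pullback β ∈ barForms π r l := by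
  obtain ⟨b, hb, e⟩ := hβ
  -- The witness is the ordinary pull-back of the form b along J^rΨ; its horizontal part is the
  -- pull-back of β because the differential commutes with the horizontal projections.
  refine ⟨fun η => (b (Ψ.jetMap r η)).compLinearMap (Ψ.tMap η), fun η₀ v => ?_, fun θ => ?_⟩
  · let c₀ := adaptedChartAt π η₀.toE
    let c' := adaptedChartAt π' (Ψ.jetMap r η₀).toE
    let c := Ψ.pullChart c'
    have h₀ : η₀.toE ∈ c₀.tot.source := mem_adaptedChartAt π η₀.toE
    have h' : (Ψ.jetMap r η₀).toE ∈ c'.tot.source := mem_adaptedChartAt π' _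
    have h : η₀.toE ∈ c.tot.source := (Ψ.toE_jetMap_mem c').1 h'
    let T : (η : Jet π r) → JetModel B F r →ₗ[ℝ] TJet (Ψ.jetMap r η) := fun η =>
      ((trivializationAt (JetModel B F r) (TangentSpace 𝓘(ℝ, JetModel B F r) : Jet π' r → Type _)
        (Ψ.jetMap r η₀)).symmL ℝ (Ψ.jetMap r η)).toLinearMap
    have h1 := contMDiffAt_multilinear_apply (I := 𝓘(ℝ, JetModel B F r)) (x₀ := η₀)
      (A := fun η => ((b (Ψ.jetMap r η)).compLinearMap (T η)).toMultilinearMap)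
      (fun w => (hb (Ψ.jetMap r η₀) w).comp η₀ (Ψ.contMDiff_jetMap η₀))
      (m := fun i η => fderiv ℝ (AdaptedChart.transMap c₀ c r) (c₀.jetCoord r η) (v i))
      fun i => (contDiffAt_fderiv_transMap c₀ c h₀ h (v i)).contMDiffAt.comp η₀
        (c₀.contMDiffAt_jetCoord h₀)
    refine h1.congr_of_eventuallyEq ?_
    filter_upwards [(c₀.isOpen_jetSource r).mem_nhds h₀, (c.isOpen_jetSource r).mem_nhds h]
      with η h2 h3
    exact congrArg (b (Ψ.jetMap r η)) (funext fun i => Ψ.tMap_coordVec h2 h3 (v i))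
  · ext u
    rw [pullback_apply, e]
    change b (Ψ.jetMap (r + 1) θ).proj
        (fun i => hor (Ψ.jetMap (r + 1) θ) (Ψ.tMapProj θ (u i))) =
      b (Ψ.jetMap r θ.proj) fun i => Ψ.tMap θ.proj (hor θ (u i))
    simp only [tMapProj_hor]
    have h5 : ∀ (η η' : Jet π' r) (_ : η = η') (v : Fin l → JetModel B F r),
        b η v = b η' v := by rintro _ _ rfl _; rfl
    exact h5 _ _ (Ψ.proj_jetMap θ) _

/-- Pull-back respects sums and products and is semilinear over the pull-back of functions, so it
carries local sums of products to local sums of products. -/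
theorem pullback_mem_contactBar (Ψ : FibredIso π π') {α : RelForm π' r (l + p)}
    (hα : α ∈ contactBar π' r p l) : Ψ.pullback α ∈ contactBar π r p l := by
  intro η₀
  obtain ⟨α', h, e⟩ := hα (Ψ.jetMap r η₀)
  refine ⟨Ψ.pullback α', ?_, ?_⟩
  · clear e
    induction h using Submodule.span_induction with
    | mem δ hδ =>
      obtain ⟨γ, hγ, β, hβ, rfl⟩ := hδ
      exact Submodule.subset_span ⟨_, Ψ.pullback_mem_contactForms hγ, _,
        Ψ.pullback_mem_barForms hβ, Ψ.pullback_wedge γ β⟩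
    | zero => exact zero_mem _
    | add x y _ _ hx hy => exact add_mem hx hy
    | smul g x _ hx =>
      rw [pullback_smul]
      exact Submodule.smul_mem _ _ hx
  · filter_upwards [Ψ.contMDiff_jetMap.continuous.continuousAt.eventually e] with η e θ hθ
    rw [pullback_apply, pullback_apply, e _ ((Ψ.proj_jetMap θ).trans (congrArg _ hθ))]

end FibredIso

end Naturality
end FiniteJet

end

/-! ### The isomorphism and its naturality -/

open FiniteJet in
theorem mainTheorem11 {B F M E E' : Type*}
    [NormedAddCommGroup B] [NormedSpace ℝ B] [FiniteDimensional ℝ B]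
    [NormedAddCommGroup F] [NormedSpace ℝ F] [FiniteDimensional ℝ F]
    [TopologicalSpace M] [T2Space M] [SecondCountableTopology M]
    [ChartedSpace B M] [IsManifold 𝓘(ℝ, B) ∞ M]
    [TopologicalSpace E] [T2Space E] [SecondCountableTopology E]
    [ChartedSpace (B × F) E] [IsManifold 𝓘(ℝ, B × F) ∞ E]
    [TopologicalSpace E'] [T2Space E'] [SecondCountableTopology E']
    [ChartedSpace (B × F) E'] [IsManifold 𝓘(ℝ, B × F) ∞ E']
    (π : FibredManifold B F M E) (r p l : ℕ) :
    (∃ Φ : contactBar π r p l ≃ₗ[JetFun π r] CDiffAlt π r p l,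
      ∀ (α : contactBar π r p l) (φ : Fin p → VertField π),
        ((Φ α).1 φ).1 = nabla α.1 φ) ∧
    (∀ (π' : FibredManifold B F M E') (Ψ : FibredIso π π'), ∀ α' ∈ contactBar π' r p l,
      Ψ.pullback α' ∈ contactBar π r p l ∧
      ∀ (φ : Fin p → VertField π) (φ' : Fin p → VertField π'), (∀ i, Ψ.Related (φ i) (φ' i)) →
        Ψ.pullback (nabla α' φ') = nabla (Ψ.pullback α') φ) := by
  refine ⟨⟨LinearEquiv.ofBijective nablaHom ⟨nablaHom_injective, nablaHom_surjective⟩,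
    fun _ _ => rfl⟩, fun π' Ψ α' hα' => ⟨Ψ.pullback_mem_contactBar hα', fun φ φ' h =>
      Ψ.pullback_nabla α' h⟩⟩
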